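/- Let $n\ge 1$ and let $k$ be a field whose characteristic does not divide $n$ and which contains all $n$-th roots of unity. Let $\mu_n\subset k^*$ be the group of $n$-th roots of unity (cyclic of order $n$) and let $\mathbf{B}\mu_{n,k}$ be its classifying stack over $k$, whose objects over a $k$-scheme are the étale $\mu_n$-torsors on it. An Azumaya algebra on $\mathbf{B}\mu_{n,k}$ is a quasi-coherent $\mathcal{O}$-algebra that is étale locally isomorphic to the matrix algebra $M_m(\mathcal{O})$ for some $m\ge 1$. Its class in the Brauer group is denoted $[\mathcal{A}]\in\mathrm{Br}(\mathbf{B}\mu_{n,k})$: here $[\mathcal{A}]=[\mathcal{B}]$ iff $\mathcal{A}\otimes\mathcal{E}nd(E)\cong\mathcal{B}\otimes\mathcal{E}nd(F)$ for some vector bundles $E,F$ of positive rank, and $[\mathcal{A}]+[\mathcal{B}]=[\mathcal{A}\otimes\mathcal{B}]$, $-[\mathcal{A}]=[\mathcal{A}^{\mathrm{op}}]$. Two Azumaya algebras $\mathcal{A},\mathcal{B}$ are Morita equivalent if the categories $\mathrm{Coh}(\mathbf{B}\mu_{n,k},\mathcal{A})$ and $\mathrm{Coh}(\mathbf{B}\mu_{n,k},\mathcal{B})$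 of coherent right modules are equivalent as $k$-linear abelian categories. Theorem. Assume $\mathrm{Br}(k)=0$. Then $\mathrm{Br}(\mathbf{B}\mu_{n,k})\cong k^*/k^{*n}$, and for all Azumaya algebras $\mathcal{A},\mathcal{B}$ on $\mathbf{B}\mu_{n,k}$: 1. $\mathcal{A}$ and $\mathcal{B}$ are Morita equivalent if and only if $[\mathcal{A}]$ and $[\mathcal{B}]$ generate the same subgroup of $\mathrm{Br}(\mathbf{B}\mu_{n,k})$. 2. $\mathcal{A}$ and $\mathcal{B}$ are Morita equivalent if and only if there is an automorphism $\varphi:\mathbf{B}\mu_{n,k}\to\mathbf{B}\mu_{n,k}$ over $k$ with $[\mathcal{A}]=[\varphi^*\mathcal{B}]$ in $\mathrm{Br}(\mathbf{B}\mu_{n,k})$. -/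

import Mathlib

open scoped TensorProduct
open MulOpposite
universe u

section Descent

theorem finite_projective_of_faithfullyFlat {R S M : Type*} [CommRing R] [CommRing S] [Algebra R S]
    [Module.FaithfullyFlat R S] [AddCommGroup M] [Module R M]
    [Module.Finite S (S ⊗[R] M)] [Module.Projective S (S ⊗[R] M)] :
    Module.Finite R M ∧ Module.Projective R M := by
  have hfin : Module.Finite R M := .of_finite_tensorProduct_of_faithfullyFlat S
  have : Module.Flat R M := Module.Flat.of_flat_tensorProduct R M S
  obtain ⟨n, π, hπ⟩ := Module.Finite.exists_fin' R M
  let K := LinearMap.ker π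
  have hex : Function.Exact K.subtype π := LinearMap.exact_subtype_ker_map π
  let ι' := TensorProduct.AlgebraTensorModule.lTensor S S K.subtype
  let π' := TensorProduct.AlgebraTensorModule.lTensor S S π
  have hex' : Function.Exact ι' π' := lTensor_exact S hex hπ
  have hinj : Function.Injective ι' :=
    Module.Flat.lTensor_preserves_injective_linearMap K.subtype K.injective_subtype
  have hsurj : Function.Surjective π' := LinearMap.lTensor_surjective S hπ
  have hFP : Module.FinitePresentation S (S ⊗[R] M) :=
    Module.finitePresentation_of_projective S _
  have hker : (LinearMap.ker π').FG := Module.FinitePresentation.fg_ker π' hsurj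
  have hrange : LinearMap.range ι' = LinearMap.ker π' := (LinearMap.exact_iff.mp hex').symm
  have : Module.Finite S (S ⊗[R] K) := by
    have h1 : Module.Finite S (LinearMap.range ι') := by
      rw [hrange]; exact Module.Finite.iff_fg.mpr hker
    exact Module.Finite.equiv (LinearEquiv.ofInjective ι' hinj).symm
  have hK : Module.Finite R K := .of_finite_tensorProduct_of_faithfullyFlat S
  have : Module.FinitePresentation R M :=
    Module.finitePresentation_of_surjective π hπ (Module.Finite.iff_fg.mp hK)
  exact ⟨hfin, Module.Flat.projective_of_finitePresentation⟩

theorem mulLeftRight_bijective_of_faithfullyFlat {R S A : Type*} [CommRing R] [CommRing S]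
    [Algebra R S] [Module.FaithfullyFlat R S] [Ring A] [Algebra R A] {m : ℕ} (hm : 0 < m)
    (e : S ⊗[R] A ≃ₐ[S] Matrix (Fin m) (Fin m) S) :
    Function.Bijective (AlgHom.mulLeftRight R A) := by
  have : Nonempty (Fin m) := ⟨⟨0, hm⟩⟩
  have hAz : IsAzumaya S (S ⊗[R] A) :=
    have := IsAzumaya.matrix S (Fin m); IsAzumaya.of_AlgEquiv (R := S) _ _ e.symm
  obtain ⟨_, _⟩ := finite_projective_of_faithfullyFlat (R := R) (S := S) (M := A)
  have tp : ∀ (s s' : S) (f : A →ₗ[R] A) (a : A),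
      LinearMap.tensorProduct R S A A (s ⊗ₜ f) (s' ⊗ₜ a) = (s * s') ⊗ₜ f a := fun _ _ _ _ => rfl
  have hL : Function.Injective (LinearMap.tensorProduct R S A A) := by
    intro x y hxy
    apply (lTensorHomEquivHomLTensor R A S A).injective
    have key : ∀ z : S ⊗[R] (A →ₗ[R] A), ∀ a : A,
        lTensorHomEquivHomLTensor R A S A z a = LinearMap.tensorProduct R S A A z (1 ⊗ₜ a) := by
      intro z a
      rw [lTensorHomEquivHomLTensor_apply]
      induction z with
      | zero => simp
      | add z w hz hw => simp only [map_add, LinearMap.add_apply, hz, hw]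
      | tmul s f => rw [tp]; simp
    ext a
    rw [key, key, hxy]
  let op1 : S ⊗[R] Aᵐᵒᵖ ≃ₗ[S] (S ⊗[R] A)ᵐᵒᵖ :=
    (TensorProduct.AlgebraTensorModule.congr (LinearEquiv.refl S S)
      (opLinearEquiv R).symm).trans (opLinearEquiv S)
  let E : S ⊗[R] (A ⊗[R] Aᵐᵒᵖ) ≃ₗ[S] (S ⊗[R] A) ⊗[S] (S ⊗[R] A)ᵐᵒᵖ :=
    (TensorProduct.AlgebraTensorModule.distribBaseChange R S A Aᵐᵒᵖ).trans
      (TensorProduct.congr (LinearEquiv.refl S _) op1)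
  let μ : S ⊗[R] (A ⊗[R] Aᵐᵒᵖ) →ₗ[S] S ⊗[R] Module.End R A :=
    TensorProduct.AlgebraTensorModule.lTensor S S (AlgHom.mulLeftRight R A).toLinearMap
  have hcomm : ∀ z, LinearMap.tensorProduct R S A A (μ z) =
      AlgHom.mulLeftRight S (S ⊗[R] A) (E z) := by
    intro z
    induction z with
    | zero => simp
    | add z w hz hw => simp only [map_add, hz, hw]
    | tmul s t =>
      induction t with
      | zero => simp
      | add z w hz hw => simp only [TensorProduct.tmul_add, map_add, hz, hw]
      | tmul a b =>
        apply LinearMap.ext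
        intro w
        induction w with
        | zero => simp
        | add z w hz hw => simp only [map_add, hz, hw]
        | tmul s' a' =>
          have h1 : μ (s ⊗ₜ (a ⊗ₜ b)) = s ⊗ₜ AlgHom.mulLeftRight R A (a ⊗ₜ b) := rfl
          rw [h1, tp]
          simp [E, op1, AlgHom.mulLeftRight_apply]
  have hbij := hAz.bij.comp E.bijective
  have hμ : Function.Bijective μ := by
    constructor
    · intro x y hxy
      apply hbij.1
      simp only [Function.comp_apply, ← hcomm, hxy]
    · intro y
      obtain ⟨x, hx⟩ := hbij.2 (LinearMap.tensorProduct R S A A y)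
      exact ⟨x, hL (by rw [hcomm]; exact hx)⟩
  exact (Module.FaithfullyFlat.lTensor_bijective_iff_bijective R S
    (AlgHom.mulLeftRight R A).toLinearMap).mp hμ

theorem endTensorEnd_bijective {R M N : Type*} [CommRing R] [AddCommGroup M] [Module R M]
    [AddCommGroup N] [Module R N] [Module.Finite R M] [Module.Projective R M]
    [Module.Finite R N] [Module.Projective R N] :
    Function.Bijective
      (Module.endTensorEndAlgHom (R := R) (S := R) (A := R) (M := M) (N := N)) := by
  have h := (homTensorHomEquiv R M N M N).bijective
  convert h using 1
  ext x
  rw [homTensorHomEquiv_apply]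
  rfl

end Descent

namespace BG

/-! ### Torsors and the classifying stack -/

/-- For a group `G` acting on a commutative `R`-algebra `T` by `R`-algebra automorphisms, the map
`T ⊗[R] T → ∏_G T`, `a ⊗ b ↦ (a * g b)_g`.  On spectra it is the map
`G × Spec T → Spec T ×_R Spec T` given by the projection and the action. -/
noncomputable def translationMap (G R T : Type u) [Group G] [CommRing R] [CommRing T] [Algebra R T]
    [MulSemiringAction G T] [SMulCommClass G R T] : T ⊗[R] T →ₐ[R] (G → T) :=
  AlgHom.pi fun g : G =>
    Algebra.TensorProduct.productMap (AlgHom.id R T) (MulSemiringAction.toAlgHom R T g)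

/-- A torsor over `Spec R` under a finite (constant) group `G`.  It is an affine scheme `Spec T`
which is étale and surjective over `Spec R`, with an action of `G` over `R` for which
`G × Spec T → Spec T ×_R Spec T` is an isomorphism. -/
structure Torsor (G : Type u) [Group G] (R : Type u) [CommRing R] where
  /-- the ring of functions on the torsor -/
  carrier : Type u
  [commRing : CommRing carrier]
  [algebra : Algebra R carrier]
  [action : MulSemiringAction G carrier]
  [smulComm : SMulCommClass G R carrier]
  etale : Algebra.Etale R carrier
  faithfullyFlat : Module.FaithfullyFlat R carrier
  bijective : Function.Bijective (translationMap G R carrier)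

attribute [instance] Torsor.commRing Torsor.algebra Torsor.action Torsor.smulComm

/-- Let `f : R → R'` be a map of `k`-algebras.  A morphism of `BG` over
`Spec R' → Spec R` from the torsor `P'` on `Spec R'` to the torsor `P` on `Spec R`, written in terms
of rings: a `G`-equivariant ring map `P → P'` over `f`.  (Such a map automatically identifies `P'`
with the base change of `P`.) -/
@[ext]
structure TorsorHom {k G : Type u} [Field k] [Group G] {R R' : Type u} [CommRing R] [Algebra k R]
    [CommRing R'] [Algebra k R'] (f : R →ₐ[k] R') (P : Torsor G R) (P' : Torsor G R') where
  /-- the map on functions -/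
  toRingHom : P.carrier →+* P'.carrier
  map_algebraMap : ∀ r : R, toRingHom (algebraMap R P.carrier r) = algebraMap R' P'.carrier (f r)
  map_smul : ∀ (g : G) (x : P.carrier), toRingHom (g • x) = g • toRingHom x

/-- The identity of a torsor. -/
def TorsorHom.id (k : Type u) {G : Type u} [Field k] [Group G] {R : Type u} [CommRing R]
    [Algebra k R] (P : Torsor G R) : TorsorHom (AlgHom.id k R) P P where
  toRingHom := RingHom.id _
  map_algebraMap _ := rfl
  map_smul _ _ := rfl

/-- Composition of morphisms of torsors, covering the composition of maps of base rings. -/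
def TorsorHom.comp {k G : Type u} [Field k] [Group G] {R R' R'' : Type u} [CommRing R] [Algebra k R]
    [CommRing R'] [Algebra k R'] [CommRing R''] [Algebra k R''] {f : R →ₐ[k] R'}
    {f' : R' →ₐ[k] R''} {P : Torsor G R} {P' : Torsor G R'} {P'' : Torsor G R''}
    (h' : TorsorHom f' P' P'') (h : TorsorHom f P P') : TorsorHom (f'.comp f) P P'' where
  toRingHom := h'.toRingHom.comp h.toRingHom
  map_algebraMap r := by simp [h.map_algebraMap, h'.map_algebraMap]
  map_smul g x := by simp [h.map_smul, h'.map_smul]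

/-! ### Automorphisms of the classifying stack -/

/-- A morphism `BG → BG` of stacks over `Spec k`: a functor of fibred categories over the category
of affine `k`-schemes, i.e. a functor that covers the identity of the base category. -/
structure StackMap (k G : Type u) [Field k] [Group G] where
  /-- the functor on objects -/
  obj : ∀ {R : Type u} [CommRing R] [Algebra k R], Torsor G R → Torsor G R
  /-- the functor on morphisms -/
  map : ∀ {R R' : Type u} [CommRing R] [Algebra k R] [CommRing R'] [Algebra k R']
    {f : R →ₐ[k] R'} {P : Torsor G R} {P' : Torsor G R'},
    TorsorHom f P P' → TorsorHom f (obj P) (obj P')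
  map_id : ∀ {R : Type u} [CommRing R] [Algebra k R] (P : Torsor G R),
    map (TorsorHom.id k P) = TorsorHom.id k (obj P)
  map_comp : ∀ {R R' R'' : Type u} [CommRing R] [Algebra k R]
    [CommRing R'] [Algebra k R'] [CommRing R''] [Algebra k R''] {f : R →ₐ[k] R'}
    {f' : R' →ₐ[k] R''} {P : Torsor G R} {P' : Torsor G R'} {P'' : Torsor G R''}
    (h' : TorsorHom f' P' P'') (h : TorsorHom f P P'),
    map (h'.comp h) = (map h').comp (map h)

/-- The identity of the stack `BG`. -/
def StackMap.id (k G : Type u) [Field k] [Group G] : StackMap k G where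
  obj P := P
  map h := h
  map_id _ := rfl
  map_comp _ _ := rfl

/-- Composition of morphisms of stacks. -/
def StackMap.comp {k G : Type u} [Field k] [Group G] (ψ φ : StackMap k G) : StackMap k G where
  obj P := ψ.obj (φ.obj P)
  map h := ψ.map (φ.map h)
  map_id P := by rw [φ.map_id, ψ.map_id]
  map_comp h' h := by rw [φ.map_comp, ψ.map_comp]

/-- A 2-morphism between morphisms of stacks: a natural transformation over the identity of the
base.  (As `BG` is fibred in groupoids, it is automatically invertible.) -/
structure StackTrans {k G : Type u} [Field k] [Group G] (φ ψ : StackMap k G) where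
  /-- the components -/
  app : ∀ {R : Type u} [CommRing R] [Algebra k R] (P : Torsor G R),
    TorsorHom (AlgHom.id k R) (φ.obj P) (ψ.obj P)
  naturality : ∀ {R R' : Type u} [CommRing R] [Algebra k R] [CommRing R'] [Algebra k R']
    {f : R →ₐ[k] R'} {P : Torsor G R} {P' : Torsor G R'} (h : TorsorHom f P P')
    (x : (φ.obj P).carrier),
    (app P').toRingHom ((φ.map h).toRingHom x) = (ψ.map h).toRingHom ((app P).toRingHom x)

/-- An automorphism of the stack `BG` over `k`: a self-equivalence of the fibred category, i.e. a
morphism of stacks with a quasi-inverse. -/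
structure StackAut (k G : Type u) [Field k] [Group G] where
  /-- the morphism -/
  hom : StackMap k G
  /-- a quasi-inverse -/
  inv : StackMap k G
  /-- `inv ∘ hom ≅ id` -/
  unit : StackTrans (inv.comp hom) (StackMap.id k G)
  /-- `hom ∘ inv ≅ id` -/
  counit : StackTrans (hom.comp inv) (StackMap.id k G)

/-! ### Quasi-coherent sheaves on the classifying stack -/

/-- Along `f : R → R'`, the map `g : M → N` exhibits the `R'`-module `N` as `R' ⊗[R] M`. -/
def IsBaseChangeAlong {k R R' M N : Type u} [Field k] [CommRing R] [Algebra k R] [CommRing R']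
    [Algebra k R'] (f : R →ₐ[k] R') [AddCommGroup M] [Module R M] [AddCommGroup N] [Module R' N]
    (g : M →+ N) : Prop :=
  letI : Algebra R R' := f.toRingHom.toAlgebra
  ∃ e : R' ⊗[R] M ≃ₗ[R'] N, ∀ x : M, e (1 ⊗ₜ[R] x) = g x

/-- A quasi-coherent sheaf on `BG` (over `k`): for every morphism `P : Spec R → BG` an `R`-module
of sections, with restriction maps for all morphisms of `BG`, compatible with composition and
exhibiting each module as the base change of the other. -/
structure QCohSheaf (k G : Type u) [Field k] [Group G] where
  /-- the sections of the pullback to `Spec R` -/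
  sec : ∀ {R : Type u} [CommRing R] [Algebra k R], Torsor G R → Type u
  [addCommGroup : ∀ {R : Type u} [CommRing R] [Algebra k R] (P : Torsor G R), AddCommGroup (sec P)]
  [module : ∀ {R : Type u} [CommRing R] [Algebra k R] (P : Torsor G R), Module R (sec P)]
  /-- the restriction maps -/
  res : ∀ {R R' : Type u} [CommRing R] [Algebra k R] [CommRing R'] [Algebra k R']
    {f : R →ₐ[k] R'} {P : Torsor G R} {P' : Torsor G R'}, TorsorHom f P P' → sec P →+ sec P'
  res_smul : ∀ {R R' : Type u} [CommRing R] [Algebra k R] [CommRing R'] [Algebra k R']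
    {f : R →ₐ[k] R'} {P : Torsor G R} {P' : Torsor G R'} (h : TorsorHom f P P') (r : R) (x : sec P),
    res h (r • x) = f r • res h x
  res_id : ∀ {R : Type u} [CommRing R] [Algebra k R] (P : Torsor G R) (x : sec P),
    res (TorsorHom.id k P) x = x
  res_comp : ∀ {R R' R'' : Type u} [CommRing R] [Algebra k R]
    [CommRing R'] [Algebra k R'] [CommRing R''] [Algebra k R''] {f : R →ₐ[k] R'}
    {f' : R' →ₐ[k] R''} {P : Torsor G R} {P' : Torsor G R'} {P'' : Torsor G R''}
    (h' : TorsorHom f' P' P'') (h : TorsorHom f P P') (x : sec P),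
    res (h'.comp h) x = res h' (res h x)
  baseChange : ∀ {R R' : Type u} [CommRing R] [Algebra k R] [CommRing R'] [Algebra k R']
    {f : R →ₐ[k] R'} {P : Torsor G R} {P' : Torsor G R'} (h : TorsorHom f P P'),
    IsBaseChangeAlong f (res h)

attribute [instance] QCohSheaf.addCommGroup QCohSheaf.module

/-- A quasi-coherent sheaf of (associative, unital) `O`-algebras on `BG`. -/
structure AlgSheaf (k G : Type u) [Field k] [Group G] where
  /-- the sections of the pullback to `Spec R` -/
  sec : ∀ {R : Type u} [CommRing R] [Algebra k R], Torsor G R → Type u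
  [ring : ∀ {R : Type u} [CommRing R] [Algebra k R] (P : Torsor G R), Ring (sec P)]
  [algebra : ∀ {R : Type u} [CommRing R] [Algebra k R] (P : Torsor G R), Algebra R (sec P)]
  /-- the restriction maps -/
  res : ∀ {R R' : Type u} [CommRing R] [Algebra k R] [CommRing R'] [Algebra k R']
    {f : R →ₐ[k] R'} {P : Torsor G R} {P' : Torsor G R'}, TorsorHom f P P' → sec P →+* sec P'
  res_algebraMap : ∀ {R R' : Type u} [CommRing R] [Algebra k R] [CommRing R'] [Algebra k R']
    {f : R →ₐ[k] R'} {P : Torsor G R} {P' : Torsor G R'} (h : TorsorHom f P P') (r : R),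
    res h (algebraMap R (sec P) r) = algebraMap R' (sec P') (f r)
  res_id : ∀ {R : Type u} [CommRing R] [Algebra k R] (P : Torsor G R) (x : sec P),
    res (TorsorHom.id k P) x = x
  res_comp : ∀ {R R' R'' : Type u} [CommRing R] [Algebra k R]
    [CommRing R'] [Algebra k R'] [CommRing R''] [Algebra k R''] {f : R →ₐ[k] R'}
    {f' : R' →ₐ[k] R''} {P : Torsor G R} {P' : Torsor G R'} {P'' : Torsor G R''}
    (h' : TorsorHom f' P' P'') (h : TorsorHom f P P') (x : sec P),
    res (h'.comp h) x = res h' (res h x)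
  baseChange : ∀ {R R' : Type u} [CommRing R] [Algebra k R] [CommRing R'] [Algebra k R']
    {f : R →ₐ[k] R'} {P : Torsor G R} {P' : Torsor G R'} (h : TorsorHom f P P'),
    IsBaseChangeAlong f (res h).toAddMonoidHom

attribute [instance] AlgSheaf.ring AlgSheaf.algebra

/-- An isomorphism of sheaves of algebras. -/
structure AlgSheaf.Iso {k G : Type u} [Field k] [Group G] (A B : AlgSheaf k G) where
  /-- the components -/
  app : ∀ {R : Type u} [CommRing R] [Algebra k R] (P : Torsor G R), A.sec P ≃ₐ[R] B.sec P
  naturality : ∀ {R R' : Type u} [CommRing R] [Algebra k R] [CommRing R'] [Algebra k R']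
    {f : R →ₐ[k] R'} {P : Torsor G R} {P' : Torsor G R'} (h : TorsorHom f P P') (x : A.sec P),
    app P' (A.res h x) = B.res h (app P x)

section Operations

variable {k G : Type u} [Field k] [Group G]

theorem AlgSheaf.res_smul (A : AlgSheaf k G) {R R' : Type u} [CommRing R] [Algebra k R]
    [CommRing R'] [Algebra k R'] {f : R →ₐ[k] R'} {P : Torsor G R} {P' : Torsor G R'}
    (h : TorsorHom f P P') (r : R) (x : A.sec P) : A.res h (r • x) = f r • A.res h x := by
  rw [Algebra.smul_def, Algebra.smul_def, map_mul, A.res_algebraMap]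

/-- The quasi-coherent sheaf underlying a sheaf of algebras. -/
abbrev AlgSheaf.toQCohSheaf (A : AlgSheaf k G) : QCohSheaf k G where
  sec P := A.sec P
  res h := (A.res h).toAddMonoidHom
  res_smul h r x := A.res_smul h r x
  res_id P x := A.res_id P x
  res_comp h' h x := A.res_comp h' h x
  baseChange h := A.baseChange h

/-- The pullback of a sheaf of algebras along a morphism of stacks. -/
abbrev AlgSheaf.pullback (φ : StackMap k G) (A : AlgSheaf k G) : AlgSheaf k G where
  sec P := A.sec (φ.obj P)
  res h := A.res (φ.map h)
  res_algebraMap h r := A.res_algebraMap (φ.map h) r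
  res_id P x := by rw [φ.map_id, A.res_id]
  res_comp h' h x := by rw [φ.map_comp, A.res_comp]
  baseChange h := A.baseChange (φ.map h)

/-- The structure sheaf. -/
abbrev AlgSheaf.structureSheaf (k G : Type u) [Field k] [Group G] : AlgSheaf k G where
  sec {R} _ _ _ := R
  ring {R} _ _ _ := inferInstance
  algebra {R} _ _ _ := Algebra.id R
  res {_ _ _ _ _ _ f _ _} _ := f.toRingHom
  res_algebraMap _ _ := rfl
  res_id _ _ := rfl
  res_comp _ _ _ := rfl
  baseChange {R R' _ _ _ _ f _ _} _ := by
    let _ : Algebra R R' := f.toRingHom.toAlgebra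
    refine ⟨TensorProduct.AlgebraTensorModule.rid R R' R', fun x => ?_⟩
    rw [TensorProduct.AlgebraTensorModule.rid_tmul, Algebra.smul_def, mul_one]
    rfl

/-- The opposite of a sheaf of algebras. -/
abbrev AlgSheaf.op (A : AlgSheaf k G) : AlgSheaf k G where
  sec P := (A.sec P)ᵐᵒᵖ
  res h := (A.res h).op
  res_algebraMap h r := congrArg MulOpposite.op (A.res_algebraMap h r)
  res_id P x := congrArg MulOpposite.op (A.res_id P x.unop)
  res_comp h' h x := congrArg MulOpposite.op (A.res_comp h' h x.unop)
  baseChange {R R' _ _ _ _ f _ _} h := by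
    let _ : Algebra R R' := f.toRingHom.toAlgebra
    obtain ⟨e, he⟩ := A.baseChange h
    refine ⟨(TensorProduct.AlgebraTensorModule.congr (LinearEquiv.refl R' R')
      (opLinearEquiv R).symm).trans (e.trans (opLinearEquiv R')), fun x => ?_⟩
    simp [he]

/-- The map `M ⊗[R] N → M' ⊗[R'] N'` induced by two maps that are semilinear along `f`. -/
def tensorRes {R R' M N M' N' : Type u} [CommRing R] [Algebra k R] [CommRing R'] [Algebra k R']
    (f : R →ₐ[k] R') [AddCommGroup M] [Module R M] [AddCommGroup N] [Module R N]
    [AddCommGroup M'] [Module R' M'] [AddCommGroup N'] [Module R' N'] (g : M →+ M') (h : N →+ N')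
    (hg : ∀ (r : R) (x : M), g (r • x) = f r • g x)
    (hh : ∀ (r : R) (x : N), h (r • x) = f r • h x) : M ⊗[R] N →+ M' ⊗[R'] N' :=
  TensorProduct.liftAddHom
    (((AddMonoidHom.compHom (M := N) (N := N') (P := M' ⊗[R'] N')).flip h).comp
      ((LinearMap.toAddMonoidHom'.comp (TensorProduct.mk R' M' N').toAddMonoidHom).comp g))
    fun r m n => by simp [hg, hh]

theorem tensorRes_tmul {R R' M N M' N' : Type u} [CommRing R] [Algebra k R] [CommRing R']
    [Algebra k R'] (f : R →ₐ[k] R') [AddCommGroup M] [Module R M] [AddCommGroup N] [Module R N]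
    [AddCommGroup M'] [Module R' M'] [AddCommGroup N'] [Module R' N'] (g : M →+ M') (h : N →+ N')
    (hg : ∀ (r : R) (x : M), g (r • x) = f r • g x)
    (hh : ∀ (r : R) (x : N), h (r • x) = f r • h x) (m : M) (n : N) :
    tensorRes f g h hg hh (m ⊗ₜ n) = g m ⊗ₜ h n := rfl

theorem tensorRes_smul {R R' M N M' N' : Type u} [CommRing R] [Algebra k R] [CommRing R']
    [Algebra k R'] (f : R →ₐ[k] R') [AddCommGroup M] [Module R M] [AddCommGroup N] [Module R N]
    [AddCommGroup M'] [Module R' M'] [AddCommGroup N'] [Module R' N'] (g : M →+ M') (h : N →+ N')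
    (hg : ∀ (r : R) (x : M), g (r • x) = f r • g x)
    (hh : ∀ (r : R) (x : N), h (r • x) = f r • h x) (r : R) (z : M ⊗[R] N) :
    tensorRes f g h hg hh (r • z) = f r • tensorRes f g h hg hh z := by
  induction z with
  | zero => simp
  | add z w hz hw => simp only [smul_add, map_add, hz, hw]
  | tmul m n => rw [TensorProduct.smul_tmul', tensorRes_tmul, tensorRes_tmul, hg,
      TensorProduct.smul_tmul']

theorem tensorRes_baseChange {R R' M N M' N' : Type u} [CommRing R] [Algebra k R] [CommRing R']
    [Algebra k R'] (f : R →ₐ[k] R') [AddCommGroup M] [Module R M] [AddCommGroup N] [Module R N]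
    [AddCommGroup M'] [Module R' M'] [AddCommGroup N'] [Module R' N'] (g : M →+ M') (h : N →+ N')
    (hg : ∀ (r : R) (x : M), g (r • x) = f r • g x)
    (hh : ∀ (r : R) (x : N), h (r • x) = f r • h x)
    (bg : IsBaseChangeAlong f g) (bh : IsBaseChangeAlong f h) :
    IsBaseChangeAlong f (tensorRes f g h hg hh) := by
  let _ : Algebra R R' := f.toRingHom.toAlgebra
  obtain ⟨e₁, he₁⟩ := bg
  obtain ⟨e₂, he₂⟩ := bh
  refine ⟨(TensorProduct.AlgebraTensorModule.distribBaseChange R R' M N).trans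
    (TensorProduct.congr e₁ e₂), fun z => ?_⟩
  induction z with
  | zero => simp
  | add z w hz hw => rw [TensorProduct.tmul_add, map_add, map_add, hz, hw]
  | tmul m n => simp [tensorRes_tmul, he₁, he₂]

/-- The tensor product of quasi-coherent sheaves. -/
noncomputable abbrev QCohSheaf.tensor (E F : QCohSheaf k G) : QCohSheaf k G where
  sec {R} _ _ P := E.sec P ⊗[R] F.sec P
  res {_ _ _ _ _ _ f _ _} h := tensorRes f (E.res h) (F.res h) (E.res_smul h) (F.res_smul h)
  res_smul h r x := tensorRes_smul _ _ _ _ _ r x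
  res_id P x := by
    induction x with
    | zero => simp
    | add z w hz hw => rw [map_add, hz, hw]
    | tmul m n => rw [tensorRes_tmul, E.res_id, F.res_id]
  res_comp h' h x := by
    induction x with
    | zero => simp
    | add z w hz hw => rw [map_add, map_add, map_add, hz, hw]
    | tmul m n => rw [tensorRes_tmul, tensorRes_tmul, tensorRes_tmul, E.res_comp, F.res_comp]
  baseChange h := tensorRes_baseChange _ _ _ _ _ (E.baseChange h) (F.baseChange h)

/-- The tensor product of sheaves of algebras. -/
noncomputable abbrev AlgSheaf.tensor (A B : AlgSheaf k G) : AlgSheaf k G where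
  sec {R} _ _ P := A.sec P ⊗[R] B.sec P
  res {_ _ _ _ _ _ f _ _} h :=
    { toFun := tensorRes f (A.res h).toAddMonoidHom (B.res h).toAddMonoidHom (A.res_smul h)
        (B.res_smul h)
      map_zero' := map_zero _
      map_add' := map_add _
      map_one' := by
        rw [Algebra.TensorProduct.one_def, tensorRes_tmul]
        simp [Algebra.TensorProduct.one_def]
      map_mul' := fun x y => by
        induction x with
        | zero => simp
        | add z w hz hw => simp only [add_mul, map_add, hz, hw]
        | tmul a b =>
          induction y with
          | zero => simp
          | add z w hz hw => simp only [mul_add, map_add, hz, hw]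
          | tmul c d =>
            simp [tensorRes_tmul, Algebra.TensorProduct.tmul_mul_tmul] }
  res_algebraMap {R R' _ _ _ _ f P P'} h r := by
    change tensorRes f (A.res h).toAddMonoidHom (B.res h).toAddMonoidHom (A.res_smul h)
        (B.res_smul h) (algebraMap R (A.sec P ⊗[R] B.sec P) r) = _
    rw [Algebra.TensorProduct.algebraMap_apply, Algebra.TensorProduct.algebraMap_apply,
      tensorRes_tmul]
    simp [A.res_algebraMap]
  res_id P x := (A.toQCohSheaf.tensor B.toQCohSheaf).res_id P x
  res_comp h' h x := (A.toQCohSheaf.tensor B.toQCohSheaf).res_comp h' h x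
  baseChange h := (A.toQCohSheaf.tensor B.toQCohSheaf).baseChange h

theorem AlgSheaf.tensor_res_tmul (A B : AlgSheaf k G) {R R' : Type u} [CommRing R] [Algebra k R]
    [CommRing R'] [Algebra k R'] {f : R →ₐ[k] R'} {P : Torsor G R} {P' : Torsor G R'}
    (h : TorsorHom f P P') (a : A.sec P) (b : B.sec P) :
    (A.tensor B).res h (a ⊗ₜ[R] b) = A.res h a ⊗ₜ[R'] B.res h b := rfl

end Operations

/-! ### Azumaya algebras, vector bundles, Brauer equivalence -/

/-- The `R`-algebra `A` becomes isomorphic to the algebra of `m × m` matrices on some étale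
cover `Spec S → Spec R`. -/
def IsEtaleLocallyMatrix (R A : Type u) [CommRing R] [Ring A] [Algebra R A] (m : ℕ) : Prop :=
  ∃ (S : Type u) (_ : CommRing S) (_ : Algebra R S), Algebra.Etale R S ∧
    Module.FaithfullyFlat R S ∧ Nonempty (S ⊗[R] A ≃ₐ[S] Matrix (Fin m) (Fin m) S)

/-- The `R`-module `M` becomes free of rank `m` on some étale cover `Spec S → Spec R`. -/
def IsEtaleLocallyFree (R M : Type u) [CommRing R] [AddCommGroup M] [Module R M] (m : ℕ) : Prop :=
  ∃ (S : Type u) (_ : CommRing S) (_ : Algebra R S), Algebra.Etale R S ∧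
    Module.FaithfullyFlat R S ∧ Nonempty (S ⊗[R] M ≃ₗ[S] (Fin m → S))

section EtaleLocal

variable {R : Type u} [CommRing R]

theorem exists_common_etale_cover (S₁ S₂ : Type u) [CommRing S₁] [Algebra R S₁] [CommRing S₂]
    [Algebra R S₂] [Algebra.Etale R S₁] [Algebra.Etale R S₂] [Module.FaithfullyFlat R S₁]
    [Module.FaithfullyFlat R S₂] : Algebra.Etale R (S₁ ⊗[R] S₂) ∧
      Module.FaithfullyFlat R (S₁ ⊗[R] S₂) :=
  ⟨Algebra.Etale.comp R S₁ (S₁ ⊗[R] S₂), Module.FaithfullyFlat.trans R S₁ (S₁ ⊗[R] S₂)⟩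

theorem matrix_baseChange {S S' A : Type u} [CommRing S] [Algebra R S] [CommRing S'] [Algebra R S']
    [Algebra S S'] [IsScalarTower R S S'] [Ring A] [Algebra R A] {m : ℕ}
    (e : S ⊗[R] A ≃ₐ[S] Matrix (Fin m) (Fin m) S) :
    Nonempty (S' ⊗[R] A ≃ₐ[S'] Matrix (Fin m) (Fin m) S') := by
  let e₁ : S' ⊗[R] A ≃ₐ[S'] S' ⊗[S] (S ⊗[R] A) :=
    Algebra.TensorProduct.algEquivOfLinearEquivTensorProduct
      (TensorProduct.AlgebraTensorModule.cancelBaseChange R S S' S' A).symm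
      (fun a₁ a₂ b₁ b₂ => by simp [Algebra.TensorProduct.tmul_mul_tmul]) (by
        simp [Algebra.TensorProduct.one_def])
  let e₂ : S' ⊗[S] (S ⊗[R] A) ≃ₐ[S'] S' ⊗[S] Matrix (Fin m) (Fin m) S :=
    Algebra.TensorProduct.congr AlgEquiv.refl e
  let e₃ : Matrix (Fin m) (Fin m) S' ≃ₐ[S'] S' ⊗[S] Matrix (Fin m) (Fin m) S :=
    AlgEquiv.ofRingEquiv (f := (matrixEquivTensor (Fin m) S S').toRingEquiv) fun r => by
      change matrixEquivTensor (Fin m) S S' _ = _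
      rw [← AlgEquiv.eq_symm_apply, Algebra.TensorProduct.algebraMap_apply]
      simp [Matrix.algebraMap_eq_diagonal, Matrix.smul_one_eq_diagonal]
  exact ⟨(e₁.trans e₂).trans e₃.symm⟩

theorem free_baseChange {S S' M : Type u} [CommRing S] [Algebra R S] [CommRing S'] [Algebra R S']
    [Algebra S S'] [IsScalarTower R S S'] [AddCommGroup M] [Module R M] {m : ℕ}
    (e : S ⊗[R] M ≃ₗ[S] (Fin m → S)) :
    Nonempty (S' ⊗[R] M ≃ₗ[S'] (Fin m → S')) :=
  ⟨((TensorProduct.AlgebraTensorModule.cancelBaseChange R S S' S' M).symm.trans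
    (TensorProduct.AlgebraTensorModule.congr (LinearEquiv.refl S' S') e)).trans
      (TensorProduct.piScalarRight S S' S' (Fin m))⟩

/-- Base change commutes with tensor products of algebras. -/
noncomputable def distribBaseChangeAlg (S A B : Type u) [CommRing S] [Algebra R S] [Ring A]
    [Algebra R A] [Ring B] [Algebra R B] :
    S ⊗[R] (A ⊗[R] B) ≃ₐ[S] (S ⊗[R] A) ⊗[S] (S ⊗[R] B) :=
  Algebra.TensorProduct.algEquivOfLinearEquivTensorProduct
    (TensorProduct.AlgebraTensorModule.distribBaseChange R S A B)
    (fun s₁ s₂ x y => by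
      induction x with
      | zero => simp
      | add z w hz hw => simp only [TensorProduct.tmul_add, add_mul, map_add, hz, hw]
      | tmul a b =>
        induction y with
        | zero => simp
        | add z w hz hw => simp only [TensorProduct.tmul_add, mul_add, map_add, hz, hw]
        | tmul c d => simp [Algebra.TensorProduct.tmul_mul_tmul])
    (by simp [Algebra.TensorProduct.one_def])

theorem IsEtaleLocallyMatrix.tensor {A B : Type u} [Ring A] [Algebra R A] [Ring B] [Algebra R B]
    {m m' : ℕ} (hA : IsEtaleLocallyMatrix R A m) (hB : IsEtaleLocallyMatrix R B m') :
    IsEtaleLocallyMatrix R (A ⊗[R] B) (m * m') := by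
  obtain ⟨S₁, _, _, _, _, ⟨e₁⟩⟩ := hA
  obtain ⟨S₂, _, _, _, _, ⟨e₂⟩⟩ := hB
  obtain ⟨h₁, h₂⟩ := exists_common_etale_cover (R := R) S₁ S₂
  let _ : Algebra S₂ (S₁ ⊗[R] S₂) := Algebra.TensorProduct.rightAlgebra
  obtain ⟨e₁'⟩ := matrix_baseChange (S' := S₁ ⊗[R] S₂) e₁
  obtain ⟨e₂'⟩ := matrix_baseChange (S' := S₁ ⊗[R] S₂) e₂
  refine ⟨S₁ ⊗[R] S₂, inferInstance, inferInstance, h₁, h₂, ⟨?_⟩⟩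
  exact ((distribBaseChangeAlg _ A B).trans (Algebra.TensorProduct.congr e₁' e₂')).trans
    ((Matrix.kroneckerAlgEquiv (Fin m) (Fin m') _).trans (Matrix.reindexAlgEquiv _ _ finProdFinEquiv))

theorem IsEtaleLocallyMatrix.op {A : Type u} [Ring A] [Algebra R A]
    {m : ℕ} (hA : IsEtaleLocallyMatrix R A m) : IsEtaleLocallyMatrix R Aᵐᵒᵖ m := by
  obtain ⟨S, _, _, h₁, h₂, ⟨e⟩⟩ := hA
  refine ⟨S, inferInstance, inferInstance, h₁, h₂, ⟨?_⟩⟩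
  have e₁ : S ⊗[R] Aᵐᵒᵖ ≃ₐ[S] (S ⊗[R] A)ᵐᵒᵖ :=
    (Algebra.TensorProduct.congr (AlgEquiv.toOpposite S S) AlgEquiv.refl).trans
      (Algebra.TensorProduct.opAlgEquiv R S S A)
  exact (e₁.trans e.op).trans (Matrix.transposeAlgEquiv (Fin m) S S).symm

theorem IsEtaleLocallyFree.tensor {M N : Type u} [AddCommGroup M] [Module R M] [AddCommGroup N]
    [Module R N] {m m' : ℕ} (hM : IsEtaleLocallyFree R M m) (hN : IsEtaleLocallyFree R N m') :
    IsEtaleLocallyFree R (M ⊗[R] N) (m * m') := by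
  obtain ⟨S₁, _, _, _, _, ⟨e₁⟩⟩ := hM
  obtain ⟨S₂, _, _, _, _, ⟨e₂⟩⟩ := hN
  obtain ⟨h₁, h₂⟩ := exists_common_etale_cover (R := R) S₁ S₂
  let _ : Algebra S₂ (S₁ ⊗[R] S₂) := Algebra.TensorProduct.rightAlgebra
  obtain ⟨e₁'⟩ := free_baseChange (S' := S₁ ⊗[R] S₂) e₁
  obtain ⟨e₂'⟩ := free_baseChange (S' := S₁ ⊗[R] S₂) e₂
  refine ⟨S₁ ⊗[R] S₂, inferInstance, inferInstance, h₁, h₂, ⟨?_⟩⟩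
  exact (((TensorProduct.AlgebraTensorModule.distribBaseChange R (S₁ ⊗[R] S₂) M N).trans
    (TensorProduct.congr e₁' e₂')).trans
      (((Pi.basisFun (S₁ ⊗[R] S₂) (Fin m)).tensorProduct
        (Pi.basisFun (S₁ ⊗[R] S₂) (Fin m'))).reindex finProdFinEquiv).equivFun)

theorem IsEtaleLocallyMatrix.free {A : Type u} [Ring A] [Algebra R A]
    {m : ℕ} (hA : IsEtaleLocallyMatrix R A m) : IsEtaleLocallyFree R A (m * m) := by
  obtain ⟨S, _, _, h₁, h₂, ⟨e⟩⟩ := hA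
  exact ⟨S, inferInstance, inferInstance, h₁, h₂,
    ⟨e.toLinearEquiv.trans ((Matrix.stdBasis S (Fin m) (Fin m)).reindex finProdFinEquiv).equivFun⟩⟩

theorem IsEtaleLocallyFree.finite_projective {M : Type u} [AddCommGroup M] [Module R M] {m : ℕ}
    (hM : IsEtaleLocallyFree R M m) : Module.Finite R M ∧ Module.Projective R M := by
  obtain ⟨S, _, _, _, _, ⟨e⟩⟩ := hM
  have : Module.Finite S (S ⊗[R] M) := .equiv e.symm
  have : Module.Projective S (S ⊗[R] M) := .of_equiv e.symm
  exact finite_projective_of_faithfullyFlat (S := S)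

theorem IsEtaleLocallyMatrix.mulLeftRight_bijective {A : Type u} [Ring A] [Algebra R A]
    {m : ℕ} (hm : 0 < m) (hA : IsEtaleLocallyMatrix R A m) :
    Function.Bijective (AlgHom.mulLeftRight R A) := by
  obtain ⟨S, _, _, _, _, ⟨e⟩⟩ := hA
  exact mulLeftRight_bijective_of_faithfullyFlat hm e

end EtaleLocal

/-- An Azumaya algebra on `BG`: a quasi-coherent sheaf of algebras that is étale locally isomorphic
to the sheaf of `m × m` matrices, for some `m ≥ 1`. -/
structure AzumayaAlg (k G : Type u) [Field k] [Group G] extends AlgSheaf k G where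
  azumaya : ∃ m : ℕ, 0 < m ∧ ∀ {R : Type u} [CommRing R] [Algebra k R] (P : Torsor G R),
    IsEtaleLocallyMatrix R (sec P) m

section Brauer

variable {k G : Type u} [Field k] [Group G]

/-- A vector bundle of positive rank on `BG`: a quasi-coherent sheaf that is étale locally free of
some rank `m ≥ 1`. -/
def QCohSheaf.IsVectorBundle (E : QCohSheaf k G) : Prop :=
  ∃ m : ℕ, 0 < m ∧ ∀ {R : Type u} [CommRing R] [Algebra k R] (P : Torsor G R),
    IsEtaleLocallyFree R (E.sec P) m

/-- The sheaf of algebras `𝓔` is (isomorphic to) the sheaf of endomorphisms `End(E)` of the vector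
bundle `E`: it acts on `E` compatibly with restriction, and its sections over `Spec R → BG` are
identified in this way with all the `R`-linear endomorphisms of the sections of `E`. -/
def IsEndSheaf (𝓔 : AlgSheaf k G) (E : QCohSheaf k G) : Prop :=
  ∃ ρ : ∀ {R : Type u} [CommRing R] [Algebra k R] (P : Torsor G R),
      𝓔.sec P ≃ₐ[R] Module.End R (E.sec P),
    ∀ {R R' : Type u} [CommRing R] [Algebra k R] [CommRing R'] [Algebra k R']
      {f : R →ₐ[k] R'} {P : Torsor G R} {P' : Torsor G R'} (h : TorsorHom f P P')
      (a : 𝓔.sec P) (x : E.sec P),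
      E.res h (ρ P a x) = ρ P' (𝓔.res h a) (E.res h x)

/-- `A` and `B` are Brauer equivalent: `A ⊗ End(E) ≅ B ⊗ End(F)` for some vector bundles `E`, `F`
(of positive rank). -/
def BrauerEquiv (A B : AlgSheaf k G) : Prop :=
  ∃ (E F : QCohSheaf k G) (𝓔 𝓕 : AlgSheaf k G), E.IsVectorBundle ∧ F.IsVectorBundle ∧
    IsEndSheaf 𝓔 E ∧ IsEndSheaf 𝓕 F ∧ Nonempty ((A.tensor 𝓔).Iso (B.tensor 𝓕))

/-! Canonical isomorphisms of sheaves of algebras. -/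

namespace AlgSheaf

/-- The identity. -/
def Iso.refl (A : AlgSheaf k G) : A.Iso A where
  app _ := AlgEquiv.refl
  naturality _ _ := rfl

/-- The inverse. -/
def Iso.symm {A B : AlgSheaf k G} (i : A.Iso B) : B.Iso A where
  app P := (i.app P).symm
  naturality h x := by
    rw [AlgEquiv.symm_apply_eq, i.naturality, AlgEquiv.apply_symm_apply]

/-- The composition. -/
def Iso.trans {A B C : AlgSheaf k G} (i : A.Iso B) (j : B.Iso C) : A.Iso C where
  app P := (i.app P).trans (j.app P)
  naturality h x := by
    rw [AlgEquiv.trans_apply, AlgEquiv.trans_apply, i.naturality, j.naturality]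

/-- Functoriality of the tensor product. -/
noncomputable def Iso.tensor {A B A' B' : AlgSheaf k G} (i : A.Iso B) (j : A'.Iso B') :
    (A.tensor A').Iso (B.tensor B') where
  app P := Algebra.TensorProduct.congr (i.app P) (j.app P)
  naturality {R R' _ _ _ _ f P P'} h x := by
    refine TensorProduct.induction_on x (by simp) (fun a b => ?_) (fun z w hz hw => ?_)
    · have h₁ := i.naturality h a
      have h₂ := j.naturality h b
      change i.app P' (A.res h a) ⊗ₜ[R'] j.app P' (A'.res h b) =
        B.res h (i.app P a) ⊗ₜ[R'] B'.res h (j.app P b)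
      rw [h₁, h₂]
    · rw [map_add, map_add, map_add, map_add, hz, hw]

/-- Commutativity of the tensor product. -/
noncomputable def tensorComm (A B : AlgSheaf k G) : (A.tensor B).Iso (B.tensor A) where
  app {R} _ _ P := Algebra.TensorProduct.comm R (A.sec P) (B.sec P)
  naturality {R R' _ _ _ _ f P P'} h x := by
    refine TensorProduct.induction_on x (by simp) (fun a b => rfl) (fun z w hz hw => ?_)
    rw [map_add, map_add, map_add, map_add, hz, hw]

/-- Associativity of the tensor product. -/
noncomputable def tensorAssoc (A B C : AlgSheaf k G) :
    ((A.tensor B).tensor C).Iso (A.tensor (B.tensor C)) where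
  app {R} _ _ P := Algebra.TensorProduct.assoc R R R (A.sec P) (B.sec P) (C.sec P)
  naturality {R R' _ _ _ _ f P P'} h x := by
    refine TensorProduct.induction_on x (by simp) (fun y c => ?_) (fun z w hz hw => ?_)
    · refine TensorProduct.induction_on y (by simp) (fun a b => rfl) (fun z w hz hw => ?_)
      rw [TensorProduct.add_tmul, map_add, map_add, map_add, map_add, hz, hw]
    · rw [map_add, map_add, map_add, map_add, hz, hw]

/-- The structure sheaf is a unit for the tensor product. -/
noncomputable def unitTensor (A : AlgSheaf k G) : ((structureSheaf k G).tensor A).Iso A where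
  app {R} _ _ P := Algebra.TensorProduct.lid R (A.sec P)
  naturality {R R' _ _ _ _ f P P'} h x := by
    refine TensorProduct.induction_on x (by simp) (fun r a => ?_) (fun z w hz hw => ?_)
    · change f r • A.res h a = A.res h (r • a)
      rw [A.res_smul]
    · rw [map_add, map_add, map_add, map_add, hz, hw]

/-- Interchange of tensor products. -/
noncomputable def tensorTensorComm (A B C D : AlgSheaf k G) :
    ((A.tensor B).tensor (C.tensor D)).Iso ((A.tensor C).tensor (B.tensor D)) where
  app {R} _ _ P := Algebra.TensorProduct.tensorTensorTensorComm R R R R (A.sec P) (B.sec P)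
    (C.sec P) (D.sec P)
  naturality {R R' _ _ _ _ f P P'} h x := by
    refine TensorProduct.induction_on x (by simp) (fun y y' => ?_) (fun z w hz hw => ?_)
    · refine TensorProduct.induction_on y (by simp) (fun a b => ?_) (fun z w hz hw => ?_)
      · refine TensorProduct.induction_on y' (by simp) (fun a b => rfl) (fun z w hz hw => ?_)
        rw [TensorProduct.tmul_add, map_add, map_add, map_add, map_add, hz, hw]
      · rw [TensorProduct.add_tmul, map_add, map_add, map_add, map_add, hz, hw]
    · rw [map_add, map_add, map_add, map_add, hz, hw]

end AlgSheaf

theorem QCohSheaf.IsVectorBundle.tensor {E F : QCohSheaf k G} (hE : E.IsVectorBundle)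
    (hF : F.IsVectorBundle) : (E.tensor F).IsVectorBundle := by
  obtain ⟨m, hm, hE⟩ := hE
  obtain ⟨m', hm', hF⟩ := hF
  exact ⟨m * m', Nat.mul_pos hm hm', fun P => (hE P).tensor (hF P)⟩

theorem isVectorBundle_structureSheaf : (AlgSheaf.structureSheaf k G).toQCohSheaf.IsVectorBundle :=
  ⟨1, one_pos, fun {R} _ _ _ => ⟨R, inferInstance, inferInstance, inferInstance, inferInstance,
    ⟨(TensorProduct.lid R R).trans (LinearEquiv.funUnique (Fin 1) R R).symm⟩⟩⟩

theorem isEndSheaf_structureSheaf :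
    IsEndSheaf (AlgSheaf.structureSheaf k G) (AlgSheaf.structureSheaf k G).toQCohSheaf := by
  refine ⟨fun {R} _ _ P => AlgEquiv.ofBijective (Algebra.lmul R R) ⟨?_, ?_⟩, ?_⟩
  · intro a b hab
    simpa using DFunLike.congr_fun hab (1 : R)
  · intro φ
    refine ⟨φ (1 : R), LinearMap.ext fun x => ?_⟩
    change φ (1 : R) * x = φ x
    have := φ.map_smul (x : R) (1 : R)
    rw [smul_eq_mul, mul_one] at this
    rw [this, smul_eq_mul, mul_comm]
  · intro R R' _ _ _ _ f P P' h a x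
    change f (a * x) = f a * f x
    exact map_mul f _ _

theorem IsEndSheaf.tensor {𝓔 𝓕 : AlgSheaf k G} {E F : QCohSheaf k G} (h𝓔 : IsEndSheaf 𝓔 E)
    (h𝓕 : IsEndSheaf 𝓕 F) (hE : E.IsVectorBundle) (hF : F.IsVectorBundle) :
    IsEndSheaf (𝓔.tensor 𝓕) (E.tensor F) := by
  obtain ⟨ρ, hρ⟩ := h𝓔
  obtain ⟨σ, hσ⟩ := h𝓕
  obtain ⟨m, hm, hE⟩ := hE
  obtain ⟨m', hm', hF⟩ := hF
  have key : ∀ {R : Type u} [CommRing R] [Algebra k R] (P : Torsor G R), Function.Bijective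
      (Module.endTensorEndAlgHom (R := R) (S := R) (A := R) (M := E.sec P) (N := F.sec P)) := by
    intro R _ _ P
    obtain ⟨_, _⟩ := (hE P).finite_projective
    obtain ⟨_, _⟩ := (hF P).finite_projective
    exact endTensorEnd_bijective
  refine ⟨fun P => (Algebra.TensorProduct.congr (ρ P) (σ P)).trans
    (AlgEquiv.ofBijective _ (key P)), ?_⟩
  intro R R' _ _ _ _ f P P' h a x
  refine TensorProduct.induction_on a ?_ (fun a b => ?_) (fun z w hz hw => ?_)
  · simp
  · refine TensorProduct.induction_on x ?_ (fun x y => ?_) (fun z w hz hw => ?_)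
    · simp
    · change E.res h (ρ P a x) ⊗ₜ[R'] F.res h (σ P b y) =
        ρ P' (𝓔.res h a) (E.res h x) ⊗ₜ[R'] σ P' (𝓕.res h b) (F.res h y)
      rw [hρ, hσ]
    · rw [map_add, map_add, map_add, map_add, hz, hw]
  · rw [map_add, map_add, map_add, LinearMap.add_apply, LinearMap.add_apply, map_add, hz, hw]

theorem bijective_ofId_matrix_one {R : Type u} [CommRing R] :
    Function.Bijective (Algebra.ofId R (Matrix (Fin 1) (Fin 1) R)) := by
  refine ⟨fun a b hab => ?_, fun M => ⟨M 0 0, ?_⟩⟩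
  · have := congrFun (congrFun hab 0) 0
    simpa [Algebra.ofId_apply, Matrix.algebraMap_matrix_apply] using this
  · ext i j
    fin_cases i
    fin_cases j
    simp [Algebra.ofId_apply, Matrix.algebraMap_matrix_apply]

/-- The structure sheaf, as an Azumaya algebra. -/
abbrev AzumayaAlg.one (k G : Type u) [Field k] [Group G] : AzumayaAlg k G where
  toAlgSheaf := AlgSheaf.structureSheaf k G
  azumaya := ⟨1, one_pos, fun {R} _ _ _ => ⟨R, inferInstance, inferInstance, inferInstance,
    inferInstance, ⟨(Algebra.TensorProduct.lid R R).trans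
      (AlgEquiv.ofBijective (Algebra.ofId R (Matrix (Fin 1) (Fin 1) R))
        bijective_ofId_matrix_one)⟩⟩⟩

/-- The tensor product of Azumaya algebras. -/
noncomputable abbrev AzumayaAlg.tensor (A B : AzumayaAlg k G) : AzumayaAlg k G where
  toAlgSheaf := A.toAlgSheaf.tensor B.toAlgSheaf
  azumaya := by
    obtain ⟨m, hm, hA⟩ := A.azumaya
    obtain ⟨m', hm', hB⟩ := B.azumaya
    exact ⟨m * m', Nat.mul_pos hm hm', fun P => (hA P).tensor (hB P)⟩

/-- The opposite of an Azumaya algebra. -/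
abbrev AzumayaAlg.op (A : AzumayaAlg k G) : AzumayaAlg k G where
  toAlgSheaf := A.toAlgSheaf.op
  azumaya := by
    obtain ⟨m, hm, hA⟩ := A.azumaya
    exact ⟨m, hm, fun P => (hA P).op⟩

/-- The pullback of an Azumaya algebra along a morphism of stacks. -/
abbrev AzumayaAlg.pullback (φ : StackMap k G) (A : AzumayaAlg k G) : AzumayaAlg k G where
  toAlgSheaf := A.toAlgSheaf.pullback φ
  azumaya := by
    obtain ⟨m, hm, hA⟩ := A.azumaya
    exact ⟨m, hm, fun P => hA (φ.obj P)⟩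

theorem AzumayaAlg.isVectorBundle (A : AzumayaAlg k G) :
    A.toAlgSheaf.toQCohSheaf.IsVectorBundle := by
  obtain ⟨m, hm, hA⟩ := A.azumaya
  exact ⟨m * m, Nat.mul_pos hm hm, fun P => (hA P).free⟩

theorem AzumayaAlg.isEndSheaf_tensor_op (A : AzumayaAlg k G) :
    IsEndSheaf (A.toAlgSheaf.tensor A.toAlgSheaf.op) A.toAlgSheaf.toQCohSheaf := by
  obtain ⟨m, hm, hA⟩ := A.azumaya
  refine ⟨fun {R} _ _ P => AlgEquiv.ofBijective (AlgHom.mulLeftRight R (A.sec P))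
    ((hA P).mulLeftRight_bijective hm), ?_⟩
  intro R R' _ _ _ _ f P P' h a x
  refine TensorProduct.induction_on a ?_ (fun a b => ?_) (fun z w hz hw => ?_)
  · simp
  · change A.res h (AlgHom.mulLeftRight R (A.sec P) (a ⊗ₜ b) x) =
      AlgHom.mulLeftRight R' (A.sec P') (A.res h a ⊗ₜ MulOpposite.op (A.res h b.unop)) (A.res h x)
    simp [AlgHom.mulLeftRight_apply]
  · rw [map_add, map_add, map_add, LinearMap.add_apply, LinearMap.add_apply, map_add, hz, hw]

theorem BrauerEquiv.of_iso {A B : AlgSheaf k G} (i : A.Iso B) : BrauerEquiv A B :=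
  ⟨_, _, _, _, isVectorBundle_structureSheaf, isVectorBundle_structureSheaf,
    isEndSheaf_structureSheaf, isEndSheaf_structureSheaf, ⟨i.tensor (AlgSheaf.Iso.refl _)⟩⟩

theorem BrauerEquiv.symm {A B : AlgSheaf k G} (h : BrauerEquiv A B) : BrauerEquiv B A := by
  obtain ⟨E, F, 𝓔, 𝓕, hE, hF, h𝓔, h𝓕, ⟨i⟩⟩ := h
  exact ⟨F, E, 𝓕, 𝓔, hF, hE, h𝓕, h𝓔, ⟨i.symm⟩⟩

theorem BrauerEquiv.trans {A B C : AlgSheaf k G} (h : BrauerEquiv A B) (h' : BrauerEquiv B C) :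
    BrauerEquiv A C := by
  obtain ⟨E, F, 𝓔, 𝓕, hE, hF, h𝓔, h𝓕, ⟨i⟩⟩ := h
  obtain ⟨E', F', 𝓔', 𝓕', hE', hF', h𝓔', h𝓕', ⟨i'⟩⟩ := h'
  refine ⟨E.tensor E', F'.tensor F, 𝓔.tensor 𝓔', 𝓕'.tensor 𝓕, hE.tensor hE', hF'.tensor hF,
    h𝓔.tensor h𝓔' hE hE', h𝓕'.tensor h𝓕 hF' hF, ⟨?_⟩⟩
  have i₁ := (AlgSheaf.tensorAssoc A 𝓔 𝓔').symm.trans (i.tensor (AlgSheaf.Iso.refl 𝓔'))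
  have i₂ : ((B.tensor 𝓕).tensor 𝓔').Iso ((B.tensor 𝓔').tensor 𝓕) :=
    ((AlgSheaf.tensorAssoc B 𝓕 𝓔').trans
      ((AlgSheaf.Iso.refl B).tensor (AlgSheaf.tensorComm 𝓕 𝓔'))).trans
        (AlgSheaf.tensorAssoc B 𝓔' 𝓕).symm
  exact (i₁.trans i₂).trans
    ((i'.tensor (AlgSheaf.Iso.refl 𝓕)).trans (AlgSheaf.tensorAssoc C 𝓕' 𝓕))

theorem BrauerEquiv.tensor {A B A' B' : AlgSheaf k G} (h : BrauerEquiv A B)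
    (h' : BrauerEquiv A' B') : BrauerEquiv (A.tensor A') (B.tensor B') := by
  obtain ⟨E, F, 𝓔, 𝓕, hE, hF, h𝓔, h𝓕, ⟨i⟩⟩ := h
  obtain ⟨E', F', 𝓔', 𝓕', hE', hF', h𝓔', h𝓕', ⟨i'⟩⟩ := h'
  exact ⟨E.tensor E', F.tensor F', 𝓔.tensor 𝓔', 𝓕.tensor 𝓕', hE.tensor hE', hF.tensor hF',
    h𝓔.tensor h𝓔' hE hE', h𝓕.tensor h𝓕' hF hF',
    ⟨((AlgSheaf.tensorTensorComm A A' 𝓔 𝓔').trans (i.tensor i')).trans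
      (AlgSheaf.tensorTensorComm B 𝓕 B' 𝓕')⟩⟩

theorem BrauerEquiv.of_isEndSheaf {𝓔 : AlgSheaf k G} {E : QCohSheaf k G} (hE : E.IsVectorBundle)
    (h𝓔 : IsEndSheaf 𝓔 E) : BrauerEquiv 𝓔 (AlgSheaf.structureSheaf k G) :=
  ⟨_, E, _, 𝓔, isVectorBundle_structureSheaf, hE, isEndSheaf_structureSheaf, h𝓔,
    ⟨AlgSheaf.tensorComm _ _⟩⟩

theorem BrauerEquiv.op {A B : AzumayaAlg k G} (h : BrauerEquiv A.toAlgSheaf B.toAlgSheaf) :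
    BrauerEquiv A.toAlgSheaf.op B.toAlgSheaf.op := by
  have hA := BrauerEquiv.of_isEndSheaf A.isVectorBundle A.isEndSheaf_tensor_op
  have hB := BrauerEquiv.of_isEndSheaf B.isVectorBundle B.isEndSheaf_tensor_op
  have refl := fun C : AlgSheaf k G => BrauerEquiv.of_iso (AlgSheaf.Iso.refl C)
  have h₁ : BrauerEquiv A.toAlgSheaf.op
      ((B.toAlgSheaf.tensor B.toAlgSheaf.op).tensor A.toAlgSheaf.op) :=
    (BrauerEquiv.of_iso (AlgSheaf.unitTensor _)).symm.trans (hB.symm.tensor (refl _))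
  have h₂ : BrauerEquiv ((B.toAlgSheaf.tensor B.toAlgSheaf.op).tensor A.toAlgSheaf.op)
      ((A.toAlgSheaf.tensor A.toAlgSheaf.op).tensor B.toAlgSheaf.op) :=
    ((h.symm.tensor (refl _)).tensor (refl _)).trans (BrauerEquiv.of_iso
      (((AlgSheaf.tensorAssoc _ _ _).trans
        ((AlgSheaf.Iso.refl _).tensor (AlgSheaf.tensorComm _ _))).trans
          (AlgSheaf.tensorAssoc _ _ _).symm))
  exact (h₁.trans h₂).trans
    ((hA.tensor (refl _)).trans (BrauerEquiv.of_iso (AlgSheaf.unitTensor _)))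

end Brauer

/-- Brauer equivalence of Azumaya algebras on `BG`. -/
def brauerSetoid (k G : Type u) [Field k] [Group G] : Setoid (AzumayaAlg k G) where
  r A B := BrauerEquiv A.toAlgSheaf B.toAlgSheaf
  iseqv := ⟨fun _ => BrauerEquiv.of_iso (AlgSheaf.Iso.refl _), BrauerEquiv.symm, BrauerEquiv.trans⟩

/-- The Brauer group of `BG`: Azumaya algebras up to Brauer equivalence. -/
def Br (k G : Type u) [Field k] [Group G] : Type (u + 1) :=
  Quotient (brauerSetoid k G)

/-- The Brauer class of an Azumaya algebra. -/
def AzumayaAlg.cls {k G : Type u} [Field k] [Group G] (A : AzumayaAlg k G) : Br k G :=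
  Quotient.mk (brauerSetoid k G) A

/-- The group structure (written multiplicatively): `[A] * [B] = [A ⊗ B]`, `[A]⁻¹ = [Aᵒᵖ]`. -/
noncomputable instance (k G : Type u) [Field k] [Group G] : CommGroup (Br k G) where
  mul := Quotient.map₂ AzumayaAlg.tensor fun _ _ h _ _ h' => BrauerEquiv.tensor h h'
  one := (AzumayaAlg.one k G).cls
  inv := Quotient.map AzumayaAlg.op fun _ _ h => BrauerEquiv.op h
  mul_assoc := by
    rintro ⟨A⟩ ⟨B⟩ ⟨C⟩
    exact Quotient.sound (BrauerEquiv.of_iso (AlgSheaf.tensorAssoc _ _ _))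
  one_mul := by
    rintro ⟨A⟩
    exact Quotient.sound (BrauerEquiv.of_iso (AlgSheaf.unitTensor _))
  mul_one := by
    rintro ⟨A⟩
    exact Quotient.sound (BrauerEquiv.of_iso
      ((AlgSheaf.tensorComm _ _).trans (AlgSheaf.unitTensor _)))
  mul_comm := by
    rintro ⟨A⟩ ⟨B⟩
    exact Quotient.sound (BrauerEquiv.of_iso (AlgSheaf.tensorComm _ _))
  inv_mul_cancel := by
    rintro ⟨A⟩
    exact Quotient.sound ((BrauerEquiv.of_iso (AlgSheaf.tensorComm _ _)).trans
      (BrauerEquiv.of_isEndSheaf A.isVectorBundle A.isEndSheaf_tensor_op))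

/-! ### Coherent modules and Morita equivalence -/

/-- A coherent right module over a sheaf of algebras `A` on `BG`: a quasi-coherent sheaf of finite
type with a right action of `A`. -/
structure CohMod {k G : Type u} [Field k] [Group G] (A : AlgSheaf k G) extends QCohSheaf k G where
  [act : ∀ {R : Type u} [CommRing R] [Algebra k R] (P : Torsor G R),
    Module (A.sec P)ᵐᵒᵖ (sec P)]
  [tower : ∀ {R : Type u} [CommRing R] [Algebra k R] (P : Torsor G R),
    IsScalarTower R (A.sec P)ᵐᵒᵖ (sec P)]
  res_act : ∀ {R R' : Type u} [CommRing R] [Algebra k R] [CommRing R'] [Algebra k R']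
    {f : R →ₐ[k] R'} {P : Torsor G R} {P' : Torsor G R'} (h : TorsorHom f P P')
    (a : A.sec P) (x : sec P),
    res h (MulOpposite.op a • x) = MulOpposite.op (A.res h a) • res h x
  finite : ∀ {R : Type u} [CommRing R] [Algebra k R] (P : Torsor G R), Module.Finite R (sec P)

attribute [instance] CohMod.act CohMod.tower

section Coh

variable {k G : Type u} [Field k] [Group G] {A : AlgSheaf k G}

/-- A homomorphism of right `A`-modules. -/
@[ext]
structure CohMod.Hom (M N : CohMod A) where
  /-- the components -/
  app : ∀ {R : Type u} [CommRing R] [Algebra k R] (P : Torsor G R),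
    M.sec P →ₗ[(A.sec P)ᵐᵒᵖ] N.sec P
  naturality : ∀ {R R' : Type u} [CommRing R] [Algebra k R] [CommRing R'] [Algebra k R']
    {f : R →ₐ[k] R'} {P : Torsor G R} {P' : Torsor G R'} (h : TorsorHom f P P') (x : M.sec P),
    app P' (M.res h x) = N.res h (app P x)

instance : CategoryTheory.Category (CohMod A) where
  Hom := CohMod.Hom
  id M := ⟨fun _ => LinearMap.id, fun _ _ => rfl⟩
  comp φ ψ := ⟨fun P => (ψ.app P).comp (φ.app P), fun h x => by
    simp [φ.naturality, ψ.naturality]⟩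

theorem CohMod.hom_ext {M N : CohMod A} {φ ψ : M ⟶ N}
    (h : ∀ {R : Type u} [CommRing R] [Algebra k R] (P : Torsor G R) (x : M.sec P),
      CohMod.Hom.app φ P x = CohMod.Hom.app ψ P x) : φ = ψ := by
  apply CohMod.Hom.ext
  funext R _ _ P
  exact LinearMap.ext (h P)

instance (M N : CohMod A) : Add (M ⟶ N) where
  add φ ψ := ⟨fun P => CohMod.Hom.app φ P + CohMod.Hom.app ψ P, fun h x => by
    simp [CohMod.Hom.naturality]⟩

instance (M N : CohMod A) : Zero (M ⟶ N) where
  zero := ⟨fun P => 0, fun h x => by simp⟩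

instance (M N : CohMod A) : Neg (M ⟶ N) where
  neg φ := ⟨fun P => -CohMod.Hom.app φ P, fun h x => by simp [CohMod.Hom.naturality]⟩

instance (M N : CohMod A) : AddCommGroup (M ⟶ N) where
  nsmul := nsmulRec
  zsmul := zsmulRec
  add_assoc φ ψ χ := CohMod.hom_ext fun P x => add_assoc _ _ _
  zero_add φ := CohMod.hom_ext fun P x => zero_add _
  add_zero φ := CohMod.hom_ext fun P x => add_zero _
  neg_add_cancel φ := CohMod.hom_ext fun P x => neg_add_cancel _
  add_comm φ ψ := CohMod.hom_ext fun P x => add_comm _ _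

instance : CategoryTheory.Preadditive (CohMod A) where
  add_comp _ _ _ _ _ χ := CohMod.hom_ext fun P _ => map_add (CohMod.Hom.app χ P) _ _
  comp_add _ _ _ _ _ _ := rfl

instance (M N : CohMod A) : Module k (M ⟶ N) where
  smul c φ := ⟨fun {R} _ _ P =>
    { toFun := fun x => algebraMap k R c • CohMod.Hom.app φ P x
      map_add' := fun x y => by simp
      map_smul' := fun a x => by
        rw [map_smul, RingHom.id_apply, ← algebraMap_smul (A.sec P)ᵐᵒᵖ,
          ← algebraMap_smul (A.sec P)ᵐᵒᵖ, smul_smul, smul_smul, Algebra.commutes] },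
    fun {R R' _ _ _ _ f P P'} h x => by
      change algebraMap k R' c • CohMod.Hom.app φ P' (M.res h x) =
        N.res h (algebraMap k R c • CohMod.Hom.app φ P x)
      rw [N.res_smul, CohMod.Hom.naturality, AlgHom.commutes]⟩
  one_smul φ := CohMod.hom_ext fun {R} _ _ P x => by
    change algebraMap k R 1 • CohMod.Hom.app φ P x = _
    rw [map_one, one_smul]
  mul_smul c d φ := CohMod.hom_ext fun {R} _ _ P x => by
    change algebraMap k R (c * d) • CohMod.Hom.app φ P x =
      algebraMap k R c • algebraMap k R d • CohMod.Hom.app φ P x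
    rw [map_mul, mul_smul]
  smul_zero c := CohMod.hom_ext fun {R} _ _ P x => smul_zero (algebraMap k R c)
  smul_add c φ ψ := CohMod.hom_ext fun {R} _ _ P x => smul_add (algebraMap k R c) _ _
  add_smul c d φ := CohMod.hom_ext fun {R} _ _ P x => by
    change algebraMap k R (c + d) • CohMod.Hom.app φ P x =
      algebraMap k R c • CohMod.Hom.app φ P x + algebraMap k R d • CohMod.Hom.app φ P x
    rw [map_add, add_smul]
  zero_smul φ := CohMod.hom_ext fun {R} _ _ P x => by
    change algebraMap k R 0 • CohMod.Hom.app φ P x = 0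
    rw [map_zero, zero_smul]

instance : CategoryTheory.Linear k (CohMod A) where
  smul_comp M N L c φ ψ := CohMod.hom_ext fun {R} _ _ P x => by
    change CohMod.Hom.app ψ P (algebraMap k R c • CohMod.Hom.app φ P x) =
      algebraMap k R c • CohMod.Hom.app ψ P (CohMod.Hom.app φ P x)
    rw [← algebraMap_smul (A.sec P)ᵐᵒᵖ, map_smul, algebraMap_smul]
  comp_smul _ _ _ _ _ _ := rfl

end Coh

/-- `A` and `B` are Morita equivalent: `Coh(BG, A)` and `Coh(BG, B)` are equivalent as `k`-linear
(abelian) categories. -/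
def MoritaEquivalent {k G : Type u} [Field k] [Group G] (A B : AlgSheaf k G) : Prop :=
  ∃ e : CohMod A ≌ CohMod B, e.functor.Additive ∧ e.functor.Linear k

end BG

/-!
# Azumaya algebras on the classifying stack of the `n`-th roots of unity

Let `G` be the group of `n`-th roots of unity, a cyclic group whose order is invertible in `k`, and
let `g` be a generator.

**Sheaves are representations.** A quasi-coherent sheaf on the classifying stack is determined by
its fibre at the trivial torsor over `k`, with the action of `G` by automorphisms of that torsor.
Every torsor `P` becomes trivial over itself, so over the functions on `P` the sheaf is the base
change of its fibre (`QCohSheaf.isBaseChange_comparison`), and by Galois descent its sections on `P`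
are the invariants of the diagonal action (`QCohSheaf.exists_comparison_eq`). Conversely
representations, algebras with an action of `G`, and modules with a compatible action all descend to
sheaves (`isBaseChange_invariants`, `descendAlg`, `cohModOfRep`). The order of `G` being invertible,
averaging over `G` supplies the invariants that descent requires.

**The Brauer group.** Since the Brauer group of `k` is trivial, the fibre of an Azumaya algebra is a
matrix algebra, and by the Skolem–Noether theorem `g` acts on it by conjugation by some `u`. As
`g ^ n = 1`, the power `u ^ n` is a scalar `a`, well defined up to `n`-th powers. This gives a
homomorphism from the Brauer group to `kˣ` modulo `n`-th powers (`classHom`). If `u ^ n = 1`, the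
powers of `u` define a representation of `G` of which the algebra is the endomorphism sheaf
(`AzumayaAlg.cls_eq_one`), whence injectivity. The endomorphisms of `k[X] / (X ^ n - a)`, with `g`
acting through multiplication by `X`, have class `a` (`exists_azumayaAlg_hasClass`), whence
surjectivity.

**Modules.** On a coherent module over an algebra of class `a` the action of `g`, corrected by `u`,
becomes linear over the matrix algebra in the fibre, and its `n`-th power is `a`. By Morita theory for
matrix algebras the module is therefore a finite-dimensional vector space with an `n`-th root of `a`
(`AzumayaAlg.exists_equivalence_rootMod`). That category depends on `a` only, and not on the generator
for which `a` is the class. An algebra with class `b` for `g` has class `b ^ i` for `g ^ i`, so for `i`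
prime to `n` the algebras of classes `b` and `b ^ i` for `g` are Morita equivalent. These are exactly
the classes that generate the same subgroup (`exists_coprime_of_zpowers_eq`).

**Recovering the subgroup.** Every object of the category of an algebra of class `a` has an endomorphism
whose `n`-th power is `a`, and this is invariant under linear equivalence. If it holds in the category
of an algebra of class `b`, apply it to the splitting field of `X ^ n - b`, with multiplication by a
root of `b`: this gives an `n`-th root of `a` in that field, so by Kummer theory `a` is a power of `b`
modulo `n`-th powers (`RootMod.exists_eq_pow_mul_pow`). Hence Morita equivalent algebras generate the
same subgroup.

**Automorphisms of the stack.** Raising to the `i`-th power is an automorphism of `G` for `i` prime to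
`n`, and pulling back along the induced automorphism of the stack raises classes to a power in the same
way (`AlgSheaf.HasClass.pullback_twist`). Conversely, for any automorphism `φ` of the stack, with class
`a` of the pullback of `B`, an endomorphism of a pulled back `B`-module descends to the module by
conjugation with the counit (`StackAut.descendEnd`). So every `B`-module has an `n`-th root of `a`, and
the argument of the previous paragraph shows that `φ` preserves the subgroup generated by the class of
`B`.
-/


/-! ### Galois descent along a torsor -/

section GaloisDescent

/-- The property of being a base change descends along a faithfully flat ring extension. -/
theorem IsBaseChange.of_faithfullyFlat {R R' T' M M' N' : Type*} [CommRing R] [CommRing R']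
    [CommRing T'] [Algebra R R'] [Algebra R' T'] [Algebra R T'] [IsScalarTower R R' T']
    [Module.FaithfullyFlat R' T'] [AddCommGroup M] [Module R M] [AddCommGroup M'] [Module R M']
    [Module R' M'] [IsScalarTower R R' M'] [AddCommGroup N'] [Module R N'] [Module R' N']
    [Module T' N'] [IsScalarTower R T' N'] [IsScalarTower R' T' N'] [IsScalarTower R R' N']
    (l : M →ₗ[R] M') (l' : M' →ₗ[R'] N') (hl' : IsBaseChange T' l')
    (hc : IsBaseChange T' (l'.restrictScalars R ∘ₗ l)) : IsBaseChange R' l := by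
  let β : R' ⊗[R] M →ₗ[R'] M' := LinearMap.liftBaseChange R' l
  have hβ : Function.Bijective β := by
    rw [← Module.FaithfullyFlat.lTensor_bijective_iff_bijective R' T']
    have key : ∀ z, hl'.equiv (LinearMap.lTensor T' β z) =
        hc.equiv (TensorProduct.AlgebraTensorModule.cancelBaseChange R R' T' T' M z) := by
      intro z
      induction z with
      | zero => simp
      | add z w hz hw => simp only [map_add, hz, hw]
      | tmul t y =>
        induction y with
        | zero => simp
        | add z w hz hw => simp only [TensorProduct.tmul_add, map_add, hz, hw]
        | tmul r m =>
          simp [β, IsBaseChange.equiv_tmul, LinearMap.liftBaseChange_tmul, TensorProduct.smul_tmul']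
    have : (LinearMap.lTensor T' β : _ → _) = hl'.equiv.symm ∘ hc.equiv ∘
        TensorProduct.AlgebraTensorModule.cancelBaseChange R R' T' T' M := by
      funext z
      simp [← key]
    rw [this]
    exact hl'.equiv.symm.bijective.comp (hc.equiv.bijective.comp (LinearEquiv.bijective _))
  exact IsBaseChange.of_equiv (LinearEquiv.ofBijective β hβ) fun x => by
    simp [β, LinearMap.liftBaseChange_tmul]

namespace BG

variable {G R T : Type u} [Group G] [CommRing R] [CommRing T] [Algebra R T]
  [MulSemiringAction G T] [SMulCommClass G R T]

theorem translationMap_tmul (a b : T) (g : G) :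
    translationMap G R T (a ⊗ₜ b) g = a * g • b := by
  simp [translationMap, Algebra.TensorProduct.productMap_apply_tmul]

/-- The invariant functions on a torsor are the functions on the base. -/
theorem exists_algebraMap_eq_of_smul_eq [Module.FaithfullyFlat R T]
    (hT : Function.Bijective (translationMap G R T)) {t : T} (ht : ∀ g : G, g • t = t) :
    ∃ r : R, algebraMap R T r = t := by
  have h1 : (t ⊗ₜ[R] (1 : T)) = 1 ⊗ₜ t := hT.1 (funext fun g => by
    simp [translationMap_tmul, ht])
  let q := (LinearMap.range (Algebra.linearMap R T)).mkQ
  have h2 : (1 : T) ⊗ₜ[R] q t = 0 := by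
    have := congrArg (LinearMap.lTensor T q) h1
    rw [LinearMap.lTensor_tmul, LinearMap.lTensor_tmul] at this
    have hq : q 1 = 0 := (Submodule.Quotient.mk_eq_zero _).mpr (LinearMap.mem_range.mpr ⟨1, by simp⟩)
    rw [← this, hq, TensorProduct.tmul_zero]
  rw [Module.FaithfullyFlat.one_tmul_eq_zero_iff] at h2
  obtain ⟨r, hr⟩ := (Submodule.Quotient.mk_eq_zero _).mp h2
  exact ⟨r, hr⟩

theorem smul_algebraMap_eq (g : G) (r : R) : g • algebraMap R T r = algebraMap R T r := by
  rw [Algebra.algebraMap_eq_smul_one, smul_comm, smul_one]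

variable {N : Type*} [AddCommGroup N] [Module T N] (σ : G →* AddMonoid.End N)

/-- A module with a semilinear action of the group of a torsor is spanned by traces. -/
theorem mem_span_trace [Fintype G] (hT : Function.Bijective (translationMap G R T))
    (hσ : ∀ g (t : T) x, σ g (t • x) = (g • t) • σ g x) (m : N) :
    m ∈ Submodule.span T (Set.range fun b : T => ∑ g, σ g (b • m)) := by
  classical
  obtain ⟨z, hz⟩ := hT.2 (Pi.single 1 1)
  have key : ∀ z : T ⊗[R] T, ∑ g, translationMap G R T z g • σ g m ∈
      Submodule.span T (Set.range fun b : T => ∑ g, σ g (b • m)) := by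
    intro z
    induction z with
    | zero => simp
    | add z w hz hw =>
      simp only [map_add, Pi.add_apply, add_smul, Finset.sum_add_distrib]
      exact add_mem hz hw
    | tmul a b =>
      have : ∑ g, translationMap G R T (a ⊗ₜ b) g • σ g m = a • ∑ g, σ g (b • m) := by
        rw [Finset.smul_sum]
        exact Finset.sum_congr rfl fun g _ => by rw [translationMap_tmul, hσ, mul_smul]
      rw [this]
      exact Submodule.smul_mem _ _ (Submodule.subset_span ⟨b, rfl⟩)
  have := key z
  rw [hz, Finset.sum_eq_single 1 (fun g _ hg => by simp [hg]) (by simp)] at this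
  simpa using this

theorem apply_trace [Fintype G] (h : G) (m : N) : σ h (∑ g, σ g m) = ∑ g, σ g m := by
  rw [map_sum]
  refine Fintype.sum_equiv (Equiv.mulLeft h) _ _ fun g => ?_
  simp

/-- In `T ⊗ E`, with the group acting on the first factor, the invariants are `1 ⊗ E`. -/
theorem exists_one_tmul_eq_of_invariant [Fintype G] [Module.FaithfullyFlat R T]
    (hT : Function.Bijective (translationMap G R T)) (hG : IsUnit (Fintype.card G : R))
    {E : Type*} [AddCommGroup E] [Module R E] (z : T ⊗[R] E)
    (hz : ∀ g : G, (MulSemiringAction.toAlgHom R T g).toLinearMap.rTensor E z = z) :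
    ∃ e : E, (1 : T) ⊗ₜ[R] e = z := by
  have key : ∀ z : T ⊗[R] E, ∃ e : E, (1 : T) ⊗ₜ[R] e =
      ∑ g : G, (MulSemiringAction.toAlgHom R T g).toLinearMap.rTensor E z := by
    intro z
    induction z with
    | zero => exact ⟨0, by simp⟩
    | add z w hz hw =>
      obtain ⟨e, he⟩ := hz
      obtain ⟨e', he'⟩ := hw
      exact ⟨e + e', by simp [TensorProduct.tmul_add, he, he', Finset.sum_add_distrib]⟩
    | tmul t e =>
      obtain ⟨r, hr⟩ := exists_algebraMap_eq_of_smul_eq hT (t := ∑ g : G, g • t) fun h => by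
        rw [Finset.smul_sum]
        refine Fintype.sum_equiv (Equiv.mulLeft h) _ _ fun g => ?_
        simp [mul_smul]
      refine ⟨r • e, ?_⟩
      rw [← TensorProduct.smul_tmul, ← Algebra.algebraMap_eq_smul_one, hr,
        TensorProduct.sum_tmul]
      rfl
  obtain ⟨e, he⟩ := key z
  obtain ⟨u, hu⟩ := hG
  refine ⟨(↑u⁻¹ : R) • e, ?_⟩
  rw [TensorProduct.tmul_smul, he, Finset.sum_congr rfl fun g _ => hz g, Finset.sum_const,
    Finset.card_univ, ← Nat.cast_smul_eq_nsmul R, ← hu, smul_smul, Units.inv_mul, one_smul]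

variable [Module R N] [IsScalarTower R T N]

/-- The invariants of a semilinear action, as a module over the base. -/
def invariants (hσ : ∀ g (t : T) x, σ g (t • x) = (g • t) • σ g x) : Submodule R N where
  carrier := {x | ∀ g, σ g x = x}
  zero_mem' g := map_zero _
  add_mem' hx hy g := by rw [map_add, hx g, hy g]
  smul_mem' r x hx g := by
    rw [← algebraMap_smul T r x, hσ, smul_algebraMap_eq, hx g]

/-- Galois descent: a module with semilinear action is the base change of its invariants. -/
theorem isBaseChange_invariants [Fintype G] [Module.FaithfullyFlat R T]
    (hT : Function.Bijective (translationMap G R T)) (hG : IsUnit (Fintype.card G : R))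
    (hσ : ∀ g (t : T) x, σ g (t • x) = (g • t) • σ g x) :
    IsBaseChange T (invariants (R := R) σ hσ).subtype := by
  let E := invariants (R := R) σ hσ
  let β : T ⊗[R] E →ₗ[T] N := LinearMap.liftBaseChange T E.subtype
  have hβt : ∀ t (e : E), β (t ⊗ₜ e) = t • (e : N) := fun t e => by
    simp [β, LinearMap.liftBaseChange_tmul]
  let τ : G →* AddMonoid.End (T ⊗[R] E) :=
    { toFun := fun g => ((MulSemiringAction.toAlgHom R T g).toLinearMap.rTensor E).toAddMonoidHom
      map_one' := by
        ext z
        change (MulSemiringAction.toAlgHom R T (1 : G)).toLinearMap.rTensor E z = z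
        induction z with
        | zero => simp
        | add z w hz hw => rw [map_add, hz, hw]
        | tmul t e => simp
      map_mul' := fun g h => by
        ext z
        change (MulSemiringAction.toAlgHom R T (g * h)).toLinearMap.rTensor E z =
          (MulSemiringAction.toAlgHom R T g).toLinearMap.rTensor E
            ((MulSemiringAction.toAlgHom R T h).toLinearMap.rTensor E z)
        induction z with
        | zero => simp
        | add z w hz hw => simp only [map_add, hz, hw]
        | tmul t e => simp [mul_smul] }
  have hτt : ∀ g t (e : E), τ g (t ⊗ₜ e) = (g • t) ⊗ₜ e := fun g t e => rfl
  have hτ : ∀ g (t : T) x, τ g (t • x) = (g • t) • τ g x := by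
    intro g t x
    induction x with
    | zero => simp
    | add z w hz hw => simp only [smul_add, map_add, hz, hw]
    | tmul t' e => simp [TensorProduct.smul_tmul', hτt, smul_mul']
  have hβτ : ∀ g x, β (τ g x) = σ g (β x) := by
    intro g x
    induction x with
    | zero => simp
    | add z w hz hw => simp only [map_add, hz, hw]
    | tmul t e => rw [hτt, hβt, hβt, hσ, e.2 g]
  have hbij : Function.Bijective β := by
    constructor
    · rw [injective_iff_map_eq_zero]
      intro x hx
      have h0 : ∀ b : T, ∑ g, τ g (b • x) = 0 := by
        intro b
        obtain ⟨e, he⟩ := exists_one_tmul_eq_of_invariant hT hG (∑ g, τ g (b • x))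
          fun h => apply_trace τ h (b • x)
        have h1 : β (∑ g, τ g (b • x)) = 0 := by
          rw [map_sum]
          exact Finset.sum_eq_zero fun g _ => by rw [hβτ, map_smul, hx, smul_zero, map_zero]
        rw [← he, hβt, one_smul] at h1
        rw [← he, (Subtype.ext h1 : e = 0), TensorProduct.tmul_zero]
      have := mem_span_trace τ hT hτ x
      simpa [h0] using this
    · intro m
      have := mem_span_trace σ hT hσ m
      refine Submodule.span_induction (p := fun y _ => ∃ x, β x = y) ?_ ⟨0, map_zero _⟩ ?_ ?_ this
      · rintro _ ⟨b, rfl⟩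
        exact ⟨1 ⊗ₜ ⟨∑ g, σ g (b • m), fun h => apply_trace σ h _⟩, by rw [hβt, one_smul]⟩
      · rintro _ _ _ _ ⟨x, rfl⟩ ⟨y, rfl⟩
        exact ⟨x + y, map_add _ _ _⟩
      · rintro t _ _ ⟨x, rfl⟩
        exact ⟨t • x, map_smul _ _ _⟩
  exact IsBaseChange.of_equiv (LinearEquiv.ofBijective β hbij) fun x => by
    change β _ = _
    rw [hβt, one_smul]; rfl

/-- A form `E` of the `T`-module `N`, on which the semilinear action is trivial, consists of all
the invariants of `N`. -/
theorem exists_eq_of_isBaseChange [Fintype G] [Module.FaithfullyFlat R T]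
    (hT : Function.Bijective (translationMap G R T)) (hG : IsUnit (Fintype.card G : R))
    (hσ : ∀ g (t : T) x, σ g (t • x) = (g • t) • σ g x)
    {E : Type*} [AddCommGroup E] [Module R E] (j : E →ₗ[R] N) (hj : IsBaseChange T j)
    (hjσ : ∀ g e, σ g (j e) = j e) {x : N} (hx : ∀ g, σ g x = x) : ∃ e, j e = x := by
  obtain ⟨e, he⟩ := exists_one_tmul_eq_of_invariant hT hG (hj.equiv.symm x) fun g => by
    apply hj.equiv.injective
    rw [LinearEquiv.apply_symm_apply]
    have : ∀ z, hj.equiv ((MulSemiringAction.toAlgHom R T g).toLinearMap.rTensor E z) =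
        σ g (hj.equiv z) := by
      intro z
      induction z with
      | zero => simp
      | add z w hz hw => simp only [map_add, hz, hw]
      | tmul t e => simp [IsBaseChange.equiv_tmul, hσ, hjσ]
    rw [this, LinearEquiv.apply_symm_apply, hx]
  refine ⟨e, ?_⟩
  rw [← one_smul T (j e), ← hj.equiv_tmul, he, LinearEquiv.apply_symm_apply]

theorem injective_of_isBaseChange [Module.FaithfullyFlat R T]
    {E : Type*} [AddCommGroup E] [Module R E] (j : E →ₗ[R] N) (hj : IsBaseChange T j) :
    Function.Injective j := by
  rw [injective_iff_map_eq_zero]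
  intro e he
  rw [← one_smul T (j e), ← hj.equiv_tmul, LinearEquiv.map_eq_zero_iff,
    Module.FaithfullyFlat.one_tmul_eq_zero_iff] at he
  exact he

end BG

end GaloisDescent

namespace BG

/-! ### Trivial torsors -/

section TrivialTorsor

variable {k G : Type u} [Field k] [Group G]

/-- The action of `G` by right translation on functions on `G`. -/
abbrev translationAction (G R : Type u) [Group G] [CommRing R] : MulSemiringAction G (G → R) where
  smul g f := fun h => f (h * g)
  one_smul f := funext fun h => congrArg f (mul_one h)
  mul_smul a b f := funext fun h => congrArg f (mul_assoc h a b).symm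
  smul_zero _ := rfl
  smul_add _ _ _ := rfl
  smul_one _ := rfl
  smul_mul _ _ _ := rfl

/-- The trivial torsor: its functions are the functions `G → R`, translated by `G`. -/
def triv (G R : Type u) [Group G] [Finite G] [CommRing R] : Torsor G R where
  carrier := G → R
  action := translationAction G R
  smulComm := letI := translationAction G R; ⟨fun _ _ _ => rfl⟩
  etale := inferInstance
  faithfullyFlat := by
    classical
    have := Fintype.ofFinite G
    exact Module.FaithfullyFlat.of_linearEquiv _ (G →₀ R) (Finsupp.linearEquivFunOnFinite R R G).symm
  bijective := by
    classical
    have := Fintype.ofFinite G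
    let _ := translationAction G R
    let _ : SMulCommClass G R (G → R) := ⟨fun _ _ _ => rfl⟩
    let d : G → G → R := fun g => Pi.single g 1
    have hd : ∀ f : G → R, ∑ x, f x • d x = f := fun f => by
      funext y
      simp [d, Finset.sum_apply, Pi.single_apply]
    let inv : (G → G → R) →ₗ[R] (G → R) ⊗[R] (G → R) :=
      { toFun := fun F => ∑ x, ∑ g, F g x • d x ⊗ₜ[R] d (x * g)
        map_add' := fun F F' => by simp [add_smul, Finset.sum_add_distrib]
        map_smul' := fun r F => by simp [mul_smul, Finset.smul_sum] }
    have hinv : ∀ F, inv F = ∑ x, ∑ g, F g x • d x ⊗ₜ[R] d (x * g) := fun _ => rfl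
    have h1 : ∀ z, inv (translationMap G R (G → R) z) = z := by
      intro z
      induction z with
      | zero => simp
      | add z w hz hw => rw [map_add, map_add, hz, hw]
      | tmul a b =>
        rw [hinv]
        have : ∀ x, ∑ g, translationMap G R (G → R) (a ⊗ₜ b) g x • d x ⊗ₜ[R] d (x * g) =
            (a x • d x) ⊗ₜ b := by
          intro x
          conv_rhs => rw [← hd b]
          rw [TensorProduct.tmul_sum]
          refine Fintype.sum_equiv (Equiv.mulLeft x) _ _ fun g => ?_
          rw [translationMap_tmul]
          change (a x * b (x * g)) • d x ⊗ₜ[R] d (x * g) = (a x • d x) ⊗ₜ[R] (b (x * g) • d (x * g))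
          rw [TensorProduct.smul_tmul_smul]
        rw [Finset.sum_congr rfl fun x _ => this x, ← TensorProduct.sum_tmul, hd]
    have h2 : ∀ F, translationMap G R (G → R) (inv F) = F := by
      intro F
      rw [hinv]
      simp only [map_sum, map_smul]
      funext g y
      simp only [Finset.sum_apply, Pi.smul_apply, translationMap_tmul, Pi.mul_apply]
      have hs : ∀ (a h : G), (g • d a : G → R) h = d a (h * g) := fun _ _ => rfl
      simp only [hs, d, Pi.single_apply]
      rw [Finset.sum_eq_single y (fun x _ hx => by simp [hx.symm]) (by simp),
        Finset.sum_eq_single g (fun x _ hx => by simp [hx.symm]) (by simp)]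
      simp
    exact ⟨Function.LeftInverse.injective h1, Function.RightInverse.surjective h2⟩

variable {R R' : Type u} [CommRing R] [Algebra k R] [CommRing R'] [Algebra k R']

/-- The functions on a torsor over a `k`-algebra form a `k`-algebra. -/
noncomputable instance (priority := 50) Torsor.algebraBase (P : Torsor G R) : Algebra k P.carrier :=
  ((algebraMap R P.carrier).comp (algebraMap k R)).toAlgebra

instance (P : Torsor G R) : IsScalarTower k R P.carrier := .of_algebraMap_eq fun _ => rfl

instance (P : Torsor G R) : SMulCommClass G k P.carrier where
  smul_comm g c t := by
    rw [← algebraMap_smul R c t, ← algebraMap_smul R c (g • t), smul_comm]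

instance (P : Torsor G R) : Module.FaithfullyFlat R P.carrier := P.faithfullyFlat

/-- A morphism of torsors is a homomorphism of `k`-algebras. -/
noncomputable def TorsorHom.toAlgHom {f : R →ₐ[k] R'} {P : Torsor G R} {P' : Torsor G R'}
    (h : TorsorHom f P P') : P.carrier →ₐ[k] P'.carrier where
  __ := h.toRingHom
  commutes' c := by
    change h.toRingHom (algebraMap R P.carrier (algebraMap k R c)) = _
    rw [h.map_algebraMap, f.commutes]
    rfl

/-- The automorphism of the functions on a torsor given by an element of the group. -/
noncomputable def Torsor.smulAlgHom (P : Torsor G R) (g : G) : P.carrier →ₐ[k] P.carrier :=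
  (MulSemiringAction.toAlgHom R P.carrier g).restrictScalars k

variable [Finite G]

/-- The morphism of trivial torsors over a map of base rings. -/
def trivMap (f : R →ₐ[k] R') : TorsorHom f (triv G R) (triv G R') where
  toRingHom := f.toRingHom.compLeft G
  map_algebraMap _ := rfl
  map_smul _ _ := rfl

variable (k) in
/-- The automorphism of the trivial torsor given by left translation by `g`. -/
def trivTranslation (R : Type u) [CommRing R] [Algebra k R] (g : G) :
    TorsorHom (AlgHom.id k R) (triv G R) (triv G R) where
  toRingHom :=
    { toFun := fun (f : G → R) => (fun h => f (g⁻¹ * h) : G → R)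
      map_one' := rfl
      map_mul' := fun _ _ => rfl
      map_zero' := rfl
      map_add' := fun _ _ => rfl }
  map_algebraMap _ := rfl
  map_smul a f := funext fun h => congrArg f (mul_assoc g⁻¹ h a)

variable (k) in
/-- A torsor becomes trivial over itself: `t ↦ (h ↦ h • t)`. -/
noncomputable def Torsor.splitting (P : Torsor G R) :
    TorsorHom (IsScalarTower.toAlgHom k R P.carrier) P (triv G P.carrier) where
  toRingHom :=
    { toFun := fun t => (fun h => h • t : G → P.carrier)
      map_one' := funext fun h => smul_one h
      map_mul' := fun s t => funext fun h => smul_mul' h s t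
      map_zero' := funext fun h => smul_zero h
      map_add' := fun s t => funext fun h => smul_add h s t }
  map_algebraMap r := funext fun h => smul_algebraMap_eq h r
  map_smul g t := funext fun h => smul_smul h g t

variable (k) in
/-- Evaluation at `1` of functions on the trivial torsor. -/
noncomputable def evalOne (R : Type u) [CommRing R] [Algebra k R] :
    (triv G R).carrier →ₐ[k] R where
  toFun := fun (f : G → R) => f 1
  map_one' := rfl
  map_mul' := fun _ _ => rfl
  map_zero' := rfl
  map_add' := fun _ _ => rfl
  commutes' := fun _ => rfl

end TrivialTorsor

/-! ### The fibre of a sheaf and its comparison with the sheaf -/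

section Fiber

theorem IsBaseChangeAlong.exists_equiv {k R R' M N : Type u} [Field k] [CommRing R] [Algebra k R]
    [CommRing R'] [Algebra k R'] {f : R →ₐ[k] R'} [AddCommGroup M] [Module R M] [AddCommGroup N]
    [Module R' N] {g : M →+ N} (h : IsBaseChangeAlong f g) [inst : Algebra R R']
    (hf : ∀ r, algebraMap R R' r = f r) :
    ∃ e : R' ⊗[R] M ≃ₗ[R'] N, ∀ x : M, e (1 ⊗ₜ[R] x) = g x := by
  have : inst = f.toRingHom.toAlgebra := Algebra.algebra_ext _ _ hf
  subst this
  exact h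

variable {k G : Type u} [Field k] [Group G] {R R' : Type u} [CommRing R] [Algebra k R]
  [CommRing R'] [Algebra k R']

theorem QCohSheaf.res_congr (E : QCohSheaf k G) {f f' : R →ₐ[k] R'} {P : Torsor G R}
    {P' : Torsor G R'} {h : TorsorHom f P P'} {h' : TorsorHom f' P P'} (hf : f = f')
    (hh : ∀ x, h.toRingHom x = h'.toRingHom x) (x : E.sec P) : E.res h x = E.res h' x := by
  subst hf
  have : h = h' := TorsorHom.ext (RingHom.ext hh)
  rw [this]

variable [Finite G]

/-- The fibre of a quasi-coherent sheaf at the trivial torsor over `k`. -/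
abbrev QCohSheaf.fiber (E : QCohSheaf k G) : Type u := E.sec (triv G k)

/-- The fibre as a representation of `G`, which acts by automorphisms of the trivial torsor. -/
def QCohSheaf.rep (E : QCohSheaf k G) : Representation k G E.fiber where
  toFun g :=
    { toFun := E.res (trivTranslation k k g)
      map_add' := map_add _
      map_smul' := E.res_smul (trivTranslation k k g) }
  map_one' := LinearMap.ext fun x => by
    refine (E.res_congr rfl (h' := TorsorHom.id k _) (fun y => ?_) x).trans (E.res_id _ x)
    funext h
    change y (1⁻¹ * h) = y h
    rw [inv_one, one_mul]
  map_mul' a b := LinearMap.ext fun x => by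
    refine (E.res_congr rfl (h' := (trivTranslation k k a).comp (trivTranslation k k b))
      (fun y => ?_) x).trans (E.res_comp _ _ x)
    funext h
    change y ((a * b)⁻¹ * h) = y (b⁻¹ * (a⁻¹ * h))
    rw [mul_inv_rev, mul_assoc]

theorem QCohSheaf.rep_apply (E : QCohSheaf k G) (g : G) (x : E.fiber) :
    E.rep g x = E.res (trivTranslation k k g) x := rfl

theorem QCohSheaf.exists_trivEquiv (E : QCohSheaf k G) (R : Type u) [CommRing R] [Algebra k R] :
    ∃ e : R ⊗[k] E.fiber ≃ₗ[R] E.sec (triv G R),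
      ∀ x : E.fiber, e (1 ⊗ₜ[k] x) = E.res (trivMap (Algebra.ofId k R)) x :=
  (E.baseChange (trivMap (Algebra.ofId k R))).exists_equiv fun _ => rfl

/-- The sections on a trivial torsor are the base change of the fibre. -/
noncomputable def QCohSheaf.trivEquiv (E : QCohSheaf k G) (R : Type u) [CommRing R] [Algebra k R] :
    R ⊗[k] E.fiber ≃ₗ[R] E.sec (triv G R) :=
  (E.exists_trivEquiv R).choose

theorem QCohSheaf.trivEquiv_tmul (E : QCohSheaf k G) (r : R) (x : E.fiber) :
    E.trivEquiv R (r ⊗ₜ x) = r • E.res (trivMap (Algebra.ofId k R)) x := by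
  rw [← mul_one r, ← smul_eq_mul, ← TensorProduct.smul_tmul', map_smul, smul_eq_mul, mul_one]
  exact congrArg _ ((E.exists_trivEquiv R).choose_spec x)

theorem QCohSheaf.res_trivMap_trivEquiv (E : QCohSheaf k G) (f : R →ₐ[k] R')
    (y : R ⊗[k] E.fiber) : E.res (trivMap f) (E.trivEquiv R y) =
      E.trivEquiv R' (f.toLinearMap.rTensor E.fiber y) := by
  induction y with
  | zero => simp
  | add z w hz hw => simp only [map_add, hz, hw]
  | tmul r x =>
    rw [LinearMap.rTensor_tmul, trivEquiv_tmul, trivEquiv_tmul, E.res_smul, ← E.res_comp]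
    congr 1
    exact E.res_congr (AlgHom.ext fun r => f.commutes r) (fun y => funext fun h => f.commutes _) x

theorem QCohSheaf.res_trivTranslation_trivEquiv (E : QCohSheaf k G) (g : G)
    (y : R ⊗[k] E.fiber) : E.res (trivTranslation k R g) (E.trivEquiv R y) =
      E.trivEquiv R ((E.rep g).lTensor R y) := by
  induction y with
  | zero => simp
  | add z w hz hw => simp only [map_add, hz, hw]
  | tmul r x =>
    rw [LinearMap.lTensor_tmul, trivEquiv_tmul, trivEquiv_tmul, E.res_smul, ← E.res_comp,
      rep_apply, ← E.res_comp]
    congr 1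

section SemilinearAction

variable {T V : Type u} [CommRing T] [Algebra k T] [MulSemiringAction G T] [SMulCommClass G k T]
  [AddCommGroup V] [Module k V]

variable (T) in
/-- The diagonal action of `G` on `T ⊗ V`, for a representation `V`. -/
noncomputable def diagonalAction (ρ : Representation k G V) : G →* AddMonoid.End (T ⊗[k] V) where
  toFun g := (TensorProduct.map (DistribSMul.toLinearMap k T g) (ρ g)).toAddMonoidHom
  map_one' := by
    ext z
    change TensorProduct.map _ _ z = z
    induction z with
    | zero => simp
    | add z w hz hw => rw [map_add, hz, hw]
    | tmul t e => simp
  map_mul' a b := by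
    ext z
    change TensorProduct.map _ _ z = TensorProduct.map _ _ (TensorProduct.map _ _ z)
    induction z with
    | zero => simp
    | add z w hz hw => simp only [map_add, hz, hw]
    | tmul t e => simp [mul_smul]

omit [Finite G] in
theorem diagonalAction_tmul (ρ : Representation k G V) (g : G) (t : T) (v : V) :
    diagonalAction T ρ g (t ⊗ₜ v) = (g • t) ⊗ₜ ρ g v := rfl

omit [Finite G] in
theorem diagonalAction_smul (ρ : Representation k G V) (g : G) (t : T) (x : T ⊗[k] V) :
    diagonalAction T ρ g (t • x) = (g • t) • diagonalAction T ρ g x := by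
  induction x with
  | zero => simp
  | add z w hz hw => simp only [smul_add, map_add, hz, hw]
  | tmul t' e => simp [TensorProduct.smul_tmul', diagonalAction_tmul, smul_mul']

end SemilinearAction

/-- The comparison of the sections on a torsor `P` with the base change of the fibre: restrict to
the torsor `P ×_R P` over `P`, which is trivial. -/
noncomputable def QCohSheaf.comparison (E : QCohSheaf k G) (P : Torsor G R) :
    E.sec P →ₗ[R] P.carrier ⊗[k] E.fiber where
  toFun x := (E.trivEquiv P.carrier).symm (E.res (P.splitting k) x)
  map_add' x y := by simp
  map_smul' r x := by
    rw [E.res_smul, map_smul, RingHom.id_apply]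
    exact algebraMap_smul P.carrier r _

/-- The comparison map is restriction along the splitting of `P` over itself. -/
theorem QCohSheaf.trivEquiv_comparison (E : QCohSheaf k G) (P : Torsor G R) (x : E.sec P) :
    E.trivEquiv P.carrier (E.comparison P x) = E.res (P.splitting k) x :=
  LinearEquiv.apply_symm_apply _ _

/-- A quasi-coherent sheaf on a torsor `P` is, over the functions on `P`, the base change of its
fibre, because `P` becomes trivial over itself. -/
theorem QCohSheaf.isBaseChange_comparison (E : QCohSheaf k G) (P : Torsor G R) :
    IsBaseChange P.carrier (E.comparison P) := by
  obtain ⟨e, he⟩ := (E.baseChange (P.splitting k)).exists_equiv fun _ => rfl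
  exact IsBaseChange.of_equiv (e.trans (E.trivEquiv P.carrier).symm) fun x => by
    rw [LinearEquiv.trans_apply, he]; rfl

theorem QCohSheaf.comparison_injective (E : QCohSheaf k G) (P : Torsor G R) :
    Function.Injective (E.comparison P) :=
  injective_of_isBaseChange _ (E.isBaseChange_comparison P)

theorem QCohSheaf.comparison_res (E : QCohSheaf k G) {f : R →ₐ[k] R'} {P : Torsor G R}
    {P' : Torsor G R'} (h : TorsorHom f P P') (x : E.sec P) :
    E.comparison P' (E.res h x) = h.toAlgHom.toLinearMap.rTensor E.fiber (E.comparison P x) := by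
  apply (E.trivEquiv P'.carrier).injective
  rw [trivEquiv_comparison, ← res_trivMap_trivEquiv, trivEquiv_comparison, ← E.res_comp,
    ← E.res_comp]
  refine E.res_congr (AlgHom.ext fun r => (h.map_algebraMap r).symm) (fun t => funext fun g => ?_) x
  exact (h.map_smul g t).symm

/-- Compared with the fibre, a section is fixed by the diagonal action: the splitting of `P` turns
the action of `g` on `P` into right translation, which left translation of the fibre undoes at
every point. -/
theorem QCohSheaf.diagonalAction_comparison (E : QCohSheaf k G) (P : Torsor G R) (g : G)
    (x : E.sec P) : diagonalAction P.carrier E.rep g (E.comparison P x) = E.comparison P x := by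
  have h1 : ∀ z, diagonalAction P.carrier E.rep g z =
      (P.smulAlgHom (k := k) g).toLinearMap.rTensor E.fiber ((E.rep g).lTensor P.carrier z) := by
    intro z
    induction z with
    | zero => simp
    | add z w hz hw => simp only [map_add, hz, hw]
    | tmul t e => rfl
  apply (E.trivEquiv P.carrier).injective
  rw [h1, ← res_trivMap_trivEquiv, ← res_trivTranslation_trivEquiv, trivEquiv_comparison,
    ← E.res_comp, ← E.res_comp]
  refine E.res_congr (AlgHom.ext fun r => smul_algebraMap_eq g r)
    (fun t => funext fun h => ?_) x
  change g • (g⁻¹ * h) • t = h • t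
  rw [smul_smul, mul_inv_cancel_left]

omit [Group G] [Finite G] in
theorem isUnit_card [NeZero (Nat.card G : k)] [Fintype G] (R : Type u) [CommRing R] [Algebra k R] :
    IsUnit (Fintype.card G : R) := by
  have := (IsUnit.mk0 _ (NeZero.ne (Nat.card G : k))).map (algebraMap k R)
  simpa [Nat.card_eq_fintype_card] using this

/-- By Galois descent the sections on `P` are exactly the invariants of the diagonal action on the
base change of the fibre. -/
theorem QCohSheaf.exists_comparison_eq [NeZero (Nat.card G : k)] (E : QCohSheaf k G)
    (P : Torsor G R) {y : P.carrier ⊗[k] E.fiber}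
    (hy : ∀ g, diagonalAction P.carrier E.rep g y = y) : ∃ x, E.comparison P x = y := by
  have := Fintype.ofFinite G
  exact exists_eq_of_isBaseChange (diagonalAction P.carrier E.rep) P.bijective
    (isUnit_card (k := k) (G := G) R)
    (fun g t x => diagonalAction_smul _ g t x) _ (E.isBaseChange_comparison P)
    (fun g x => E.diagonalAction_comparison P g x) hy

/-- On a trivial torsor the comparison, evaluated at `1`, is the canonical identification. -/
theorem QCohSheaf.rTensor_evalOne_comparison (E : QCohSheaf k G) (x : E.sec (triv G R)) :
    (evalOne k R).toLinearMap.rTensor E.fiber (E.comparison (triv G R) x) =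
      (E.trivEquiv R).symm x := by
  apply (E.trivEquiv R).injective
  rw [← res_trivMap_trivEquiv, trivEquiv_comparison, ← E.res_comp, LinearEquiv.apply_symm_apply]
  refine (E.res_congr (h' := TorsorHom.id k _) (AlgHom.ext fun r => rfl) (fun y => ?_) x).trans
    (E.res_id _ x)
  funext h
  change y (1 * h) = y h
  rw [one_mul]

/-- Over `k`, the canonical identification is the identity of the fibre. -/
theorem QCohSheaf.trivEquiv_symm_fiber (E : QCohSheaf k G) (x : E.fiber) :
    (E.trivEquiv k).symm x = 1 ⊗ₜ x := by
  rw [LinearEquiv.symm_apply_eq, trivEquiv_tmul, one_smul]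
  exact ((E.res_congr (h' := TorsorHom.id k _) (AlgHom.ext fun r => rfl) (fun y => rfl) x).trans
    (E.res_id _ x)).symm

/-- A `G`-equivariant map of fibres extends to the sections on all torsors. -/
theorem QCohSheaf.exists_extension [NeZero (Nat.card G : k)] {E F : QCohSheaf k G}
    (ψ : E.fiber →ₗ[k] F.fiber) (hψ : ∀ g x, ψ (E.rep g x) = F.rep g (ψ x)) (P : Torsor G R)
    (x : E.sec P) : ∃ y, F.comparison P y = ψ.lTensor P.carrier (E.comparison P x) := by
  refine F.exists_comparison_eq P fun g => ?_
  have : ∀ z, diagonalAction P.carrier F.rep g (ψ.lTensor P.carrier z) =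
      ψ.lTensor P.carrier (diagonalAction P.carrier E.rep g z) := by
    intro z
    induction z with
    | zero => simp
    | add z w hz hw => simp only [map_add, hz, hw]
    | tmul t e => simp [diagonalAction_tmul, hψ]
  rw [this, diagonalAction_comparison]

/-- The extension of a `G`-equivariant map of fibres to the sections on all torsors. -/
noncomputable def QCohSheaf.extension [NeZero (Nat.card G : k)] {E F : QCohSheaf k G}
    (ψ : E.fiber →ₗ[k] F.fiber) (hψ : ∀ g x, ψ (E.rep g x) = F.rep g (ψ x)) (P : Torsor G R) :
    E.sec P → F.sec P := fun x => (exists_extension ψ hψ P x).choose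

theorem QCohSheaf.comparison_extension [NeZero (Nat.card G : k)] {E F : QCohSheaf k G}
    (ψ : E.fiber →ₗ[k] F.fiber) (hψ : ∀ g x, ψ (E.rep g x) = F.rep g (ψ x)) (P : Torsor G R)
    (x : E.sec P) :
    F.comparison P (extension ψ hψ P x) = ψ.lTensor P.carrier (E.comparison P x) :=
  (exists_extension ψ hψ P x).choose_spec

/-- On the fibre, the extension of an equivariant map `ψ` is `ψ` itself. -/
theorem QCohSheaf.extension_fiber [NeZero (Nat.card G : k)] {E F : QCohSheaf k G}
    (ψ : E.fiber →ₗ[k] F.fiber) (hψ : ∀ g x, ψ (E.rep g x) = F.rep g (ψ x)) (x : E.fiber) :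
    extension ψ hψ (triv G k) x = ψ x := by
  apply (F.trivEquiv k).symm.injective
  rw [← rTensor_evalOne_comparison, comparison_extension]
  have : ∀ (T : Type u) [CommRing T] [Algebra k T] (φ : T →ₐ[k] k) (z : T ⊗[k] E.fiber),
      φ.toLinearMap.rTensor F.fiber (ψ.lTensor T z) =
        ψ.lTensor k (φ.toLinearMap.rTensor E.fiber z) := by
    intro T _ _ φ z
    induction z with
    | zero => simp
    | add z w hz hw => simp only [map_add, hz, hw]
    | tmul t e => rfl
  refine (this _ (evalOne k k) _).trans ?_
  rw [rTensor_evalOne_comparison, trivEquiv_symm_fiber, trivEquiv_symm_fiber]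
  rfl

end Fiber

end BG

namespace BG

section Multiplicativity

variable {k G : Type u} [Field k] [Group G] [Finite G] {R R' : Type u} [CommRing R] [Algebra k R]
  [CommRing R'] [Algebra k R']

theorem AlgSheaf.trivEquiv_mul (A : AlgSheaf k G) (y z : R ⊗[k] A.toQCohSheaf.fiber) :
    A.toQCohSheaf.trivEquiv R (y * z : R ⊗[k] A.sec (triv G k)) =
      (A.toQCohSheaf.trivEquiv R y : A.sec (triv G R)) * A.toQCohSheaf.trivEquiv R z := by
  induction y with
  | zero => rw [zero_mul, map_zero, zero_mul]
  | add y w hy hw => rw [add_mul, map_add, map_add, add_mul, hy, hw]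
  | tmul r x =>
    induction z with
    | zero => rw [mul_zero, map_zero, mul_zero]
    | add y w hy hw => rw [mul_add, map_add, map_add, mul_add, hy, hw]
    | tmul s y =>
      rw [Algebra.TensorProduct.tmul_mul_tmul, QCohSheaf.trivEquiv_tmul, QCohSheaf.trivEquiv_tmul,
        QCohSheaf.trivEquiv_tmul]
      change _ • A.res _ (x * y) = (_ • A.res _ x) * (_ • A.res _ y)
      rw [map_mul, smul_mul_smul_comm]

theorem AlgSheaf.trivEquiv_one (A : AlgSheaf k G) :
    A.toQCohSheaf.trivEquiv R (1 : R ⊗[k] A.sec (triv G k)) = (1 : A.sec (triv G R)) := by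
  rw [Algebra.TensorProduct.one_def, QCohSheaf.trivEquiv_tmul, one_smul]
  exact map_one (A.res _)

/-- The comparison of a sheaf of algebras with its fibre is a homomorphism of algebras. -/
noncomputable def AlgSheaf.comparison (A : AlgSheaf k G) (P : Torsor G R) :
    A.sec P →ₐ[R] P.carrier ⊗[k] A.sec (triv G k) :=
  AlgHom.ofLinearMap (A.toQCohSheaf.comparison P)
    ((A.toQCohSheaf.trivEquiv P.carrier).injective (by
      rw [QCohSheaf.trivEquiv_comparison]
      exact (map_one (A.res _)).trans A.trivEquiv_one.symm))
    fun x y => (A.toQCohSheaf.trivEquiv P.carrier).injective (by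
      rw [QCohSheaf.trivEquiv_comparison, A.trivEquiv_mul, QCohSheaf.trivEquiv_comparison,
        QCohSheaf.trivEquiv_comparison]
      exact map_mul (A.res _) x y)

theorem AlgSheaf.comparison_apply (A : AlgSheaf k G) (P : Torsor G R) (x : A.sec P) :
    A.comparison P x = A.toQCohSheaf.comparison P x := rfl

end Multiplicativity

section BaseChangeAction

variable {k T T' B V : Type u} [Field k] [CommRing T] [Algebra k T] [CommRing T'] [Algebra k T']
  [Ring B] [Algebra k B] [AddCommGroup V] [Module k V] [Module B V] [IsScalarTower k B V]

variable (k T B V) in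
/-- The action of `T ⊗ B` on `T ⊗ V`, for a `B`-module `V`. -/
noncomputable def baseChangeAction : T ⊗[k] B →ₐ[T] Module.End T (T ⊗[k] V) :=
  (LinearMap.tensorProductEnd k T V).comp
    (Algebra.TensorProduct.map (AlgHom.id T T) (Algebra.lsmul k k V))

theorem baseChangeAction_tmul (t t' : T) (b : B) (v : V) :
    baseChangeAction k T B V (t ⊗ₜ b) (t' ⊗ₜ v) = (t * t') ⊗ₜ (b • v) := by
  rfl

theorem baseChangeAction_rTensor (φ : T →ₐ[k] T') (b : T ⊗[k] B) (x : T ⊗[k] V) :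
    φ.toLinearMap.rTensor V (baseChangeAction k T B V b x) =
      baseChangeAction k T' B V (φ.toLinearMap.rTensor B b) (φ.toLinearMap.rTensor V x) := by
  induction x with
  | zero => simp only [map_zero]
  | add y w hy hw => simp only [map_add, hy, hw]
  | tmul t v =>
    induction b with
    | zero => simp only [map_zero, LinearMap.zero_apply]
    | add y w hy hw => simp only [map_add, LinearMap.add_apply, hy, hw]
    | tmul s b => simp [baseChangeAction_tmul]

/-- The assertion that `B` is the endomorphism algebra of `V` is preserved by base change. -/
theorem baseChangeAction_bijective [Module.Finite k V]
    (h : Function.Bijective (Algebra.lsmul k k V : B →ₐ[k] Module.End k V)) :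
    Function.Bijective (baseChangeAction k T B V) := by
  have h1 : Function.Bijective (LinearMap.tensorProductEnd k T V) := by
    have : Module.FinitePresentation k V := Module.finitePresentation_of_finite k V
    have hb := Module.FinitePresentation.isBaseChange_map (R := k) (M := V) (N := V) T
    convert hb.equiv.bijective using 1
    funext z
    induction z with
    | zero => simp
    | add z w hz hw => rw [map_add, map_add, hz, hw]
    | tmul t e => rw [hb.equiv_tmul]; rfl
  refine h1.comp ?_
  exact (Algebra.TensorProduct.congr (AlgEquiv.refl (R := T) (A₁ := T))
    (AlgEquiv.ofBijective _ h)).bijective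

end BaseChangeAction

/-! ### Sheaves descended from representations -/

/-- A map of modules is a base change if it becomes one over a faithfully flat extension. -/
theorem isBaseChangeAlong_of_descent {k R R' T T' E E' N N' : Type u} [Field k] [CommRing R]
    [Algebra k R] [CommRing R'] [Algebra k R'] [CommRing T] [Algebra R T] [CommRing T']
    [Algebra R' T'] [Module.FaithfullyFlat R' T'] [AddCommGroup E] [Module R E] [AddCommGroup E']
    [Module R' E'] [AddCommGroup N] [Module R N] [Module T N] [IsScalarTower R T N]
    [AddCommGroup N'] [Module R' N'] [Module T' N'] [IsScalarTower R' T' N']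
    (f : R →ₐ[k] R') (φ : T →+* T') (hφ : ∀ r, φ (algebraMap R T r) = algebraMap R' T' (f r))
    {j : E →ₗ[R] N} (hj : IsBaseChange T j) {j' : E' →ₗ[R'] N'} (hj' : IsBaseChange T' j')
    (g : N →+ N') (hg : letI := φ.toAlgebra
      ∃ e : T' ⊗[T] N ≃ₗ[T'] N', ∀ x : N, e (1 ⊗ₜ[T] x) = g x)
    (l : E →+ E') (hl : ∀ (r : R) x, l (r • x) = f r • l x) (hlg : ∀ x, j' (l x) = g (j x)) :
    IsBaseChangeAlong f l := by
  let _ : Algebra R R' := f.toRingHom.toAlgebra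
  let _ : Algebra T T' := φ.toAlgebra
  let _ : Algebra R T' := ((algebraMap R' T').comp (algebraMap R R')).toAlgebra
  have : IsScalarTower R R' T' := .of_algebraMap_eq fun c => rfl
  have : IsScalarTower R T T' := .of_algebraMap_eq fun c => (hφ c).symm
  let _ : Module R E' := Module.compHom _ (algebraMap R R')
  have : IsScalarTower R R' E' := .of_algebraMap_smul fun _ _ => rfl
  let _ : Module R N' := Module.compHom _ (algebraMap R R')
  have : IsScalarTower R R' N' := .of_algebraMap_smul fun _ _ => rfl
  let _ : Module T N' := Module.compHom _ (algebraMap T T')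
  have : IsScalarTower T T' N' := .of_algebraMap_smul fun _ _ => rfl
  have : IsScalarTower R T' N' := .of_algebraMap_smul fun r x => algebraMap_smul T' (f r) x
  have : IsScalarTower R T N' := .of_algebraMap_smul fun r x => by
    rw [← algebraMap_smul T', ← IsScalarTower.algebraMap_apply R T T', algebraMap_smul]
  obtain ⟨e, he⟩ := hg
  let gl : N →ₗ[T] N' :=
    { toFun := g
      map_add' := map_add g
      map_smul' := fun t x => by
        rw [← he, ← he, TensorProduct.tmul_smul, ← algebraMap_smul T' t (1 ⊗ₜ[T] x : T' ⊗[T] N),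
          map_smul]
        rfl }
  have hgl : IsBaseChange T' gl := IsBaseChange.of_equiv e he
  let ll : E →ₗ[R] E' :=
    { toFun := l
      map_add' := map_add l
      map_smul' := hl }
  have hll : IsBaseChange R' ll := by
    refine IsBaseChange.of_faithfullyFlat ll j' hj' ?_
    have := hj.comp hgl
    convert this using 1
    exact LinearMap.ext hlg
  exact ⟨hll.equiv, fun x => by rw [hll.equiv_tmul, one_smul]; rfl⟩

section Descended

variable {k G : Type u} [Field k] [Group G] [Finite G] [NeZero (Nat.card G : k)]
  {R R' : Type u} [CommRing R] [Algebra k R] [CommRing R'] [Algebra k R']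
  {V : Type u} [AddCommGroup V] [Module k V]

/-- The sections on `P` of the sheaf descended from `V`: the invariants of `T ⊗ V`. -/
noncomputable abbrev descendedSections (ρ : Representation k G V) (P : Torsor G R) :
    Submodule R (P.carrier ⊗[k] V) :=
  invariants (R := R) (diagonalAction P.carrier ρ) (fun g t x => diagonalAction_smul ρ g t x)

omit [Finite G] [NeZero (Nat.card G : k)] in
theorem rTensor_diagonalAction (ρ : Representation k G V) {f : R →ₐ[k] R'} {P : Torsor G R}
    {P' : Torsor G R'} (h : TorsorHom f P P') (g : G) (x : P.carrier ⊗[k] V) :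
    diagonalAction P'.carrier ρ g (h.toAlgHom.toLinearMap.rTensor V x) =
      h.toAlgHom.toLinearMap.rTensor V (diagonalAction P.carrier ρ g x) := by
  induction x with
  | zero => simp
  | add z w hz hw => simp only [map_add, hz, hw]
  | tmul t e =>
    rw [LinearMap.rTensor_tmul, diagonalAction_tmul, diagonalAction_tmul, LinearMap.rTensor_tmul]
    congr 1
    exact (h.map_smul g t).symm

omit [Finite G] [NeZero (Nat.card G : k)] in
theorem rTensor_smul_base {f : R →ₐ[k] R'} {P : Torsor G R}
    {P' : Torsor G R'} (h : TorsorHom f P P') (r : R) (x : P.carrier ⊗[k] V) :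
    h.toAlgHom.toLinearMap.rTensor V (r • x) = f r • h.toAlgHom.toLinearMap.rTensor V x := by
  induction x with
  | zero => simp
  | add z w hz hw => simp only [map_add, smul_add, hz, hw]
  | tmul t e =>
    rw [TensorProduct.smul_tmul', LinearMap.rTensor_tmul, LinearMap.rTensor_tmul,
      TensorProduct.smul_tmul']
    congr 1
    rw [Algebra.smul_def, Algebra.smul_def, ← h.map_algebraMap]
    exact map_mul h.toRingHom _ _

/-- The restriction maps of the sheaf descended from `V`. -/
noncomputable def descendedRes (ρ : Representation k G V) {f : R →ₐ[k] R'} {P : Torsor G R}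
    {P' : Torsor G R'} (h : TorsorHom f P P') : descendedSections ρ P →+ descendedSections ρ P' where
  toFun x := ⟨h.toAlgHom.toLinearMap.rTensor V x, fun g => by
    rw [rTensor_diagonalAction, x.2 g]⟩
  map_zero' := Subtype.ext (map_zero _)
  map_add' x y := Subtype.ext (map_add _ _ _)

omit [Finite G] [NeZero (Nat.card G : k)] in
theorem descendedRes_coe (ρ : Representation k G V) {f : R →ₐ[k] R'} {P : Torsor G R}
    {P' : Torsor G R'} (h : TorsorHom f P P') (x : descendedSections ρ P) :
    (descendedRes ρ h x : P'.carrier ⊗[k] V) = h.toAlgHom.toLinearMap.rTensor V x := rfl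

/-- Galois descent for the representation `V`: the invariants of `P.carrier ⊗ V` are a form of it
over the base. -/
theorem isBaseChange_descendedSections (ρ : Representation k G V) (P : Torsor G R) :
    IsBaseChange P.carrier (descendedSections ρ P).subtype := by
  have := Fintype.ofFinite G
  exact isBaseChange_invariants _ P.bijective (isUnit_card (k := k) (G := G) R) _

theorem descendedRes_baseChange (ρ : Representation k G V) {f : R →ₐ[k] R'} {P : Torsor G R}
    {P' : Torsor G R'} (h : TorsorHom f P P') : IsBaseChangeAlong f (descendedRes ρ h) := by
  refine isBaseChangeAlong_of_descent f h.toRingHom h.map_algebraMap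
    (isBaseChange_descendedSections ρ P) (isBaseChange_descendedSections ρ P')
    (h.toAlgHom.toLinearMap.rTensor V).toAddMonoidHom ?_ _
    (fun r x => Subtype.ext (rTensor_smul_base h r x.1)) fun x => rfl
  let _ : Algebra P.carrier P'.carrier := h.toRingHom.toAlgebra
  have : IsScalarTower k P.carrier P'.carrier :=
    .of_algebraMap_eq fun c => (h.toAlgHom.commutes c).symm
  refine ⟨TensorProduct.AlgebraTensorModule.cancelBaseChange k P.carrier P'.carrier P'.carrier V,
    fun x => ?_⟩
  induction x with
  | zero => simp
  | add z w hz hw => rw [TensorProduct.tmul_add, map_add, map_add, hz, hw]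
  | tmul t v =>
    rw [TensorProduct.AlgebraTensorModule.cancelBaseChange_tmul, Algebra.smul_def, mul_one]
    rfl

/-- The quasi-coherent sheaf descended from a representation of `G`. -/
noncomputable abbrev descend (ρ : Representation k G V) : QCohSheaf k G where
  sec P := descendedSections ρ P
  res h := descendedRes ρ h
  res_smul h r x := Subtype.ext (rTensor_smul_base h r x.1)
  res_id P x := Subtype.ext (by
    rw [descendedRes_coe]
    exact LinearMap.congr_fun (LinearMap.rTensor_id V P.carrier) x.1)
  res_comp h' h x := Subtype.ext (by
    rw [descendedRes_coe, descendedRes_coe, descendedRes_coe, ← LinearMap.rTensor_comp_apply]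
    rfl)
  baseChange h := descendedRes_baseChange ρ h

end Descended

end BG

namespace BG

section DescendedAlgebra

variable {k G : Type u} [Field k] [Group G] [Finite G] [NeZero (Nat.card G : k)]
  {R R' : Type u} [CommRing R] [Algebra k R] [CommRing R'] [Algebra k R']
  {B : Type u} [Ring B] [Algebra k B]

omit [Finite G] [NeZero (Nat.card G : k)] in
theorem diagonalAction_mul {T : Type u} [CommRing T] [Algebra k T] [MulSemiringAction G T]
    [SMulCommClass G k T] (ρ : G →* (B ≃ₐ[k] B)) (g : G) (x y : T ⊗[k] B) :
    diagonalAction T (AlgEquiv.toLinearMapHom k B |>.comp ρ) g (x * y) =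
      diagonalAction T (AlgEquiv.toLinearMapHom k B |>.comp ρ) g x *
        diagonalAction T (AlgEquiv.toLinearMapHom k B |>.comp ρ) g y := by
  induction x with
  | zero => simp
  | add z w hz hw => simp only [map_add, add_mul, hz, hw]
  | tmul t b =>
    induction y with
    | zero => simp
    | add z w hz hw => simp only [map_add, mul_add, hz, hw]
    | tmul s c => simp [diagonalAction_tmul, smul_mul']

/-- The representation underlying an action by algebra automorphisms. -/
noncomputable abbrev algRep (ρ : G →* (B ≃ₐ[k] B)) : Representation k G B :=
  (AlgEquiv.toLinearMapHom k B).comp ρ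

/-- The sections of the sheaf of algebras descended from `B`, as a subalgebra of `T ⊗ B`. -/
noncomputable abbrev descendedSubalgebra (ρ : G →* (B ≃ₐ[k] B)) (P : Torsor G R) :
    Subalgebra R (P.carrier ⊗[k] B) where
  carrier := descendedSections (algRep ρ) P
  mul_mem' {x y} hx hy g := by rw [diagonalAction_mul, hx g, hy g]
  add_mem' {x y} hx hy := add_mem hx hy
  algebraMap_mem' r g := by
    change diagonalAction P.carrier (algRep ρ) g (algebraMap R P.carrier r ⊗ₜ 1) = _
    rw [diagonalAction_tmul, smul_algebraMap_eq]
    change _ ⊗ₜ (ρ g 1) = _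
    rw [map_one]
    rfl

/-- The sheaf of algebras descended from an algebra on which `G` acts by automorphisms. -/
noncomputable def descendAlg (ρ : G →* (B ≃ₐ[k] B)) : AlgSheaf k G where
  sec P := descendedSubalgebra ρ P
  res {R R' _ _ _ _ f P P'} h :=
    { toFun := descendedRes (algRep ρ) h
      map_zero' := map_zero _
      map_add' := map_add _
      map_one' := Subtype.ext (map_one (Algebra.TensorProduct.map h.toAlgHom (AlgHom.id k B)))
      map_mul' := fun x y => Subtype.ext
        (map_mul (Algebra.TensorProduct.map h.toAlgHom (AlgHom.id k B)) x.1 y.1) }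
  res_algebraMap {R R' _ _ _ _ f P P'} h r := Subtype.ext (by
    change h.toAlgHom.toLinearMap.rTensor B (algebraMap R P.carrier r ⊗ₜ 1) =
      algebraMap R' P'.carrier (f r) ⊗ₜ 1
    rw [LinearMap.rTensor_tmul, ← h.map_algebraMap]
    rfl)
  res_id P x := (descend (algRep ρ)).res_id P x
  res_comp h' h x := (descend (algRep ρ)).res_comp h' h x
  baseChange h := descendedRes_baseChange (algRep ρ) h

/-- The torsor `P` itself is an étale cover over which the descended algebra becomes a matrix
algebra. -/
theorem isEtaleLocallyMatrix_descendAlg (ρ : G →* (B ≃ₐ[k] B)) (m : ℕ)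
    (e : B ≃ₐ[k] Matrix (Fin m) (Fin m) k) (P : Torsor G R) :
    IsEtaleLocallyMatrix R ((descendAlg ρ).sec P) m := by
  have hb : IsBaseChange P.carrier (descendedSubalgebra ρ P).val.toLinearMap :=
    isBaseChange_descendedSections (algRep ρ) P
  let e₁ : P.carrier ⊗[R] descendedSubalgebra ρ P ≃ₐ[P.carrier] P.carrier ⊗[k] B :=
    Algebra.TensorProduct.algEquivOfLinearEquivTensorProduct hb.equiv
      (fun a₁ a₂ b₁ b₂ => by simp [IsBaseChange.equiv_tmul, mul_comm a₁, mul_smul])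
      (by simp [IsBaseChange.equiv_tmul])
  obtain ⟨e₂⟩ := matrix_baseChange (R := k) (S := k) (S' := P.carrier)
    ((Algebra.TensorProduct.lid k B).trans e)
  exact ⟨P.carrier, inferInstance, inferInstance, P.etale, P.faithfullyFlat, ⟨e₁.trans e₂⟩⟩

end DescendedAlgebra

section DescendedAction

variable {k G : Type u} [Field k] [Group G] [Finite G] [NeZero (Nat.card G : k)]
  {R R' : Type u} [CommRing R] [Algebra k R] [CommRing R'] [Algebra k R']
  {C : AlgSheaf k G} {V : Type u} [AddCommGroup V] [Module k V] [Module (C.sec (triv G k)) V]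
  [IsScalarTower k (C.sec (triv G k)) V] {ρ : Representation k G V}

omit [NeZero (Nat.card G : k)] in
theorem diagonalAction_baseChangeAction {T : Type u} [CommRing T] [Algebra k T]
    [MulSemiringAction G T] [SMulCommClass G k T]
    (hρ : ∀ g (c : C.sec (triv G k)) v,
      ρ g (c • v) = (C.toQCohSheaf.rep g c : C.sec (triv G k)) • ρ g v) (g : G)
    (c : T ⊗[k] C.sec (triv G k)) (x : T ⊗[k] V) :
    diagonalAction T ρ g (baseChangeAction k T _ V c x) =
      baseChangeAction k T _ V (diagonalAction T C.toQCohSheaf.rep g c)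
        (diagonalAction T ρ g x) := by
  induction x with
  | zero => simp only [map_zero]
  | add z w hz hw => simp only [map_add, hz, hw]
  | tmul t v =>
    induction c with
    | zero => simp only [map_zero, LinearMap.zero_apply]
    | add z w hz hw => simp only [map_add, LinearMap.add_apply, hz, hw]
    | tmul s c =>
      rw [baseChangeAction_tmul, diagonalAction_tmul, diagonalAction_tmul, diagonalAction_tmul,
        hρ, smul_mul']
      exact (baseChangeAction_tmul _ _ _ _).symm

omit [NeZero (Nat.card G : k)] in
theorem baseChangeAction_comparison_mem
    (hρ : ∀ g (c : C.sec (triv G k)) v,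
      ρ g (c • v) = (C.toQCohSheaf.rep g c : C.sec (triv G k)) • ρ g v) (P : Torsor G R)
    (c : C.sec P) {x : P.carrier ⊗[k] V} (hx : x ∈ descendedSections ρ P) :
    baseChangeAction k P.carrier _ V (C.comparison P c) x ∈ descendedSections ρ P := by
  intro g
  have h1 := diagonalAction_baseChangeAction hρ g (C.comparison P c) x
  have h2 : diagonalAction P.carrier C.toQCohSheaf.rep g (C.comparison P c) = C.comparison P c :=
    C.toQCohSheaf.diagonalAction_comparison P g c
  rw [hx g, h2] at h1
  exact h1

/-- If `V` is a module over the fibre of a sheaf of algebras `C`, compatibly with the actions of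
`G`, then `C` acts on the sheaf descended from `V`. -/
noncomputable def descendAction
    (hρ : ∀ g (c : C.sec (triv G k)) v,
      ρ g (c • v) = (C.toQCohSheaf.rep g c : C.sec (triv G k)) • ρ g v) (P : Torsor G R) :
    C.sec P →ₐ[R] Module.End R (descendedSections ρ P) where
  toFun c :=
    { toFun := fun x => ⟨baseChangeAction k P.carrier _ V (C.comparison P c) x,
        baseChangeAction_comparison_mem hρ P c x.2⟩
      map_add' := fun x y => Subtype.ext (map_add _ _ _)
      map_smul' := fun r x => Subtype.ext (LinearMap.map_smul_of_tower _ r x.1) }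
  map_one' := LinearMap.ext fun x => Subtype.ext (by
    change baseChangeAction k P.carrier _ V (C.comparison P 1) x.1 = x.1
    rw [map_one, map_one]; rfl)
  map_mul' c d := LinearMap.ext fun x => Subtype.ext (by
    change baseChangeAction k P.carrier _ V (C.comparison P (c * d)) x.1 = _
    rw [map_mul, map_mul]; rfl)
  map_zero' := LinearMap.ext fun x => Subtype.ext (by
    change baseChangeAction k P.carrier _ V (C.comparison P 0) x.1 = _
    rw [map_zero, map_zero]; rfl)
  map_add' c d := LinearMap.ext fun x => Subtype.ext (by
    change baseChangeAction k P.carrier _ V (C.comparison P (c + d)) x.1 = _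
    rw [map_add, map_add]; rfl)
  commutes' r := LinearMap.ext fun x => Subtype.ext (by
    change baseChangeAction k P.carrier _ V (C.comparison P (algebraMap R _ r)) x.1 = r • x.1
    rw [AlgHom.commutes, IsScalarTower.algebraMap_apply R P.carrier, AlgHom.commutes,
      ← algebraMap_smul P.carrier r x.1]
    rfl)

variable (hρ : ∀ g (c : C.sec (triv G k)) v,
      ρ g (c • v) = (C.toQCohSheaf.rep g c : C.sec (triv G k)) • ρ g v)

omit [NeZero (Nat.card G : k)] in
theorem descendAction_coe (P : Torsor G R) (c : C.sec P) (x : descendedSections ρ P) :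
    (descendAction hρ P c x : P.carrier ⊗[k] V) =
      baseChangeAction k P.carrier _ V (C.comparison P c) x := rfl

omit [NeZero (Nat.card G : k)] in
theorem descendedRes_descendAction {f : R →ₐ[k] R'} {P : Torsor G R}
    {P' : Torsor G R'} (h : TorsorHom f P P') (c : C.sec P) (x : descendedSections ρ P) :
    descendedRes ρ h (descendAction hρ P c x) =
      descendAction hρ P' (C.res h c) (descendedRes ρ h x) := by
  apply Subtype.ext
  rw [descendAction_coe, descendedRes_coe, descendAction_coe, descendedRes_coe,
    baseChangeAction_rTensor]
  congr 2
  exact (C.toQCohSheaf.comparison_res h c).symm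

/-- The invariants span, so linear maps out of the base change are determined by their values there.
-/
theorem span_descendedSections (ρ : Representation k G V) (P : Torsor G R) :
    Submodule.span P.carrier (descendedSections ρ P : Set (P.carrier ⊗[k] V)) = ⊤ := by
  rw [eq_top_iff]
  intro x _
  have hb := isBaseChange_descendedSections ρ P
  obtain ⟨z, rfl⟩ := hb.equiv.surjective x
  induction z with
  | zero => simp
  | add z w hz hw => rw [map_add]; exact add_mem (hz trivial) (hw trivial)
  | tmul t v =>
    rw [hb.equiv_tmul]
    exact Submodule.smul_mem _ _ (Submodule.subset_span v.2)

/-- If the fibre of `C` is the endomorphism algebra of `V`, then `C` is the sheaf of endomorphisms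
of the sheaf descended from `V`. -/
theorem descendAction_bijective [Module.Finite k V]
    (h : Function.Bijective (Algebra.lsmul k k V : C.sec (triv G k) →ₐ[k] Module.End k V))
    (P : Torsor G R) : Function.Bijective (descendAction hρ P) := by
  have hT := baseChangeAction_bijective (T := P.carrier) h
  constructor
  · intro c d hcd
    apply C.toQCohSheaf.comparison_injective P
    apply hT.1
    apply LinearMap.ext_on (span_descendedSections ρ P)
    intro x hx
    exact congrArg Subtype.val (LinearMap.congr_fun hcd ⟨x, hx⟩)
  · intro φ
    have hb := isBaseChange_descendedSections ρ P
    let Φ : Module.End P.carrier (P.carrier ⊗[k] V) :=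
      hb.lift ((descendedSections ρ P).subtype ∘ₗ φ)
    have hΦ : ∀ x : descendedSections ρ P, Φ x = φ x := fun x => hb.lift_eq _ x
    obtain ⟨y, hy⟩ := hT.2 Φ
    obtain ⟨c, hc⟩ := C.toQCohSheaf.exists_comparison_eq P (y := y) fun g => by
      apply hT.1
      apply LinearMap.ext_on (span_descendedSections ρ P)
      intro x hx
      have h1 := diagonalAction_baseChangeAction hρ g y x
      rw [hx g] at h1
      rw [← h1, hy, hΦ ⟨x, hx⟩]
      exact (φ ⟨x, hx⟩).2 g
    refine ⟨c, LinearMap.ext fun x => Subtype.ext ?_⟩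
    rw [descendAction_coe, ← hΦ, ← hy, C.comparison_apply, hc]

theorem isVectorBundle_descend [Module.Finite k V] [Nontrivial V] (ρ : Representation k G V) :
    (descend ρ).IsVectorBundle := by
  refine ⟨Module.finrank k V, Module.finrank_pos, fun {R} _ _ P => ?_⟩
  refine ⟨P.carrier, inferInstance, inferInstance, P.etale, P.faithfullyFlat, ⟨?_⟩⟩
  exact (isBaseChange_descendedSections ρ P).equiv.trans
    (((Module.finBasis k V).baseChange P.carrier).equivFun)

include hρ in
/-- If the fibre of `C` is the endomorphism algebra of a vector space `V`, and `G` acts compatibly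
on both, then `C` is the endomorphism sheaf of the sheaf descended from `V`. -/
theorem isEndSheaf_descend [Module.Finite k V]
    (h : Function.Bijective (Algebra.lsmul k k V : C.sec (triv G k) →ₐ[k] Module.End k V)) :
    IsEndSheaf C (descend ρ) :=
  ⟨fun P => AlgEquiv.ofBijective (descendAction hρ P) (descendAction_bijective hρ h P),
    fun h a x => descendedRes_descendAction hρ h a x⟩

theorem finite_descendedSections [Module.Finite k V] (ρ : Representation k G V)
    (P : Torsor G R) : Module.Finite R (descendedSections ρ P) := by
  have : Module.Finite P.carrier (P.carrier ⊗[R] descendedSections ρ P) :=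
    Module.Finite.equiv (isBaseChange_descendedSections ρ P).equiv.symm
  exact Module.Finite.of_finite_tensorProduct_of_faithfullyFlat (R := R)
    (M := descendedSections ρ P) P.carrier

end DescendedAction

section DescendedFiber

variable {k G : Type u} [Field k] [Group G] [Finite G] [NeZero (Nat.card G : k)]
  {R : Type u} [CommRing R] [Algebra k R] {V : Type u} [AddCommGroup V] [Module k V]

/-- A point of the torsor identifies the sections of the descended sheaf with the base change
of `V`. -/
theorem rTensor_descendedSections_bijective (ρ : Representation k G V) (P : Torsor G R)
    (ε : P.carrier →ₐ[k] R) (hε : ∀ r, ε (algebraMap R P.carrier r) = r)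
    (l : descendedSections ρ P →ₗ[R] R ⊗[k] V) (hl : ∀ x, l x = ε.toLinearMap.rTensor V x.1) :
    Function.Bijective l := by
  let _ : Algebra P.carrier R := ε.toAlgebra
  have : IsScalarTower R P.carrier R := .of_algebraMap_eq fun c => (hε c).symm
  have : IsScalarTower k P.carrier R := .of_algebraMap_eq fun c => (ε.commutes c).symm
  let g : P.carrier ⊗[k] V →ₗ[P.carrier] R ⊗[k] V :=
    TensorProduct.AlgebraTensorModule.rTensor k V (Algebra.linearMap P.carrier R)
  have hg : IsBaseChange R g := by
    refine IsBaseChange.of_comp (TensorProduct.isBaseChange k V P.carrier) ?_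
    convert TensorProduct.isBaseChange k V R using 1
    ext v
    simp [g]
  have hb : IsBaseChange R l := by
    convert (isBaseChange_descendedSections ρ P).comp hg using 1
    exact LinearMap.ext hl
  convert ((TensorProduct.lid R _).symm.trans hb.equiv).bijective using 1
  funext x
  simp [hb.equiv_tmul]

/-- Evaluation at `1` of the sections of a descended sheaf on a trivial torsor. -/
noncomputable def descendEval (ρ : Representation k G V) (R : Type u) [CommRing R] [Algebra k R] :
    (descend ρ).sec (triv G R) →ₗ[R] R ⊗[k] V where
  toFun x := (evalOne k R).toLinearMap.rTensor V x.1
  map_add' x y := map_add _ _ _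
  map_smul' r x := by
    change (evalOne k R).toLinearMap.rTensor V (r • x.1) = r • _
    induction x.1 with
    | zero => simp
    | add z w hz hw => rw [smul_add, map_add, map_add, hz, hw, smul_add]
    | tmul f v => rfl

/-- Invariant functions `G → R ⊗ V` are determined by their value at `1`, which is arbitrary. -/
theorem descendEval_bijective (ρ : Representation k G V) (R : Type u) [CommRing R] [Algebra k R] :
    Function.Bijective (descendEval ρ R) :=
  rTensor_descendedSections_bijective ρ (triv G R) (evalOne k R) (fun _ => rfl)
    (descendEval ρ R) fun _ => rfl

/-- The fibre of the sheaf descended from `V` is `V`. -/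
noncomputable def descendFiberEquiv (ρ : Representation k G V) : (descend ρ).fiber ≃ₗ[k] V :=
  (LinearEquiv.ofBijective _ (descendEval_bijective ρ k)).trans (TensorProduct.lid k V)

theorem descendEval_translation (ρ : Representation k G V) (g : G)
    (x : (descend ρ).sec (triv G R)) :
    descendEval ρ R ((descend ρ).res (trivTranslation k R g) x) =
      (ρ g).lTensor R (descendEval ρ R x) := by
  have key : ∀ z : (triv G R).carrier ⊗[k] V, (evalOne k R).toLinearMap.rTensor V
      ((trivTranslation k R g).toAlgHom.toLinearMap.rTensor V
        (diagonalAction (triv G R).carrier ρ g z)) =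
      (ρ g).lTensor R ((evalOne k R).toLinearMap.rTensor V z) := by
    intro z
    induction z with
    | zero => simp
    | add z w hz hw => simp only [map_add, hz, hw]
    | tmul f v =>
      rw [diagonalAction_tmul, LinearMap.rTensor_tmul, LinearMap.rTensor_tmul,
        LinearMap.rTensor_tmul, LinearMap.lTensor_tmul]
      congr 1
      change (f : G → R) (g⁻¹ * 1 * g) = (f : G → R) 1
      rw [mul_one, inv_mul_cancel]
  rw [← show _ = descendEval ρ R x from rfl]
  refine Eq.trans ?_ (key x.1)
  rw [x.2 g]
  rfl

/-- The fibre of the sheaf descended from `V` is `V` also as a representation. -/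
theorem descendFiberEquiv_rep (ρ : Representation k G V) (g : G) (x : (descend ρ).fiber) :
    descendFiberEquiv ρ ((descend ρ).rep g x) = ρ g (descendFiberEquiv ρ x) := by
  change TensorProduct.lid k V (descendEval ρ k _) = ρ g (TensorProduct.lid k V (descendEval ρ k x))
  rw [QCohSheaf.rep_apply, descendEval_translation]
  induction descendEval ρ k x with
  | zero => simp
  | add z w hz hw => simp only [map_add, hz, hw]
  | tmul f v => simp

variable {C : AlgSheaf k G} [Module (C.sec (triv G k)) V]
  [IsScalarTower k (C.sec (triv G k)) V] {ρ : Representation k G V}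
  (hρ : ∀ g (c : C.sec (triv G k)) v,
      ρ g (c • v) = (C.toQCohSheaf.rep g c : C.sec (triv G k)) • ρ g v)

theorem descendEval_descendAction (c : C.sec (triv G R)) (x : (descend ρ).sec (triv G R)) :
    descendEval ρ R (descendAction hρ (triv G R) c x) =
      baseChangeAction k R _ V ((C.toQCohSheaf.trivEquiv R).symm c) (descendEval ρ R x) := by
  change (evalOne k R).toLinearMap.rTensor V _ = _
  rw [descendAction_coe, baseChangeAction_rTensor]
  exact congrArg (fun y => baseChangeAction k R (C.sec (triv G k)) V y (descendEval ρ R x))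
    (C.toQCohSheaf.rTensor_evalOne_comparison c)

/-- The fibre of the sheaf descended from `V` is `V` also as a module over the fibre of `C`. -/
theorem descendFiberEquiv_descendAction (c : C.sec (triv G k)) (x : (descend ρ).fiber) :
    descendFiberEquiv ρ (descendAction hρ (triv G k) c x) = c • descendFiberEquiv ρ x := by
  change TensorProduct.lid k V (descendEval ρ k _) = c • (TensorProduct.lid k V (descendEval ρ k x))
  rw [descendEval_descendAction, QCohSheaf.trivEquiv_symm_fiber]
  induction descendEval ρ k x with
  | zero => simp
  | add z w hz hw => simp only [map_add, hz, hw, smul_add]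
  | tmul f v =>
    rw [baseChangeAction_tmul]
    rw [TensorProduct.lid_tmul, TensorProduct.lid_tmul, smul_comm, one_mul]

end DescendedFiber

end BG

/-! ### Central simple algebras over a field with trivial Brauer group -/

section CentralSimple

variable {k : Type u} [Field k] {A : Type u} [Ring A] [Algebra k A]

theorem isCentral_of_mulLeftRight_bijective (h : Function.Bijective (AlgHom.mulLeftRight k A)) :
    Algebra.IsCentral k A := by
  refine ⟨fun z hz => ?_⟩
  have hz := Subalgebra.mem_center_iff.mp hz
  have h1 : Algebra.lmul k A z ∈ Subalgebra.center k (Module.End k A) := by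
    rw [Subalgebra.mem_center_iff]
    intro f
    obtain ⟨t, rfl⟩ := h.2 f
    induction t with
    | zero => simp
    | add x y hx hy => rw [map_add, add_mul, mul_add, hx, hy]
    | tmul a b =>
      ext x
      simp [AlgHom.mulLeftRight_apply, mul_assoc, ← mul_assoc a z, hz a]
  rw [Algebra.IsCentral.center_eq_bot] at h1
  obtain ⟨c, hc⟩ := h1
  refine ⟨c, ?_⟩
  have := LinearMap.congr_fun hc 1
  simpa [Algebra.ofId_apply, Algebra.algebraMap_eq_smul_one] using this

theorem isSimpleRing_of_mulLeftRight_bijective [Nontrivial A]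
    (h : Function.Bijective (AlgHom.mulLeftRight k A)) : IsSimpleRing A := by
  refine ⟨⟨fun I => or_iff_not_imp_left.mpr fun hI => ?_⟩⟩
  obtain ⟨x, hx, hx0⟩ : ∃ x ∈ I, x ≠ 0 := by
    by_contra hc
    push Not at hc
    exact hI (le_bot_iff.mp fun x hx => (TwoSidedIdeal.mem_bot A).mpr (hc x hx))
  -- multiplications from both sides give every linear map, so an ideal containing `x ≠ 0` contains 1
  obtain ⟨φ, hφ⟩ := Module.Projective.exists_dual_eq_one k hx0
  obtain ⟨t, ht⟩ := h.2 (φ.smulRight (1 : A))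
  have key : ∀ t, AlgHom.mulLeftRight k A t x ∈ I := by
    intro t
    induction t with
    | zero => simp [I.zero_mem]
    | add y z hy hz => rw [map_add]; exact I.add_mem hy hz
    | tmul a b =>
      rw [AlgHom.mulLeftRight_apply]
      exact I.mul_mem_right _ _ (I.mul_mem_left _ _ hx)
  have h1 := key t
  rw [ht, LinearMap.smulRight_apply, hφ, one_smul] at h1
  exact (TwoSidedIdeal.one_mem_iff I).mp h1

/-- If a matrix algebra over `A` is a matrix algebra over `k`, then so is `A`. -/
theorem exists_algEquiv_end_of_matrix [Nontrivial A] {p q : ℕ} (hp : p ≠ 0)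
    (Φ : Matrix (Fin p) (Fin p) A ≃ₐ[k] Matrix (Fin q) (Fin q) k) :
    ∃ m : ℕ, 0 < m ∧ Nonempty (A ≃ₐ[k] Module.End k (Fin m → k)) := by
  have : NeZero p := ⟨hp⟩
  let W := Fin q → k
  let Ψ : Matrix (Fin p) (Fin p) A ≃ₐ[k] Module.End k W := Φ.trans Matrix.toLinAlgEquiv'
  -- the idempotent `e` cuts out a space `V` on which `A`, the corner at `e`, acts
  let e : Module.End k W := Ψ (Matrix.single 0 0 1)
  have hmul : ∀ a b : A, Ψ (Matrix.single 0 0 a) * Ψ (Matrix.single 0 0 b) =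
      Ψ (Matrix.single 0 0 (a * b)) := fun a b => by
    rw [← map_mul, Matrix.single_mul_single_same]
  let V := LinearMap.range e
  have heV : ∀ v : V, e v = v := by
    rintro ⟨_, w, rfl⟩
    change (e * e) w = e w
    rw [hmul, mul_one]
  have hmem : ∀ a w, Ψ (Matrix.single 0 0 a) w ∈ V := fun a w =>
    ⟨Ψ (Matrix.single 0 0 a) w, by
      change (e * Ψ (Matrix.single 0 0 a)) w = _
      rw [hmul, one_mul]⟩
  let θ : A →ₐ[k] Module.End k V :=
    { toFun := fun a => ((Ψ (Matrix.single 0 0 a)).comp V.subtype).codRestrict V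
        fun v => hmem a v
      map_one' := LinearMap.ext fun v => Subtype.ext (heV v)
      map_mul' := fun a b => LinearMap.ext fun v => Subtype.ext
        (LinearMap.congr_fun (hmul a b) v.1).symm
      map_zero' := LinearMap.ext fun v => Subtype.ext (by
        change Ψ (Matrix.single 0 0 0) v.1 = 0
        rw [Matrix.single_zero, map_zero]; rfl)
      map_add' := fun a b => LinearMap.ext fun v => Subtype.ext (by
        change Ψ (Matrix.single 0 0 (a + b)) v.1 = _
        rw [Matrix.single_add, map_add]; rfl)
      commutes' := fun c => LinearMap.ext fun v => Subtype.ext (by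
        change Ψ (Matrix.single 0 0 (algebraMap k A c)) v.1 = c • v.1
        rw [Algebra.algebraMap_eq_smul_one, ← Matrix.smul_single, map_smul, LinearMap.smul_apply]
        exact congrArg (c • ·) (heV v)) }
  have hθ : ∀ a (v : V), (θ a v : W) = Ψ (Matrix.single 0 0 a) v := fun _ _ => rfl
  have hbij : Function.Bijective θ := by
    constructor
    · rw [injective_iff_map_eq_zero]
      intro a ha
      have : Ψ (Matrix.single 0 0 a) = 0 := by
        rw [← mul_one a, ← hmul]
        refine LinearMap.ext fun w => ?_
        exact congrArg Subtype.val (LinearMap.congr_fun ha ⟨e w, w, rfl⟩)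
      rw [map_eq_zero_iff _ Ψ.injective] at this
      simpa using congrFun (congrFun this 0) 0
    · intro f
      let F : Module.End k W := V.subtype ∘ₗ f ∘ₗ e.rangeRestrict
      obtain ⟨M, hM⟩ := Ψ.surjective F
      have h1 : Ψ (Matrix.single 0 0 1 * M * Matrix.single 0 0 1) = Ψ M := by
        rw [map_mul, map_mul, hM]
        refine LinearMap.ext fun w => ?_
        change e (f (e.rangeRestrict (e w))) = f (e.rangeRestrict w)
        rw [heV]
        congr 2
        exact Subtype.ext (heV ⟨e w, w, rfl⟩)
      have h2 : Matrix.single 0 0 (M 0 0) = M := by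
        rw [← Ψ.injective h1]
        ext i j
        simp [Matrix.single_mul_mul_single]
      refine ⟨M 0 0, LinearMap.ext fun v => Subtype.ext ?_⟩
      rw [hθ, h2, hM]
      change (f (e.rangeRestrict v) : W) = f v
      congr 2
      exact Subtype.ext (heV v)
  refine ⟨Module.finrank k V, ?_, ⟨(AlgEquiv.ofBijective θ hbij).trans
    ((Module.finBasis k V).equivFun.conjAlgEquiv k)⟩⟩
  rw [Module.finrank_pos_iff]
  by_contra hV
  rw [not_nontrivial_iff_subsingleton] at hV
  exact one_ne_zero (hbij.1 (LinearMap.ext fun v => Subsingleton.elim _ _) : (1 : A) = 0)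

/-- Over a field with trivial Brauer group, a finite-dimensional algebra `A` for which `A ⊗ Aᵐᵒᵖ →
End A` is bijective is a matrix algebra. -/
theorem exists_algEquiv_end_of_subsingleton_brauerGroup [Subsingleton (BrauerGroup.{u, u} k)]
    [Nontrivial A] [Module.Finite k A] (h : Function.Bijective (AlgHom.mulLeftRight k A)) :
    ∃ m : ℕ, 0 < m ∧ Nonempty (A ≃ₐ[k] Module.End k (Fin m → k)) := by
  have := isCentral_of_mulLeftRight_bijective h
  have := isSimpleRing_of_mulLeftRight_bijective h
  obtain ⟨p, q, hp, -, ⟨Φ⟩⟩ := Quotient.exact (s := Brauer.CSA_Setoid k)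
    (Subsingleton.elim (Quotient.mk _ (⟨AlgCat.of k A⟩ : CSA.{u, u} k))
      (Quotient.mk _ (⟨AlgCat.of k k⟩ : CSA.{u, u} k)))
  exact exists_algEquiv_end_of_matrix hp Φ

end CentralSimple

namespace BG

/-! ### The class of an Azumaya algebra in `kˣ` modulo `n`-th powers -/

section HasClass

variable {k G : Type u} [Field k] [Group G] [Finite G]

/-- The algebra `A` has class `a` with respect to `g ∈ G` if `g` acts on the fibre of `A` by
conjugation by an element `u` with `u ^ n = a`. -/
def AlgSheaf.HasClass (A : AlgSheaf k G) (n : ℕ) (g : G) (a : kˣ) : Prop :=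
  ∃ u : A.sec (triv G k), u ^ n = algebraMap k _ a ∧
    ∀ x, A.res (trivTranslation k k g) x * u = u * x

variable {n : ℕ} {g : G} {a b : kˣ} {A B : AlgSheaf k G}

omit [Finite G] in
theorem isUnit_of_pow_eq_algebraMap {C : Type*} [Ring C] [Algebra k C] (hn : n ≠ 0) {u : C}
    (hu : u ^ n = algebraMap k C a) : IsUnit u :=
  (isUnit_pow_iff hn).mp (hu ▸ a.isUnit.map (algebraMap k C))

theorem AlgSheaf.res_trivTranslation_mul (A : AlgSheaf k G) (g h : G) (x : A.sec (triv G k)) :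
    A.res (trivTranslation k k (g * h)) x =
      A.res (trivTranslation k k g) (A.res (trivTranslation k k h) x) :=
  LinearMap.congr_fun (map_mul A.toQCohSheaf.rep g h) x

theorem AlgSheaf.res_trivTranslation_one (A : AlgSheaf k G) (x : A.sec (triv G k)) :
    A.res (trivTranslation k k (1 : G)) x = x :=
  LinearMap.congr_fun (map_one A.toQCohSheaf.rep) x

/-- Rescaling the conjugating element by `c` multiplies the class by `c ^ n`. -/
theorem AlgSheaf.HasClass.mul_pow (h : A.HasClass n g a) (c : kˣ) : A.HasClass n g (a * c ^ n) := by
  obtain ⟨u, hu, hux⟩ := h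
  refine ⟨u * algebraMap k _ c, ?_, fun x => ?_⟩
  · rw [(Algebra.commute_algebraMap_right (c : k) u).mul_pow, hu]
    simp
  · rw [← mul_assoc, hux, mul_assoc, mul_assoc, Algebra.commutes]

/-- If `A` has class `a` with respect to `g`, then it has class `a ^ i` with respect to `g ^ i`.
This is how the choice of a generator of `G` enters. -/
theorem AlgSheaf.HasClass.pow (h : A.HasClass n g a) (i : ℕ) : A.HasClass n (g ^ i) (a ^ i) := by
  obtain ⟨u, hu, hux⟩ := h
  refine ⟨u ^ i, by rw [← pow_mul, mul_comm, pow_mul, hu, Units.val_pow_eq_pow_val, map_pow], ?_⟩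
  induction i with
  | zero => intro x; simp [A.res_trivTranslation_one]
  | succ i ih =>
    intro x
    rw [pow_succ, A.res_trivTranslation_mul, pow_succ, ← mul_assoc, ih, mul_assoc, hux, mul_assoc]

theorem AlgSheaf.HasClass.of_iso (h : A.HasClass n g a) (i : A.Iso B) : B.HasClass n g a := by
  obtain ⟨u, hu, hux⟩ := h
  refine ⟨i.app _ u, by rw [← map_pow, hu, AlgEquiv.commutes], fun x => ?_⟩
  obtain ⟨y, rfl⟩ := (i.app (triv G k)).surjective x
  rw [← i.naturality, ← map_mul, hux, map_mul]

theorem AlgSheaf.HasClass.tensor (hA : A.HasClass n g a) (hB : B.HasClass n g b) :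
    (A.tensor B).HasClass n g (a * b) := by
  obtain ⟨u, hu, hux⟩ := hA
  obtain ⟨v, hv, hvx⟩ := hB
  refine ⟨u ⊗ₜ v, ?_, fun x => ?_⟩
  · rw [Algebra.TensorProduct.tmul_pow, hu, hv, Units.val_mul, map_mul,
      Algebra.TensorProduct.algebraMap_apply, Algebra.TensorProduct.algebraMap_apply',
      Algebra.TensorProduct.tmul_mul_tmul, one_mul, mul_one]
  · refine TensorProduct.induction_on x ?_ (fun y z => ?_) (fun y z hy hz => ?_)
    · rw [map_zero, zero_mul, mul_zero]
    · rw [AlgSheaf.tensor_res_tmul, Algebra.TensorProduct.tmul_mul_tmul,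
        Algebra.TensorProduct.tmul_mul_tmul, hux, hvx]
    · rw [map_add, add_mul, mul_add, hy, hz]

/-- The action of `g` on an endomorphism sheaf is conjugation by the action of `g` on the fibre of
the vector bundle, whose `n`-th power is `1`. -/
theorem hasClass_one_of_isEndSheaf {E : QCohSheaf k G} (hE : IsEndSheaf A E) (hg : g ^ n = 1) :
    A.HasClass n g 1 := by
  obtain ⟨ρ, hρ⟩ := hE
  refine ⟨(ρ (triv G k)).symm (E.rep g), ?_, fun x => (ρ (triv G k)).injective ?_⟩
  · rw [← map_pow, ← map_pow, hg, map_one, map_one, Units.val_one, map_one]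
  · rw [map_mul, map_mul, AlgEquiv.apply_symm_apply]
    exact LinearMap.ext fun v => (hρ (trivTranslation k k g) x v).symm

/-- Two elements inducing the same automorphism differ by a central element, that is, by a scalar;
so the class is unique modulo `n`-th powers. -/
theorem AlgSheaf.HasClass.exists_eq_mul_pow [Nontrivial (A.sec (triv G k))]
    [Algebra.IsCentral k (A.sec (triv G k))] (hn : n ≠ 0) (ha : A.HasClass n g a)
    (hb : A.HasClass n g b) : ∃ c : kˣ, a = b * c ^ n := by
  obtain ⟨u, hu, hux⟩ := ha
  obtain ⟨v, hv, hvx⟩ := hb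
  obtain ⟨u, rfl⟩ := isUnit_of_pow_eq_algebraMap hn hu
  obtain ⟨v, rfl⟩ := isUnit_of_pow_eq_algebraMap hn hv
  -- `u` and `v` induce the same automorphism of the fibre, so `v⁻¹ * u` is central
  have hz : (↑(v⁻¹ * u) : A.sec (triv G k)) ∈ Subalgebra.center k (A.sec (triv G k)) := by
    rw [Subalgebra.mem_center_iff]
    intro x
    calc x * (↑v⁻¹ * ↑u) = ↑v⁻¹ * (↑v * x) * (↑v⁻¹ * ↑u) := by rw [Units.inv_mul_cancel_left]
      _ = ↑v⁻¹ * (A.res (trivTranslation k k g) x * ↑u) := by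
        rw [← hvx, mul_assoc, mul_assoc, Units.mul_inv_cancel_left]
      _ = ↑v⁻¹ * ↑u * x := by rw [hux, mul_assoc]
  rw [Algebra.IsCentral.center_eq_bot] at hz
  obtain ⟨c, hc⟩ := hz
  have hc : algebraMap k (A.sec (triv G k)) c = ↑v⁻¹ * ↑u := hc
  have hc0 : c ≠ 0 := by
    rintro rfl
    rw [map_zero] at hc
    exact (v⁻¹ * u).ne_zero hc.symm
  refine ⟨Units.mk0 c hc0, Units.ext ((algebraMap k (A.sec (triv G k))).injective ?_)⟩
  have huv : (u : A.sec (triv G k)) = v * algebraMap k _ c := by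
    rw [hc, Units.mul_inv_cancel_left]
  rw [← hu, huv, (Algebra.commute_algebraMap_right c (v : A.sec (triv G k))).mul_pow, hv]
  simp

end HasClass

section Fiber

variable {k G : Type u} [Field k] [Group G] [Finite G]

theorem IsEtaleLocallyMatrix.nontrivial {A : Type u} [Ring A] [Algebra k A] {m : ℕ} (hm : 0 < m)
    (h : IsEtaleLocallyMatrix k A m) : Nontrivial A := by
  obtain ⟨S, _, _, _, _, ⟨e⟩⟩ := h
  have : Nontrivial S := (Module.FaithfullyFlat.faithfulSMul (A := k) (B := S)).algebraMap_injective.nontrivial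
  have : Nonempty (Fin m) := ⟨⟨0, hm⟩⟩
  have : Nontrivial (S ⊗[k] A) := e.toEquiv.nontrivial
  by_contra hA
  rw [not_nontrivial_iff_subsingleton] at hA
  exact not_subsingleton (S ⊗[k] A) inferInstance

/-- The fibre of an Azumaya algebra is a central simple algebra. -/
theorem fiber_isCentral_and_nontrivial {A : AlgSheaf k G} {m : ℕ} (hm : 0 < m)
    (h : IsEtaleLocallyMatrix k (A.sec (triv G k)) m) :
    Algebra.IsCentral k (A.sec (triv G k)) ∧ Nontrivial (A.sec (triv G k)) :=
  ⟨isCentral_of_mulLeftRight_bijective (h.mulLeftRight_bijective hm), h.nontrivial hm⟩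

/-- The fibre is a matrix algebra, by triviality of the Brauer group of `k`. -/
theorem AzumayaAlg.exists_fiber_algEquiv_end [Subsingleton (BrauerGroup.{u, u} k)]
    (A : AzumayaAlg k G) :
    ∃ m : ℕ, 0 < m ∧ Nonempty (A.sec (triv G k) ≃ₐ[k] Module.End k (Fin m → k)) := by
  obtain ⟨m, hm, hA⟩ := A.azumaya
  have := (hA (triv G k)).nontrivial hm
  have := (hA (triv G k)).free.finite_projective.1
  exact exists_algEquiv_end_of_subsingleton_brauerGroup ((hA (triv G k)).mulLeftRight_bijective hm)

/-- The action of `g` on the fibre, as an algebra automorphism. -/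
def AlgSheaf.fiberAut (A : AlgSheaf k G) (g : G) : A.sec (triv G k) ≃ₐ[k] A.sec (triv G k) where
  toFun := A.res (trivTranslation k k g)
  invFun := A.res (trivTranslation k k g⁻¹)
  left_inv x := by
    rw [← A.res_trivTranslation_mul, inv_mul_cancel, A.res_trivTranslation_one]
  right_inv x := by
    rw [← A.res_trivTranslation_mul, mul_inv_cancel, A.res_trivTranslation_one]
  map_mul' := map_mul _
  map_add' := map_add _
  commutes' c := A.res_algebraMap _ c

/-- Every Azumaya algebra has a class: by the Skolem–Noether theorem `g` acts on the fibre by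
conjugation by some `u`, and `u ^ n` is central since `g ^ n = 1`. -/
theorem AzumayaAlg.exists_hasClass [Subsingleton (BrauerGroup.{u, u} k)]
    (A : AzumayaAlg k G) {n : ℕ} {g : G} (hg : g ^ n = 1) :
    ∃ a : kˣ, A.HasClass n g a := by
  obtain ⟨m, hm, ⟨ψ⟩⟩ := A.exists_fiber_algEquiv_end
  obtain ⟨m', hm', hA⟩ := A.azumaya
  obtain ⟨hcent, hnt⟩ := fiber_isCentral_and_nontrivial hm' (hA (triv G k))
  -- by the Skolem–Noether theorem the automorphism is inner
  obtain ⟨T, hT⟩ := ((ψ.symm.trans (A.fiberAut g)).trans ψ).eq_linearEquivConjAlgEquiv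
  let u : (A.sec (triv G k))ˣ := Units.map (ψ.symm : _ →* A.sec (triv G k))
    ((LinearMap.GeneralLinearGroup.generalLinearEquiv k (Fin m → k)).symm T)
  have hψu : ψ u = T.toLinearMap := ψ.apply_symm_apply _
  have hu : ∀ x, A.res (trivTranslation k k g) x * u = u * x := by
    intro x
    apply ψ.injective
    have h1 := AlgEquiv.congr_fun hT (ψ x)
    simp only [AlgEquiv.trans_apply, AlgEquiv.symm_apply_apply] at h1
    rw [map_mul, map_mul, hψu]
    refine (congrArg (· * T.toLinearMap) h1).trans (LinearMap.ext fun v => ?_)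
    simp [LinearEquiv.conjAlgEquiv_apply]
  have hpow : ∀ (i : ℕ) x, A.res (trivTranslation k k (g ^ i)) x * ↑(u ^ i) = ↑(u ^ i) * x := by
    intro i
    induction i with
    | zero => intro x; simp [A.res_trivTranslation_one]
    | succ i ih =>
      intro x
      rw [pow_succ, A.res_trivTranslation_mul, pow_succ, Units.val_mul, ← mul_assoc, ih, mul_assoc,
        hu, mul_assoc]
  have hz : (↑(u ^ n) : A.sec (triv G k)) ∈ Subalgebra.center k (A.sec (triv G k)) := by
    rw [Subalgebra.mem_center_iff]
    intro x
    rw [← hpow n x, hg, A.res_trivTranslation_one]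
  rw [Algebra.IsCentral.center_eq_bot] at hz
  obtain ⟨c, hc⟩ := hz
  have hc : algebraMap k (A.sec (triv G k)) c = ↑(u ^ n) := hc
  have hc0 : c ≠ 0 := by
    rintro rfl
    rw [map_zero] at hc
    exact (u ^ n).ne_zero hc.symm
  exact ⟨Units.mk0 c hc0, u, by rw [← Units.val_pow_eq_pow_val, ← hc]; rfl, hu⟩

theorem hasClass_one_structureSheaf (n : ℕ) (g : G) :
    (AlgSheaf.structureSheaf k G).HasClass n g 1 :=
  ⟨(1 : k), by rw [one_pow, Units.val_one, map_one], fun x => (mul_comm _ _)⟩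

/-- Brauer equivalent algebras have the same class. -/
theorem BrauerEquiv.exists_eq_mul_pow {A B : AzumayaAlg k G} {n : ℕ} (hn : n ≠ 0) {g : G}
    (hg : g ^ n = 1) {a b : kˣ} (h : BrauerEquiv A.toAlgSheaf B.toAlgSheaf)
    (ha : A.HasClass n g a) (hb : B.HasClass n g b) : ∃ c : kˣ, a = b * c ^ n := by
  obtain ⟨E, F, 𝓔, 𝓕, ⟨m, hm, hE⟩, hF, h𝓔, h𝓕, ⟨i⟩⟩ := h
  have h1 := ha.tensor (hasClass_one_of_isEndSheaf h𝓔 hg)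
  have h2 := (hb.tensor (hasClass_one_of_isEndSheaf h𝓕 hg)).of_iso i.symm
  rw [mul_one] at h1 h2
  obtain ⟨m', hm', hA⟩ := A.azumaya
  have h𝓔m : ∃ m : ℕ, 0 < m ∧ IsEtaleLocallyMatrix k (𝓔.sec (triv G k)) m := by
    obtain ⟨ρ, -⟩ := h𝓔
    obtain ⟨S, _, _, _, _, ⟨e⟩⟩ := hE (triv G k)
    have : Module.Finite k (E.sec (triv G k)) := (hE (triv G k)).finite_projective.1
    have : Nontrivial (E.sec (triv G k)) := by
      have : Nontrivial S := (Module.FaithfullyFlat.faithfulSMul (A := k) (B := S)).algebraMap_injective.nontrivial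
      have : Nonempty (Fin m) := ⟨⟨0, hm⟩⟩
      have : Nontrivial (S ⊗[k] E.sec (triv G k)) := e.toEquiv.nontrivial
      by_contra hA
      rw [not_nontrivial_iff_subsingleton] at hA
      exact not_subsingleton (S ⊗[k] E.sec (triv G k)) inferInstance
    exact ⟨_, Module.finrank_pos, k, inferInstance, inferInstance, inferInstance, inferInstance,
      ⟨((Algebra.TensorProduct.lid k _).trans (ρ (triv G k))).trans
        (algEquivMatrix (Module.finBasis k (E.sec (triv G k))))⟩⟩
  obtain ⟨m'', hm'', h𝓔m⟩ := h𝓔m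
  obtain ⟨_, _⟩ := fiber_isCentral_and_nontrivial (A := A.toAlgSheaf.tensor 𝓔)
    (Nat.mul_pos hm' hm'') ((hA (triv G k)).tensor h𝓔m)
  exact h1.exists_eq_mul_pow hn h2

end Fiber

section DescendedClass

variable {k G : Type u} [Field k] [Group G] [Finite G] {R : Type u} [CommRing R] [Algebra k R]
  {B : Type u} [Ring B] [Algebra k B]

theorem rTensor_trivTranslation_mul (θ : G →* (B ≃ₐ[k] B)) {g : G} (hg : ∀ h, Commute g h) {u : B}
    (hθ : ∀ x, θ g x * u = u * x) {z : (triv G R).carrier ⊗[k] B}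
    (hz : diagonalAction (triv G R).carrier (algRep θ) g⁻¹ z = z) :
    (trivTranslation k R g).toAlgHom.toLinearMap.rTensor B z * (1 ⊗ₜ u) = (1 ⊗ₜ u) * z := by
  suffices h : ∀ z, (trivTranslation k R g).toAlgHom.toLinearMap.rTensor B z * (1 ⊗ₜ u) =
      (1 ⊗ₜ u) * diagonalAction (triv G R).carrier (algRep θ) g⁻¹ z by rw [h, hz]
  clear hz z
  intro z
  induction z with
  | zero => simp
  | add z w hz hw => simp only [map_add, add_mul, mul_add, hz, hw]
  | tmul f b =>
    rw [LinearMap.rTensor_tmul, diagonalAction_tmul, Algebra.TensorProduct.tmul_mul_tmul,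
      Algebra.TensorProduct.tmul_mul_tmul, mul_one, one_mul]
    congr 1
    · funext h
      change (f : G → R) (g⁻¹ * h) = (f : G → R) (h * g⁻¹)
      rw [(hg h).inv_left.eq]
    · change b * u = u * θ g⁻¹ b
      rw [← hθ, ← AlgEquiv.mul_apply, ← map_mul, mul_inv_cancel, map_one, AlgEquiv.one_apply]

/-- If `θ g` is conjugation by `u`, then the algebra descended from `θ` has class `u ^ n` with
respect to `g`. Invariance of `u` under `θ` makes `1 ⊗ u` descend to an element of the fibre. -/
theorem hasClass_descendAlg [NeZero (Nat.card G : k)] (θ : G →* (B ≃ₐ[k] B)) {n : ℕ} {a : kˣ}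
    {g : G} {u : B} (hu : u ^ n = algebraMap k B a) (hθ : ∀ x, θ g x * u = u * x)
    (hinv : ∀ h, θ h u = u) (hg : ∀ h, Commute g h) : (descendAlg θ).HasClass n g a := by
  refine ⟨⟨1 ⊗ₜ u, fun h => ?_⟩, Subtype.ext ?_, fun x => Subtype.ext ?_⟩
  · rw [diagonalAction_tmul, smul_one]
    exact congrArg _ (hinv h)
  · change (1 ⊗ₜ[k] u : (triv G k).carrier ⊗[k] B) ^ n =
      algebraMap k (triv G k).carrier a ⊗ₜ 1
    rw [Algebra.TensorProduct.tmul_pow, one_pow, hu, Algebra.algebraMap_eq_smul_one,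
      TensorProduct.tmul_smul, TensorProduct.smul_tmul', ← Algebra.algebraMap_eq_smul_one]
  · exact rTensor_trivTranslation_mul θ hg hθ (x.2 g⁻¹)

end DescendedClass

section ClassHom

variable {k G : Type u} [Field k] [Group G] [Finite G] [Subsingleton (BrauerGroup.{u, u} k)]

theorem exists_pow_eq_of_forall_mem_zpowers {g : G} (hgen : ∀ x, x ∈ Subgroup.zpowers g) (h : G) :
    ∃ i : ℕ, g ^ i = h :=
  (mem_powers_iff_mem_zpowers.mpr (hgen h))

/-- An Azumaya algebra of class `1` is trivial in the Brauer group. -/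
theorem AzumayaAlg.cls_eq_one [NeZero (Nat.card G : k)] (A : AzumayaAlg k G) {n : ℕ} {g : G}
    (hgen : ∀ x, x ∈ Subgroup.zpowers g) (hord : orderOf g = n) (h : A.HasClass n g 1) :
    A.cls = 1 := by
  obtain ⟨m, hm, ⟨ψ⟩⟩ := A.exists_fiber_algEquiv_end
  obtain ⟨u, hu, hux⟩ := h
  have hn : n ≠ 0 := by rw [← hord]; exact (orderOf_pos g).ne'
  obtain ⟨u, rfl⟩ := isUnit_of_pow_eq_algebraMap hn hu
  have hu1 : u ^ n = 1 := Units.ext (by simpa using hu)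
  -- as `u ^ n = 1`, the action of `G` on the fibre lifts to a representation on `k ^ m`
  let θ : G →* (A.sec (triv G k))ˣ := monoidHomOfForallMemZpowers hgen (g' := u)
    (by rw [hord]; exact orderOf_dvd_of_pow_eq_one hu1)
  have hθ : θ g = u := monoidHomOfForallMemZpowers_apply_gen hgen _
  let ρ : Representation k G (Fin m → k) :=
    (ψ : A.sec (triv G k) →* Module.End k (Fin m → k)).comp ((Units.coeHom _).comp θ)
  let _ : Module (A.sec (triv G k)) (Fin m → k) :=
    Module.compHom _ (ψ : A.sec (triv G k) →+* Module.End k (Fin m → k))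
  have hsmul : ∀ (x : A.sec (triv G k)) (v : Fin m → k), x • v = ψ x v := fun _ _ => rfl
  have : IsScalarTower k (A.sec (triv G k)) (Fin m → k) := ⟨fun c x v => by
    rw [hsmul, hsmul, map_smul]; rfl⟩
  have hconj : ∀ h x, A.res (trivTranslation k k h) x * θ h = θ h * x := by
    intro h
    obtain ⟨i, rfl⟩ := exists_pow_eq_of_forall_mem_zpowers hgen h
    rw [map_pow, hθ]
    induction i with
    | zero => intro x; simp [A.res_trivTranslation_one]
    | succ i ih =>
      intro x
      rw [pow_succ, A.res_trivTranslation_mul, pow_succ, Units.val_mul, ← mul_assoc, ih, mul_assoc,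
        hux, mul_assoc]
  have hρ : ∀ h (c : A.sec (triv G k)) (v : Fin m → k),
      ρ h (c • v) = (A.toQCohSheaf.rep h c : A.sec (triv G k)) • ρ h v := by
    intro h c v
    have := hconj h c
    change ψ (θ h) (ψ c v) = ψ (A.res (trivTranslation k k h) c) (ψ (θ h) v)
    rw [← Module.End.mul_apply, ← Module.End.mul_apply, ← map_mul, ← map_mul, this]
  have : Nonempty (Fin m) := ⟨⟨0, hm⟩⟩
  exact Quotient.sound (BrauerEquiv.of_isEndSheaf (isVectorBundle_descend ρ)
    (isEndSheaf_descend hρ ψ.bijective))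

variable (k) in
/-- The class of an element of the Brauer group in `kˣ` modulo `n`-th powers. -/
noncomputable def classFun {n : ℕ} (hn : n ≠ 0) {g : G} (hg : g ^ n = 1) :
    Br k G → kˣ ⧸ (powMonoidHom n : kˣ →* kˣ).range :=
  Quotient.lift (fun A => QuotientGroup.mk (A.exists_hasClass hg).choose) fun A B h => by
    obtain ⟨c, hc⟩ := BrauerEquiv.exists_eq_mul_pow hn hg h (A.exists_hasClass hg).choose_spec
      (B.exists_hasClass hg).choose_spec
    exact (QuotientGroup.eq.mpr (MonoidHom.mem_range.mpr ⟨c, by rw [hc]; simp⟩)).symm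

theorem classFun_cls {n : ℕ} (hn : n ≠ 0) {g : G} (hg : g ^ n = 1) {A : AzumayaAlg k G} {a : kˣ}
    (h : A.HasClass n g a) : classFun k hn hg A.cls = QuotientGroup.mk a := by
  obtain ⟨c, hc⟩ := BrauerEquiv.exists_eq_mul_pow hn hg (BrauerEquiv.of_iso (AlgSheaf.Iso.refl _)) h
      (A.exists_hasClass hg).choose_spec
  exact QuotientGroup.eq.mpr (MonoidHom.mem_range.mpr ⟨c, by rw [hc]; simp⟩)

variable (k) in
/-- The class homomorphism from the Brauer group. -/
noncomputable def classHom {n : ℕ} (hn : n ≠ 0) {g : G} (hg : g ^ n = 1) :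
    Br k G →* kˣ ⧸ (powMonoidHom n : kˣ →* kˣ).range where
  toFun := classFun k hn hg
  map_one' := classFun_cls hn hg (hasClass_one_structureSheaf n g)
  map_mul' := by
    rintro ⟨A⟩ ⟨B⟩
    obtain ⟨a, ha⟩ := A.exists_hasClass hg
    obtain ⟨b, hb⟩ := B.exists_hasClass hg
    refine (classFun_cls (A := A.tensor B) hn hg (ha.tensor hb)).trans ?_
    exact (congrArg₂ (· * ·) (classFun_cls hn hg ha) (classFun_cls hn hg hb)).symm

theorem classHom_cls {n : ℕ} (hn : n ≠ 0) {g : G} (hg : g ^ n = 1) {A : AzumayaAlg k G} {a : kˣ}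
    (h : A.HasClass n g a) : classHom k hn hg A.cls = QuotientGroup.mk a :=
  classFun_cls hn hg h

/-- The class determines the element of the Brauer group; if it is an `n`-th power, it can be
rescaled to `1`. -/
theorem classHom_injective [NeZero (Nat.card G : k)] {n : ℕ} (hn : n ≠ 0) {g : G} (hg : g ^ n = 1)
    (hgen : ∀ x, x ∈ Subgroup.zpowers g) (hord : orderOf g = n) :
    Function.Injective (classHom k hn hg) := by
  rw [injective_iff_map_eq_one]
  rintro ⟨A⟩ hA
  obtain ⟨a, ha⟩ := A.exists_hasClass hg
  change classHom k hn hg A.cls = 1 at hA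
  rw [classHom_cls hn hg ha, QuotientGroup.eq_one_iff] at hA
  obtain ⟨c, rfl⟩ := hA
  refine A.cls_eq_one hgen hord ?_
  have := ha.mul_pow c⁻¹
  simpa using this

omit [Subsingleton (BrauerGroup.{u, u} k)] in
/-- Every unit is the class of an Azumaya algebra: the endomorphisms of `k[X] / (X ^ n - a)`, with
`g` acting by conjugation by multiplication by `X`. -/
theorem exists_azumayaAlg_hasClass [NeZero (Nat.card G : k)] {n : ℕ} (hn : n ≠ 0) {g : G}
    (hgen : ∀ x, x ∈ Subgroup.zpowers g) (hord : orderOf g = n) (a : kˣ) :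
    ∃ A : AzumayaAlg k G, A.HasClass n g a := by
  -- `K` need not be a field; only its dimension and the root of `a` matter
  let p : Polynomial k := Polynomial.X ^ n - Polynomial.C (a : k)
  have hp : p.Monic := Polynomial.monic_X_pow_sub_C _ hn
  have hdeg : p.degree ≠ 0 := by
    rw [Polynomial.degree_X_pow_sub_C (Nat.pos_of_ne_zero hn)]
    exact_mod_cast hn
  let K := AdjoinRoot p
  have : Nontrivial K := AdjoinRoot.nontrivial p hdeg
  have : Module.Finite k K := hp.finite_adjoinRoot
  let B := Module.End k K
  have hroot : AdjoinRoot.root p ^ n = algebraMap k K a := by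
    have := AdjoinRoot.eval₂_root p
    rw [Polynomial.eval₂_sub, Polynomial.eval₂_pow, Polynomial.eval₂_X, Polynomial.eval₂_C,
      sub_eq_zero] at this
    exact this
  have hu : Algebra.lmul k K (AdjoinRoot.root p) ^ n = algebraMap k B a := by
    rw [← map_pow, hroot, AlgHom.commutes]
  obtain ⟨u, hu'⟩ := isUnit_of_pow_eq_algebraMap hn hu
  rw [← hu'] at hu
  let θ : G →* (B ≃ₐ[k] B) := monoidHomOfForallMemZpowers hgen
    (g' := MulSemiringAction.toAlgAut (ConjAct Bˣ) k B (ConjAct.toConjAct u)) (by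
      rw [hord]
      refine orderOf_dvd_of_pow_eq_one (AlgEquiv.ext fun x => ?_)
      rw [← map_pow, ← map_pow]
      change (u ^ n : Bˣ).val * x * ((u ^ n)⁻¹ : Bˣ).val = x
      rw [Units.val_pow_eq_pow_val, hu, Algebra.commutes, ← hu, ← Units.val_pow_eq_pow_val,
        Units.mul_inv_cancel_right])
  have hθ : ∀ x, θ g x * u = u * x := fun x => by
    rw [monoidHomOfForallMemZpowers_apply_gen hgen]
    change (u : B) * x * (u⁻¹ : Bˣ) * u = u * x
    rw [Units.inv_mul_cancel_right]
  let A : AzumayaAlg k G :=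
    { toAlgSheaf := descendAlg θ
      azumaya := ⟨_, Module.finrank_pos (R := k) (M := K), fun P =>
        isEtaleLocallyMatrix_descendAlg θ _ (algEquivMatrix (Module.finBasis k K)) P⟩ }
  refine ⟨A, ?_⟩
  have huinv : θ g u = u := by
    have := hθ u
    exact u.isUnit.mul_left_injective this
  have hinv : ∀ h, θ h u = u := fun h => by
    obtain ⟨i, rfl⟩ := exists_pow_eq_of_forall_mem_zpowers hgen h
    rw [map_pow]
    induction i with
    | zero => simp
    | succ i ih => rw [pow_succ, AlgEquiv.mul_apply, huinv, ih]
  have hcomm : ∀ h, Commute g h := fun h => by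
    obtain ⟨i, rfl⟩ := exists_pow_eq_of_forall_mem_zpowers hgen h
    exact Commute.self_pow g i
  exact hasClass_descendAlg θ hu hθ hinv hcomm

end ClassHom

end BG

namespace BG

/-! ### Modules over matrix algebras -/

section Corner

variable {k H ι : Type*} [Field k] [Ring H] [Algebra k H] [Fintype ι] [DecidableEq ι]
  (ε : Matrix ι ι k ≃ₐ[k] H) (o : ι) {M N : Type*} [AddCommGroup M] [Module k M] [Module H M]
  [IsScalarTower k H M] [AddCommGroup N] [Module k N] [Module H N] [IsScalarTower k H N]

/-- The matrix units of an algebra isomorphic to a matrix algebra. -/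
def matUnit (i j : ι) : H := ε (Matrix.single i j 1)

theorem matUnit_mul_matUnit (i j l : ι) : matUnit ε i j * matUnit ε j l = matUnit ε i l := by
  rw [matUnit, matUnit, ← map_mul, Matrix.single_mul_single_same, mul_one, matUnit]

theorem matUnit_mul_of_ne {j j' : ι} (h : j ≠ j') (i l : ι) :
    matUnit ε i j * matUnit ε j' l = 0 := by
  rw [matUnit, matUnit, ← map_mul, Matrix.single_mul_single_of_ne _ _ _ _ h, map_zero]

theorem sum_matUnit : ∑ i, matUnit ε i i = 1 := by
  simp only [matUnit, ← map_sum]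
  rw [← map_one ε]
  congr 1
  ext i j
  simp [Matrix.sum_apply, Matrix.single_apply, Matrix.one_apply, ite_and]

theorem matUnit_mul (i j : ι) (b : H) :
    matUnit ε i j * b = ∑ l, ε.symm b j l • matUnit ε i l := by
  apply ε.symm.injective
  simp only [matUnit, map_mul, map_sum, map_smul, AlgEquiv.symm_apply_apply]
  ext p q
  simp [Matrix.sum_apply, Matrix.single_apply, Matrix.mul_apply, ite_and]

theorem mul_matUnit (i j : ι) (b : H) :
    b * matUnit ε i j = ∑ l, ε.symm b l i • matUnit ε l j := by
  apply ε.symm.injective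
  simp only [matUnit, map_mul, map_sum, map_smul, AlgEquiv.symm_apply_apply]
  ext p q
  simp [Matrix.sum_apply, Matrix.single_apply, Matrix.mul_apply, ite_and]

variable (M) in
/-- The subspace of a module over a matrix algebra cut out by a diagonal matrix unit.  It
determines the module. -/
def corner : Submodule k M where
  carrier := {x | matUnit ε o o • x = x}
  add_mem' {x y} hx hy := by
    change _ • (x + y) = x + y
    rw [smul_add, hx, hy]
  zero_mem' := smul_zero _
  smul_mem' c x hx := by
    change _ • (c • x) = c • x
    rw [smul_algebra_smul_comm, hx]

variable {ε o}

theorem mem_corner {x : M} : x ∈ corner ε o M ↔ matUnit ε o o • x = x := Iff.rfl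

variable (ε o) in
theorem matUnit_smul_mem_corner (i : ι) (x : M) : matUnit ε o i • x ∈ corner ε o M := by
  rw [mem_corner, smul_smul, matUnit_mul_matUnit]

theorem map_mem_corner (f : M →ₗ[H] N) {x : M} (hx : x ∈ corner ε o M) : f x ∈ corner ε o N := by
  rw [mem_corner] at hx ⊢
  rw [← map_smul, hx]

variable (ε o) in
omit [Module k M] [IsScalarTower k H M] in
/-- The module is the sum of the translates of its corner. -/
theorem sum_matUnit_smul (x : M) : ∑ i, matUnit ε i o • matUnit ε o i • x = x := by
  simp only [smul_smul, matUnit_mul_matUnit]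
  rw [← Finset.sum_smul, sum_matUnit, one_smul]

variable (ε o) in
omit [Module k N] [IsScalarTower k H N] in
/-- A linear map of modules over a matrix algebra is determined by its restriction to the corner. -/
theorem linearMap_ext_corner {f f' : M →ₗ[H] N} (h : ∀ x ∈ corner ε o M, f x = f' x) : f = f' := by
  ext x
  rw [← sum_matUnit_smul ε o x, map_sum, map_sum]
  refine Finset.sum_congr rfl fun i _ => ?_
  rw [f.map_smul (matUnit ε i o), f'.map_smul (matUnit ε i o), h _ (matUnit_smul_mem_corner ε o i x)]

/-- A linear map of corners extends to a homomorphism of modules over the matrix algebra. -/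
def cornerExtend (χ : corner ε o M →ₗ[k] corner ε o N) : M →ₗ[H] N where
  toFun x := ∑ i, matUnit ε i o • (χ ⟨matUnit ε o i • x, matUnit_smul_mem_corner ε o i x⟩ : N)
  map_add' x y := by
    rw [← Finset.sum_add_distrib]
    refine Finset.sum_congr rfl fun i _ => ?_
    rw [← smul_add, ← Submodule.coe_add, ← map_add]
    congr 3
    exact Subtype.ext (smul_add _ _ _)
  map_smul' b x := by
    have h1 : ∀ i, χ ⟨matUnit ε o i • b • x, matUnit_smul_mem_corner ε o i (b • x)⟩ =
        ∑ l, ε.symm b i l • χ ⟨matUnit ε o l • x, matUnit_smul_mem_corner ε o l x⟩ := by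
      intro i
      simp only [← map_smul, ← map_sum]
      congr 1
      apply Subtype.ext
      simp only [Submodule.coe_sum, Submodule.coe_smul]
      rw [smul_smul, matUnit_mul, Finset.sum_smul]
      exact Finset.sum_congr rfl fun l _ => smul_assoc _ _ _
    refine (Finset.sum_congr rfl fun i _ => congrArg (fun y => matUnit ε i o • (y : N))
      (congrArg Subtype.val (h1 i))).trans ?_
    simp only [Submodule.coe_sum, Submodule.coe_smul, Finset.smul_sum, RingHom.id_apply,
      smul_smul, mul_matUnit, Finset.sum_smul]
    rw [Finset.sum_comm]
    refine Finset.sum_congr rfl fun i _ => Finset.sum_congr rfl fun l _ => ?_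
    rw [smul_assoc, smul_algebra_smul_comm]

theorem cornerExtend_apply (χ : corner ε o M →ₗ[k] corner ε o N) (x : corner ε o M) :
    cornerExtend χ x = χ x := by
  change ∑ i, matUnit ε i o • (χ ⟨matUnit ε o i • (x : M), _⟩ : N) = χ x
  rw [Finset.sum_eq_single o]
  · rw [show (⟨matUnit ε o o • (x : M), matUnit_smul_mem_corner ε o o (x : M)⟩ : corner ε o M) = x
      from Subtype.ext x.2]
    exact (χ x).2
  · intro i _ hi
    have : (⟨matUnit ε o i • (x : M), matUnit_smul_mem_corner ε o i (x : M)⟩ : corner ε o M) = 0 :=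
      Subtype.ext (by
        change matUnit ε o i • (x : M) = 0
        rw [← mem_corner.mp x.2, smul_smul, matUnit_mul_of_ne ε hi, zero_smul])
    rw [this, map_zero, Submodule.coe_zero, smul_zero]
  · simp

/-- The module over the matrix algebra whose corner is `W`. -/
abbrev columnModule (ε : Matrix ι ι k ≃ₐ[k] H) (W : Type*) [AddCommGroup W] [Module k W] :
    Module H (ι → W) :=
  letI := Matrix.Module.matrixModule (ι := ι) (R := k) (M := W)
  Module.compHom (ι → W) (ε.symm : H →+* Matrix ι ι k)

theorem columnModule_smul_apply {W : Type*} [AddCommGroup W] [Module k W] (b : H) (f : ι → W)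
    (i : ι) : letI := columnModule ε W
    (b • f) i = ∑ j, ε.symm b i j • f j := rfl

theorem columnModule_isScalarTower (W : Type*) [AddCommGroup W] [Module k W] :
    letI := columnModule ε W
    IsScalarTower k H (ι → W) := by
  let _ := columnModule ε W
  refine ⟨fun c b f => funext fun i => ?_⟩
  rw [columnModule_smul_apply, Pi.smul_apply, columnModule_smul_apply, Finset.smul_sum]
  simp [mul_smul]

/-- The corner of a module of columns consists of the columns concentrated in the chosen place, so
it recovers `W`. -/
theorem mem_corner_columnModule {W : Type*} [AddCommGroup W] [Module k W] (f : ι → W) :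
    letI := columnModule ε W
    matUnit ε o o • f = f ↔ f = Pi.single o (f o) := by
  let _ := columnModule ε W
  have : matUnit ε o o • f = Pi.single o (f o) := by
    funext i
    rw [columnModule_smul_apply]
    simp [matUnit, Matrix.single_apply, Pi.single_apply, ite_and, eq_comm]
  rw [this, eq_comm]

end Corner

/-! ### Vector spaces with an `n`-th root of a scalar -/

section RootMod

open CategoryTheory

/-- A finite-dimensional vector space with an endomorphism whose `n`-th power is `a`. -/
structure RootMod (k : Type u) [Field k] (n : ℕ) (a : kˣ) where
  /-- the underlying vector space -/
  carrier : Type u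
  [addCommGroup : AddCommGroup carrier]
  [module : Module k carrier]
  [finite : Module.Finite k carrier]
  /-- the endomorphism -/
  root : Module.End k carrier
  root_pow : root ^ n = algebraMap k _ a

attribute [instance] RootMod.addCommGroup RootMod.module RootMod.finite

variable {k : Type u} [Field k] {n : ℕ} {a : kˣ}

/-- The linear maps commuting with the given endomorphisms. -/
def RootMod.homs (V W : RootMod k n a) : Submodule k (V.carrier →ₗ[k] W.carrier) where
  carrier := {f | ∀ v, f (V.root v) = W.root (f v)}
  add_mem' {f g} hf hg v := by rw [LinearMap.add_apply, LinearMap.add_apply, map_add, hf, hg]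
  zero_mem' v := by rw [LinearMap.zero_apply, LinearMap.zero_apply, map_zero]
  smul_mem' c f hf v := by rw [LinearMap.smul_apply, LinearMap.smul_apply, map_smul, hf]

instance : Category (RootMod k n a) where
  Hom V W := RootMod.homs V W
  id V := ⟨LinearMap.id, fun _ => rfl⟩
  comp f g := ⟨g.1 ∘ₗ f.1, fun v => (congrArg g.1 (f.2 v)).trans (g.2 (f.1 v))⟩

instance (V W : RootMod k n a) : AddCommGroup (V ⟶ W) :=
  inferInstanceAs (AddCommGroup (RootMod.homs V W))

instance (V W : RootMod k n a) : Module k (V ⟶ W) :=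
  inferInstanceAs (Module k (RootMod.homs V W))

instance : Preadditive (RootMod k n a) where
  add_comp _ _ _ _ _ h := Subtype.ext (LinearMap.ext fun _ => map_add h.1 _ _)
  comp_add _ _ _ _ _ _ := rfl

instance : Linear k (RootMod k n a) where
  smul_comp _ _ _ c _ h := Subtype.ext (LinearMap.ext fun _ => map_smul h.1 c _)
  comp_smul _ _ _ _ _ _ := rfl

/-- An isomorphism of vector spaces commuting with the given endomorphisms. -/
def RootMod.isoOfLinearEquiv {V W : RootMod k n a} (e : V.carrier ≃ₗ[k] W.carrier)
    (h : ∀ v, e (V.root v) = W.root (e v)) : V ≅ W where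
  hom := ⟨e.toLinearMap, h⟩
  inv := ⟨e.symm.toLinearMap, fun w => e.injective (by
    change e (e.symm _) = e (V.root (e.symm w))
    rw [h, e.apply_symm_apply, e.apply_symm_apply])⟩
  hom_inv_id := Subtype.ext (LinearMap.ext e.symm_apply_apply)
  inv_hom_id := Subtype.ext (LinearMap.ext e.apply_symm_apply)

theorem RootMod.coe_end_pow {V : RootMod k n a} (y : End V) (i : ℕ) :
    (↑(y ^ i : End V) : RootMod.homs V V).1 = (y : RootMod.homs V V).1 ^ i := by
  induction i with
  | zero => rfl
  | succ i ih =>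
    rw [pow_succ, pow_succ, ← ih]
    rfl

/-- The given endomorphism is itself an endomorphism of the object. -/
theorem RootMod.exists_end_pow_eq (V : RootMod k n a) :
    ∃ y : End V, y ^ n = (a : k) • 𝟙 V := by
  refine ⟨(⟨V.root, fun _ => rfl⟩ : RootMod.homs V V), ?_⟩
  exact Subtype.ext ((RootMod.coe_end_pow _ n).trans V.root_pow)

/-- Fully faithful linear functors reflect roots of scalars. -/
theorem exists_end_pow_eq_of_functor {C D : Type*} [Category C] [Category D] [Preadditive C]
    [Preadditive D] [Linear k C] [Linear k D] (F : C ⥤ D) [F.Full] [F.Faithful] [F.Additive]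
    [F.Linear k] {c : k} (h : ∀ Y : D, ∃ y : End Y, y ^ n = c • 𝟙 Y) (X : C) :
    ∃ x : End X, x ^ n = c • 𝟙 X := by
  obtain ⟨y, hy⟩ := h (F.obj X)
  refine ⟨F.preimage y, F.map_injective ?_⟩
  rw [F.map_smul, F.map_id, ← hy]
  refine (map_pow (F.mapEnd X) _ n).trans (congrArg (· ^ n) ?_)
  exact F.map_preimage y

end RootMod

end BG

namespace BG

open CategoryTheory

/-! ### Coherent modules and their fibres -/

section CohFiber

variable {k G : Type u} [Field k] [Group G] [Finite G] {A : AlgSheaf k G} {R : Type u} [CommRing R]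
  [Algebra k R]

omit [Finite G] in
theorem CohMod.res_smul_op (M : CohMod A) {R R' : Type u} [CommRing R] [Algebra k R] [CommRing R']
    [Algebra k R'] {f : R →ₐ[k] R'} {P : Torsor G R} {P' : Torsor G R'} (h : TorsorHom f P P')
    (c : (A.sec P)ᵐᵒᵖ) (x : M.sec P) : M.res h (c • x) = A.op.res h c • M.res h x :=
  M.res_act h c.unop x

theorem CohMod.trivEquiv_smul (M : CohMod A) (b : R ⊗[k] (A.sec (triv G k))ᵐᵒᵖ)
    (y : R ⊗[k] M.toQCohSheaf.fiber) :
    M.toQCohSheaf.trivEquiv R (baseChangeAction k R _ _ b y) =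
      (A.op.toQCohSheaf.trivEquiv R b : (A.sec (triv G R))ᵐᵒᵖ) • M.toQCohSheaf.trivEquiv R y := by
  induction y with
  | zero => simp only [map_zero, smul_zero]
  | add z w hz hw => simp only [map_add, hz, hw, smul_add]
  | tmul t x =>
    induction b with
    | zero => rw [map_zero, LinearMap.zero_apply, map_zero, map_zero, zero_smul]
    | add z w hz hw => rw [map_add, LinearMap.add_apply, map_add, map_add, hz, hw, add_smul]
    | tmul s c =>
      rw [baseChangeAction_tmul, QCohSheaf.trivEquiv_tmul, QCohSheaf.trivEquiv_tmul,
        QCohSheaf.trivEquiv_tmul, M.res_smul_op]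
      change (s * t) • A.op.res _ c • _ = (s • A.op.res _ c) • t • _
      rw [smul_assoc, mul_smul]
      congr 1
      exact (smul_algebra_smul_comm _ _ _).symm

/-- The comparison map is linear for the action of `A`, which on the base change of the fibre is the
base change of the action on the fibre. -/
theorem CohMod.comparison_smul (M : CohMod A) (P : Torsor G R) (c : (A.sec P)ᵐᵒᵖ) (x : M.sec P) :
    M.toQCohSheaf.comparison P (c • x) =
      baseChangeAction k P.carrier (A.sec (triv G k))ᵐᵒᵖ _ (A.op.comparison P c)
        (M.toQCohSheaf.comparison P x) := by
  apply (M.toQCohSheaf.trivEquiv P.carrier).injective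
  rw [M.trivEquiv_smul, QCohSheaf.trivEquiv_comparison, QCohSheaf.trivEquiv_comparison,
    M.res_smul_op]
  exact congrArg (· • _) (A.op.toQCohSheaf.trivEquiv_comparison P c).symm

/-- The map of fibres given by a homomorphism of modules. -/
def CohMod.fiberMap {M N : CohMod A} (φ : M ⟶ N) : M.sec (triv G k) →ₗ[(A.sec (triv G k))ᵐᵒᵖ]
    N.sec (triv G k) := CohMod.Hom.app φ (triv G k)

theorem CohMod.fiberMap_rep {M N : CohMod A} (φ : M ⟶ N) (g : G) (x : M.sec (triv G k)) :
    fiberMap φ (M.toQCohSheaf.rep g x) = N.toQCohSheaf.rep g (fiberMap φ x) :=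
  CohMod.Hom.naturality φ (trivTranslation k k g) x

omit [Finite G] in
theorem CohMod.app_smul {M N : CohMod A} (φ : M ⟶ N) (P : Torsor G R) (r : R) (x : M.sec P) :
    CohMod.Hom.app φ P (r • x) = r • CohMod.Hom.app φ P x := by
  rw [← algebraMap_smul (A.sec P)ᵐᵒᵖ, map_smul, algebraMap_smul]

theorem CohMod.trivEquiv_fiberMap {M N : CohMod A} (φ : M ⟶ N)
    (y : R ⊗[k] M.toQCohSheaf.fiber) : CohMod.Hom.app φ (triv G R) (M.toQCohSheaf.trivEquiv R y) =
      N.toQCohSheaf.trivEquiv R (((fiberMap φ).restrictScalars k).lTensor R y) := by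
  induction y with
  | zero => simp only [map_zero]
  | add z w hz hw => simp only [map_add, hz, hw]
  | tmul t x =>
    rw [LinearMap.lTensor_tmul, QCohSheaf.trivEquiv_tmul, QCohSheaf.trivEquiv_tmul,
      app_smul, CohMod.Hom.naturality]
    rfl

theorem CohMod.comparison_app {M N : CohMod A} (φ : M ⟶ N) (P : Torsor G R) (x : M.sec P) :
    N.toQCohSheaf.comparison P (CohMod.Hom.app φ P x) =
      ((fiberMap φ).restrictScalars k).lTensor P.carrier (M.toQCohSheaf.comparison P x) := by
  apply (N.toQCohSheaf.trivEquiv P.carrier).injective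
  rw [← trivEquiv_fiberMap, QCohSheaf.trivEquiv_comparison, QCohSheaf.trivEquiv_comparison,
    CohMod.Hom.naturality]

/-- A morphism of coherent modules is determined by its value on the fibre. -/
theorem CohMod.hom_ext_fiber {M N : CohMod A} {φ φ' : M ⟶ N} (h : fiberMap φ = fiberMap φ') :
    φ = φ' :=
  CohMod.hom_ext fun P x => N.toQCohSheaf.comparison_injective P (by
    rw [comparison_app, comparison_app, h])

/-- A homomorphism of fibres which is compatible with the actions of `A` and of `G` comes from a
homomorphism of modules. -/
noncomputable def CohMod.homOfFiber [NeZero (Nat.card G : k)] {M N : CohMod A}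
    (ψ : M.sec (triv G k) →ₗ[(A.sec (triv G k))ᵐᵒᵖ] N.sec (triv G k))
    (hψ : ∀ g x, ψ.restrictScalars k (M.toQCohSheaf.rep g x) =
      N.toQCohSheaf.rep g (ψ.restrictScalars k x)) : M ⟶ N where
  app P :=
    { toFun := QCohSheaf.extension (ψ.restrictScalars k) hψ P
      map_add' := fun x y => N.toQCohSheaf.comparison_injective P (by
        rw [map_add, QCohSheaf.comparison_extension, QCohSheaf.comparison_extension,
          QCohSheaf.comparison_extension, map_add, map_add])
      map_smul' := fun c x => N.toQCohSheaf.comparison_injective P (by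
        rw [RingHom.id_apply, comparison_smul, QCohSheaf.comparison_extension,
          QCohSheaf.comparison_extension, comparison_smul]
        generalize A.op.comparison P c = b
        generalize M.toQCohSheaf.comparison P x = y
        induction y with
        | zero => simp only [map_zero]
        | add z w hz hw => simp only [map_add, hz, hw]
        | tmul t x =>
          induction b with
          | zero => simp only [map_zero, LinearMap.zero_apply]
          | add z w hz hw => simp only [map_add, LinearMap.add_apply, hz, hw]
          | tmul s c =>
            rw [baseChangeAction_tmul, LinearMap.lTensor_tmul, LinearMap.lTensor_tmul,
              baseChangeAction_tmul]
            exact congrArg _ (map_smul ψ c x)) }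
  naturality {R R' _ _ _ _ f P P'} h x := N.toQCohSheaf.comparison_injective P' (by
    change N.toQCohSheaf.comparison P' (QCohSheaf.extension _ hψ P' (M.res h x)) =
      N.toQCohSheaf.comparison P' (N.res h (QCohSheaf.extension _ hψ P x))
    rw [QCohSheaf.comparison_res, QCohSheaf.comparison_extension, QCohSheaf.comparison_extension,
      QCohSheaf.comparison_res, ← LinearMap.comp_apply, ← LinearMap.comp_apply,
      LinearMap.lTensor_comp_rTensor, LinearMap.rTensor_comp_lTensor])

theorem CohMod.fiberMap_homOfFiber [NeZero (Nat.card G : k)] {M N : CohMod A}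
    (ψ : M.sec (triv G k) →ₗ[(A.sec (triv G k))ᵐᵒᵖ] N.sec (triv G k))
    (hψ : ∀ g x, ψ.restrictScalars k (M.toQCohSheaf.rep g x) =
      N.toQCohSheaf.rep g (ψ.restrictScalars k x)) :
    fiberMap (homOfFiber ψ hψ) = ψ :=
  LinearMap.ext fun x => QCohSheaf.extension_fiber (ψ.restrictScalars k) hψ x

/-- The coherent module descended from a finite-dimensional module over the fibre of `A` with a
compatible action of `G`. -/
noncomputable def cohModOfRep [NeZero (Nat.card G : k)] {V : Type u} [AddCommGroup V] [Module k V]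
    [Module.Finite k V] [Module (A.op.sec (triv G k)) V] [IsScalarTower k (A.op.sec (triv G k)) V]
    {ρ : Representation k G V} (hρ : ∀ g (c : A.op.sec (triv G k)) v,
      ρ g (c • v) = (A.op.toQCohSheaf.rep g c : A.op.sec (triv G k)) • ρ g v) : CohMod A where
  toQCohSheaf := descend ρ
  act {R} _ _ P := Module.compHom (descendedSections ρ P)
    (descendAction hρ P : A.op.sec P →+* Module.End R (descendedSections ρ P))
  tower {R} _ _ P := by
    let _ : Module (A.op.sec P) (descendedSections ρ P) := Module.compHom (descendedSections ρ P)
      (descendAction hρ P : A.op.sec P →+* Module.End R (descendedSections ρ P))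
    refine ⟨fun r c x => ?_⟩
    change descendAction hρ P (r • c) x = r • descendAction hρ P c x
    rw [map_smul, LinearMap.smul_apply]
  res_act h c x := descendedRes_descendAction hρ h (op c) x
  finite P := finite_descendedSections ρ P

end CohFiber

/-! ### Coherent modules as vector spaces with an `n`-th root of a scalar -/

section CornerFunctor

variable {k G : Type u} [Field k] [Group G] [Finite G] {A : AlgSheaf k G} {g : G}
  {u : (A.sec (triv G k))ᵐᵒᵖ}

/-- If `g` acts on the fibre of `A` by conjugation by `u`, then the action of `g` on the fibre
of an `A`-module becomes `A`-linear after multiplication by `u`. -/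
def CohMod.twist (hu : ∀ c, u * A.op.res (trivTranslation k k g) c = c * u) (M : CohMod A) :
    M.sec (triv G k) →ₗ[(A.sec (triv G k))ᵐᵒᵖ] M.sec (triv G k) where
  toFun x := u • M.toQCohSheaf.rep g x
  map_add' x y := by rw [map_add, smul_add]
  map_smul' c x := by
    rw [QCohSheaf.rep_apply, M.res_smul_op, smul_smul, hu, mul_smul]
    rfl

theorem CohMod.twist_apply (hu : ∀ c, u * A.op.res (trivTranslation k k g) c = c * u)
    (M : CohMod A) (x : M.sec (triv G k)) : M.twist hu x = u • M.toQCohSheaf.rep g x := rfl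

theorem CohMod.twist_iterate (hu : ∀ c, u * A.op.res (trivTranslation k k g) c = c * u)
    (M : CohMod A) (i : ℕ) (x : M.sec (triv G k)) :
    (M.twist hu)^[i] x = u ^ i • M.toQCohSheaf.rep (g ^ i) x := by
  induction i with
  | zero => rw [pow_zero, pow_zero, map_one, one_smul]; rfl
  | succ i ih =>
    rw [Function.iterate_succ_apply', ih, twist_apply, QCohSheaf.rep_apply, M.res_smul_op,
      smul_smul, hu, pow_succ, pow_succ' g, map_mul]
    rfl

theorem CohMod.fiberMap_twist (hu : ∀ c, u * A.op.res (trivTranslation k k g) c = c * u)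
    {M N : CohMod A} (φ : M ⟶ N) (x : M.sec (triv G k)) :
    fiberMap φ (M.twist hu x) = N.twist hu (fiberMap φ x) := by
  rw [twist_apply, twist_apply, map_smul, fiberMap_rep]

variable {n : ℕ} {a : kˣ} {ι : Type} [Fintype ι] [DecidableEq ι]
  (ε : Matrix ι ι k ≃ₐ[k] (A.sec (triv G k))ᵐᵒᵖ) (o : ι)
  (hu : ∀ c, u * A.op.res (trivTranslation k k g) c = c * u)
  (hun : u ^ n = algebraMap k _ a) (hg : g ^ n = 1)

include hun hg in
/-- The `n`-th power of the twisted action is the scalar `a`, because `g ^ n = 1`. -/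
theorem CohMod.twist_iterate_eq (M : CohMod A) (x : M.sec (triv G k)) :
    (M.twist hu)^[n] x = (a : k) • x := by
  rw [twist_iterate, hun, hg, map_one, algebraMap_smul, Module.End.one_apply]

/-- The functor sending a coherent `A`-module to the corner of its fibre, with the twisted action
of `g`. -/
def cornerFunctor : CohMod A ⥤ RootMod k n a where
  obj M :=
    { carrier := corner ε o (M.sec (triv G k))
      finite := by
        have : Module.Finite k (M.sec (triv G k)) := M.finite (triv G k)
        infer_instance
      root := ((M.twist hu).restrictScalars k).restrict fun _ hx => map_mem_corner _ hx
      root_pow := LinearMap.ext fun x => Subtype.ext (by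
        rw [Module.End.pow_apply]
        refine Eq.trans ?_ (M.twist_iterate_eq hu hun hg x)
        generalize n = i
        induction i with
        | zero => rfl
        | succ i ih =>
          rw [Function.iterate_succ_apply', Function.iterate_succ_apply', ← ih]
          rfl) }
  map φ := ⟨((CohMod.fiberMap φ).restrictScalars k).restrict fun _ hx => map_mem_corner _ hx,
    fun x => Subtype.ext (CohMod.fiberMap_twist hu φ x)⟩

instance : (cornerFunctor ε o hu hun hg).Additive where
  map_add := rfl

instance : (cornerFunctor ε o hu hun hg).Linear k where
  map_smul _ _ := rfl

instance : (cornerFunctor ε o hu hun hg).Faithful where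
  map_injective h := CohMod.hom_ext_fiber (linearMap_ext_corner ε o fun x hx =>
    congrArg Subtype.val (LinearMap.congr_fun (congrArg Subtype.val h) ⟨x, hx⟩))

/-- A map of corners compatible with the twisted actions extends to a linear map of fibres; it is
compatible with the action of the generator `g` since `u` is invertible, so it extends to a morphism
of sheaves. -/
theorem cornerFunctor_full [NeZero (Nat.card G : k)] (hgen : ∀ x, x ∈ Subgroup.zpowers g)
    (hn : n ≠ 0) : (cornerFunctor ε o hu hun hg).Full where
  map_surjective {M N} χ := by
    let ψ : M.sec (triv G k) →ₗ[(A.sec (triv G k))ᵐᵒᵖ] N.sec (triv G k) := cornerExtend χ.1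
    have hcomm : ψ ∘ₗ M.twist hu = N.twist hu ∘ₗ ψ := linearMap_ext_corner ε o fun x hx => by
      have h1 := cornerExtend_apply (ε := ε) χ.1 ⟨x, hx⟩
      have h2 := cornerExtend_apply (ε := ε) χ.1 ⟨M.twist hu x, map_mem_corner _ hx⟩
      refine h2.trans ((congrArg Subtype.val (χ.2 ⟨x, hx⟩)).trans ?_)
      exact congrArg (N.twist hu) h1.symm
    have hψ : ∀ x, ψ (M.toQCohSheaf.rep g x) = N.toQCohSheaf.rep g (ψ x) := fun x => by
      obtain ⟨v, hv⟩ := isUnit_of_pow_eq_algebraMap hn hun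
      have := LinearMap.congr_fun hcomm x
      rw [LinearMap.comp_apply, LinearMap.comp_apply, CohMod.twist_apply, CohMod.twist_apply,
        map_smul, ← hv] at this
      exact MulAction.injective v this
    have hψ' : ∀ h x, ψ.restrictScalars k (M.toQCohSheaf.rep h x) =
        N.toQCohSheaf.rep h (ψ.restrictScalars k x) := fun h x => by
      obtain ⟨i, rfl⟩ := exists_pow_eq_of_forall_mem_zpowers hgen h
      rw [map_pow, map_pow]
      induction i with
      | zero => rfl
      | succ i ih =>
        rw [pow_succ', pow_succ', Module.End.mul_apply, Module.End.mul_apply, ← ih]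
        exact hψ _
    refine ⟨CohMod.homOfFiber ψ hψ', Subtype.ext (LinearMap.ext fun x => Subtype.ext ?_)⟩
    refine Eq.trans ?_ (cornerExtend_apply (ε := ε) χ.1 x)
    exact LinearMap.congr_fun (CohMod.fiberMap_homOfFiber ψ hψ') x.1

include hu hun in
/-- An endomorphism of an `A`-module whose `n`-th power is `a` gives a compatible action of `G`. -/
theorem exists_representation (hgen : ∀ x, x ∈ Subgroup.zpowers g) (hord : orderOf g = n)
    {V : Type u} [AddCommGroup V] [Module k V] [Module (A.op.sec (triv G k)) V]
    [IsScalarTower k (A.op.sec (triv G k)) V] (w : Module.End (A.op.sec (triv G k)) V)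
    (hw : ∀ x, (w ^ n) x = (a : k) • x) : ∃ ρ : Representation k G V,
      (∀ x, (u : A.op.sec (triv G k)) • ρ g x = w x) ∧
        ∀ h (c : A.op.sec (triv G k)) x,
          ρ h (c • x) = (A.op.toQCohSheaf.rep h c : A.op.sec (triv G k)) • ρ h x := by
  have hn : n ≠ 0 := by rw [← hord]; exact (orderOf_pos g).ne'
  obtain ⟨v, rfl⟩ := isUnit_of_pow_eq_algebraMap hn hun
  let f : Module.End k V := Algebra.lsmul k k V (↑v⁻¹ : A.op.sec (triv G k)) * w.restrictScalars k
  have hf : ∀ x, f x = (↑v⁻¹ : A.op.sec (triv G k)) • w x := fun _ => rfl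
  have hfi : ∀ (i : ℕ) x, (f ^ i) x = (↑(v⁻¹ ^ i) : A.op.sec (triv G k)) • (w ^ i) x := by
    intro i
    induction i with
    | zero => intro x; rw [pow_zero, pow_zero, pow_zero]; exact (one_smul _ _).symm
    | succ i ih =>
      intro x
      rw [pow_succ', Module.End.mul_apply, ih, hf, map_smul, smul_smul, pow_succ', pow_succ' w,
        Module.End.mul_apply]
      rfl
  have hfn : f ^ n = 1 := LinearMap.ext fun x => by
    rw [hfi, hw, inv_pow, ← algebraMap_smul (A.op.sec (triv G k)) (a : k) x, smul_smul]
    have : (↑(v ^ n)⁻¹ : A.op.sec (triv G k)) * algebraMap k _ (a : k) = 1 := by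
      rw [Units.inv_mul_eq_one, Units.val_pow_eq_pow_val]
      exact hun
    rw [this, one_smul]
    rfl
  have hconj : ∀ c : A.op.sec (triv G k), (↑v⁻¹ : A.op.sec (triv G k)) * c =
      (A.op.toQCohSheaf.rep g c : A.op.sec (triv G k)) * ↑v⁻¹ := fun c => by
    rw [Units.inv_mul_eq_iff_eq_mul, ← mul_assoc, Units.eq_mul_inv_iff_mul_eq]
    exact (hu c).symm
  let ρ : Representation k G V := (Units.coeHom _).comp (monoidHomOfForallMemZpowers hgen
    (g' := Units.ofPowEqOne f n hfn hn) (by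
      rw [hord]
      exact orderOf_dvd_of_pow_eq_one (Units.pow_ofPowEqOne hfn hn)))
  have hρg : ρ g = f := congrArg Units.val (monoidHomOfForallMemZpowers_apply_gen hgen _)
  refine ⟨ρ, fun x => ?_, fun h c x => ?_⟩
  · rw [hρg, hf, smul_smul]
    exact (congrArg (· • w x) v.mul_inv).trans (one_smul _ _)
  · obtain ⟨i, rfl⟩ := exists_pow_eq_of_forall_mem_zpowers hgen h
    rw [map_pow, map_pow, hρg]
    induction i with
    | zero => rfl
    | succ i ih =>
      have hfc : ∀ (d : A.op.sec (triv G k)) y, f (d • y) =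
          (A.op.toQCohSheaf.rep g d : A.op.sec (triv G k)) • f y := fun d y => by
        rw [hf, map_smul, smul_smul, hconj, mul_smul, hf]
      rw [pow_succ' f, pow_succ', Module.End.mul_apply, ih, hfc]
      rfl

/-- A vector space `W` with an `n`-th root of `a` is the corner of the module of columns with
entries in `W`, on which `G` acts through `exists_representation`. -/
theorem cornerFunctor_essSurj [NeZero (Nat.card G : k)] (hgen : ∀ x, x ∈ Subgroup.zpowers g)
    (hord : orderOf g = n) : (cornerFunctor ε o hu hun hg).EssSurj where
  mem_essImage W := by
    have hn : n ≠ 0 := by rw [← hord]; exact (orderOf_pos g).ne'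
    let _ : Module (A.op.sec (triv G k)) (ι → W.carrier) := columnModule ε W.carrier
    have : IsScalarTower k (A.op.sec (triv G k)) (ι → W.carrier) :=
      columnModule_isScalarTower W.carrier
    let w : Module.End (A.op.sec (triv G k)) (ι → W.carrier) :=
      { toFun := fun f i => W.root (f i)
        map_add' := fun f f' => funext fun i => map_add _ _ _
        map_smul' := fun c f => funext fun i => by
          rw [columnModule_smul_apply, map_sum, RingHom.id_apply, columnModule_smul_apply]
          exact Finset.sum_congr rfl fun j _ => map_smul _ _ _ }
    have hwi : ∀ (i : ℕ) f, (w ^ i) f = fun j => (W.root ^ i) (f j) := by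
      intro i
      induction i with
      | zero => intro f; rfl
      | succ i ih =>
        intro f
        rw [pow_succ', Module.End.mul_apply, ih]
        funext j
        rw [pow_succ', Module.End.mul_apply]
        rfl
    obtain ⟨ρ, hρg, hρ⟩ := exists_representation hu hun hgen hord w fun f => by
      rw [hwi, W.root_pow]
      rfl
    let N : CohMod A := cohModOfRep hρ
    let δ : N.sec (triv G k) ≃ₗ[k] (ι → W.carrier) := descendFiberEquiv ρ
    have hδ : ∀ (c : A.op.sec (triv G k)) x, δ (c • x) = c • δ x :=
      descendFiberEquiv_descendAction hρ
    have hδg : ∀ x, δ (N.twist hu x) = w (δ x) := fun x => by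
      rw [CohMod.twist_apply]
      refine (hδ _ _).trans (Eq.trans ?_ (hρg (δ x)))
      exact congrArg _ (descendFiberEquiv_rep ρ g x)
    have hmem : ∀ x, x ∈ corner ε o (N.sec (triv G k)) ↔ δ x = Pi.single o (δ x o) := fun x => by
      rw [mem_corner, ← mem_corner_columnModule (ε := ε), ← δ.injective.eq_iff]
      exact Eq.congr_left (hδ _ _)
    refine ⟨N, ⟨(RootMod.isoOfLinearEquiv (V := W) (W := (cornerFunctor ε o hu hun hg).obj N)
      (LinearEquiv.ofBijective (LinearMap.codRestrict _ (δ.symm.toLinearMap ∘ₗ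
        LinearMap.single k _ o) fun x => ?_) ⟨fun x y hxy => ?_, fun y => ?_⟩) fun x => ?_).symm⟩⟩
    · rw [hmem, LinearMap.comp_apply, LinearEquiv.coe_coe, LinearEquiv.apply_symm_apply]
      simp
    · have := δ.symm.injective (congrArg Subtype.val hxy)
      exact Pi.single_injective o this
    · refine ⟨δ y.1 o, Subtype.ext (δ.injective ?_)⟩
      refine (δ.apply_symm_apply _).trans ?_
      exact ((hmem y.1).mp y.2).symm
    · apply Subtype.ext
      apply δ.injective
      refine (δ.apply_symm_apply _).trans (Eq.trans ?_ (hδg _).symm)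
      refine Eq.trans ?_ (congrArg w (δ.apply_symm_apply _)).symm
      funext i
      change Pi.single (M := fun _ => W.carrier) o (W.root x) i =
        W.root (Pi.single (M := fun _ => W.carrier) o x i)
      by_cases h : i = o
      · subst h; simp
      · simp [h]

end CornerFunctor

end BG

namespace BG

open CategoryTheory

/-! ### Morita equivalence and classes -/

section Morita

variable {k G : Type u} [Field k] [Group G] [Finite G] [NeZero (Nat.card G : k)]
  [Subsingleton (BrauerGroup.{u, u} k)]

/-- The coherent modules over an Azumaya algebra of class `a` are the finite-dimensional vector
spaces with an `n`-th root of `a`. -/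
theorem AzumayaAlg.exists_equivalence_rootMod (A : AzumayaAlg k G) {n : ℕ} {g : G} {a : kˣ}
    (hgen : ∀ x, x ∈ Subgroup.zpowers g) (hord : orderOf g = n) (h : A.HasClass n g a) :
    ∃ e : CohMod A.toAlgSheaf ≌ RootMod k n a, e.functor.Additive ∧ e.functor.Linear k := by
  obtain ⟨u, hu, hux⟩ := h
  obtain ⟨m, hm, ⟨ψ⟩⟩ := A.exists_fiber_algEquiv_end
  have hn : n ≠ 0 := by rw [← hord]; exact (orderOf_pos g).ne'
  let ε : Matrix (Fin m) (Fin m) k ≃ₐ[k] (A.sec (triv G k))ᵐᵒᵖ :=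
    (Matrix.transposeAlgEquiv (Fin m) k k).trans
      (AlgEquiv.op ((ψ.trans (algEquivMatrix (Pi.basisFun k (Fin m)))).symm))
  have hu' : ∀ c, MulOpposite.op u * A.op.res (trivTranslation k k g) c = c * MulOpposite.op u := fun c =>
    congrArg MulOpposite.op (hux c.unop)
  have hun : MulOpposite.op u ^ n = algebraMap k (A.sec (triv G k))ᵐᵒᵖ a := congrArg MulOpposite.op hu
  have hg : g ^ n = 1 := by rw [← hord, pow_orderOf_eq_one]
  have := cornerFunctor_full ε ⟨0, hm⟩ hu' hun hg hgen hn
  have := cornerFunctor_essSurj ε ⟨0, hm⟩ hu' hun hg hgen hord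
  have : (cornerFunctor ε ⟨0, hm⟩ hu' hun hg).IsEquivalence := { }
  exact ⟨(cornerFunctor ε ⟨0, hm⟩ hu' hun hg).asEquivalence,
    inferInstanceAs (cornerFunctor ε ⟨0, hm⟩ hu' hun hg).Additive,
    inferInstanceAs ((cornerFunctor ε ⟨0, hm⟩ hu' hun hg).Linear k)⟩

/-- Azumaya algebras with the same class are Morita equivalent, even if the classes are taken with
respect to different generators of `G`: both module categories are `RootMod k n a`. -/
theorem MoritaEquivalent.of_hasClass {A B : AzumayaAlg k G} {n : ℕ} {g g' : G} {a : kˣ}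
    (hgen : ∀ x, x ∈ Subgroup.zpowers g) (hord : orderOf g = n)
    (hgen' : ∀ x, x ∈ Subgroup.zpowers g') (hord' : orderOf g' = n)
    (hA : A.HasClass n g a) (hB : B.HasClass n g' a) :
    MoritaEquivalent A.toAlgSheaf B.toAlgSheaf := by
  obtain ⟨e, _, _⟩ := A.exists_equivalence_rootMod hgen hord hA
  obtain ⟨e', _, _⟩ := B.exists_equivalence_rootMod hgen' hord' hB
  exact ⟨e.trans e'.symm, inferInstanceAs (e.functor ⋙ e'.inverse).Additive,
    inferInstanceAs ((e.functor ⋙ e'.inverse).Linear k)⟩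

/-- Over an Azumaya algebra of class `a`, every coherent module has an `n`-th root of `a`. -/
theorem AzumayaAlg.exists_end_pow_eq (A : AzumayaAlg k G) {n : ℕ} {g : G} {a : kˣ}
    (hgen : ∀ x, x ∈ Subgroup.zpowers g) (hord : orderOf g = n) (h : A.HasClass n g a)
    (M : CohMod A.toAlgSheaf) : ∃ y : End M, y ^ n = (a : k) • 𝟙 M := by
  obtain ⟨e, _, _⟩ := A.exists_equivalence_rootMod hgen hord h
  exact exists_end_pow_eq_of_functor e.functor RootMod.exists_end_pow_eq M

end Morita

/-! ### Kummer theory -/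

section Kummer

/-- A root of `a` in a splitting field of `X ^ n - b` shows that `a` is a power of `b` modulo
`n`-th powers. -/
theorem exists_eq_pow_mul_pow_of_root {k L : Type*} [Field k] [Field L] [Algebra k L]
    [FiniteDimensional k L] [IsGalois k L] {n : ℕ} (hn : n ≠ 0)
    (hroots : ∀ x : L, x ^ n = 1 → ∃ c : k, algebraMap k L c = x) {β y : L} {a b : kˣ}
    (hβ : β ^ n = algebraMap k L b) (hy : y ^ n = algebraMap k L a)
    (htop : Algebra.adjoin k {β} = ⊤) : ∃ (i : ℕ) (c : kˣ), a = b ^ i * c ^ n := by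
  have hne : ∀ {x : L} {c : kˣ}, x ^ n = algebraMap k L c → x ≠ 0 := fun {x c} h h0 => by
    rw [h0, zero_pow hn] at h
    exact ((map_ne_zero (algebraMap k L)).mpr c.ne_zero) h.symm
  have hβ0 := hne hβ
  have hy0 := hne hy
  -- the character of the Galois group given by a root of an element of `k`
  have hfix : ∀ {x : L} {c : kˣ}, x ^ n = algebraMap k L c → ∀ σ : L ≃ₐ[k] L,
      ∃ d : k, algebraMap k L d = σ x / x := fun {x c} h σ => hroots _ (by
    rw [div_pow, ← map_pow, h, AlgEquiv.commutes, ← h, div_self (pow_ne_zero n (hne h))])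
  have hmul : ∀ {x : L} {c : kˣ}, x ^ n = algebraMap k L c → ∀ σ τ : L ≃ₐ[k] L,
      (σ * τ) x / x = σ x / x * (τ x / x) := fun {x c} h σ τ => by
    obtain ⟨d, hd⟩ := hfix h τ
    have hτ : τ x = algebraMap k L d * x := by rw [hd, div_mul_cancel₀ _ (hne h)]
    rw [AlgEquiv.mul_apply, hτ, map_mul, AlgEquiv.commutes, mul_div_assoc, mul_comm (algebraMap k L d),
      mul_div_assoc _ x x, div_self (hne h), mul_one, mul_comm]
  have hone : ∀ {x : L} {c : kˣ}, x ^ n = algebraMap k L c → (1 : L ≃ₐ[k] L) x / x = 1 :=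
    fun h => div_self (hne h)
  let χ : (L ≃ₐ[k] L) →* L :=
    { toFun := fun σ => σ β / β
      map_one' := hone hβ
      map_mul' := hmul hβ }
  let χ' : (L ≃ₐ[k] L) →* L :=
    { toFun := fun σ => σ y / y
      map_one' := hone hy
      map_mul' := hmul hy }
  have hχ : Function.Injective χ := fun σ τ h => by
    have h1 : σ β = τ β := (div_left_inj' hβ0).mp h
    have h2 : (σ : L →ₐ[k] L) = τ := AlgHom.ext_of_adjoin_eq_top htop fun x hx => by
      rw [Set.mem_singleton_iff.mp hx]; exact h1
    exact AlgEquiv.coe_toAlgHom_injective h2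
  have := isCyclic_of_injective_ringHom χ hχ
  -- the Galois group is cyclic; on a generator the character of `y` is a power of that of `β`
  obtain ⟨σ, hσ⟩ := IsCyclic.exists_generator (α := L ≃ₐ[k] L)
  have hprim : IsPrimitiveRoot (χ σ) (orderOf σ) := by
    rw [← orderOf_injective χ hχ σ]
    exact IsPrimitiveRoot.orderOf _
  have : NeZero (orderOf σ) := ⟨(orderOf_pos σ).ne'⟩
  obtain ⟨i, -, hi⟩ := hprim.eq_pow_of_pow_eq_one (ξ := χ' σ) (by
    rw [← map_pow, pow_orderOf_eq_one, map_one])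
  -- `y / β ^ i` is invariant under the Galois group
  have hinv : σ (y / β ^ i) = y / β ^ i := by
    have h1 : σ y = χ' σ * y := (div_mul_cancel₀ _ hy0).symm
    have h2 : σ β = χ σ * β := (div_mul_cancel₀ _ hβ0).symm
    have h3 : χ σ ≠ 0 := hprim.ne_zero (orderOf_pos σ).ne'
    rw [map_div₀, map_pow, h1, h2, ← hi, mul_pow, mul_div_mul_left _ _ (pow_ne_zero i h3)]
  have hmem : y / β ^ i ∈ Set.range (algebraMap k L) := by
    rw [IsGalois.mem_range_algebraMap_iff_fixed]
    intro τ
    obtain ⟨j, rfl⟩ := exists_pow_eq_of_forall_mem_zpowers hσ τ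
    induction j with
    | zero => rfl
    | succ j ih => rw [pow_succ, AlgEquiv.mul_apply, hinv, ih]
  obtain ⟨c, hc⟩ := hmem
  have hc0 : c ≠ 0 := by
    rintro rfl
    rw [map_zero] at hc
    exact (div_ne_zero hy0 (pow_ne_zero i hβ0)) hc.symm
  refine ⟨i, Units.mk0 c hc0, Units.ext ((algebraMap k L).injective ?_)⟩
  rw [Units.val_mul, Units.val_pow_eq_pow_val, Units.val_pow_eq_pow_val, map_mul, map_pow, map_pow,
    Units.val_mk0, hc, ← hβ, ← hy, div_pow, ← pow_mul, ← pow_mul, mul_comm i n,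
    mul_div_cancel₀ _ (pow_ne_zero _ hβ0)]

/-- A root of `a` on the object `L`, with endomorphism multiplication by a generator `β`, is
multiplication by an element of `L`. -/
theorem RootMod.exists_pow_eq {k L : Type u} [Field k] [Field L] [Algebra k L]
    [FiniteDimensional k L] {n : ℕ} {a b : kˣ} {β : L} (hβ : β ^ n = algebraMap k L b)
    (htop : Algebra.adjoin k {β} = ⊤)
    (h : ∀ V : RootMod k n b, ∃ y : End V, y ^ n = (a : k) • 𝟙 V) :
    ∃ y : L, y ^ n = algebraMap k L a := by
  let V : RootMod k n b :=
    { carrier := L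
      root := Algebra.lmul k L β
      root_pow := by rw [← map_pow, hβ, AlgHom.commutes] }
  obtain ⟨y, hy⟩ := h V
  let f : L →ₗ[k] L := (y : RootMod.homs V V).1
  have hf : ∀ x, f (β * x) = β * f x := (y : RootMod.homs V V).2
  -- endomorphisms commute with multiplication by `β`, hence with all of `L`
  have hfmul : ∀ z x, f (z * x) = z * f x := by
    intro z
    have hz : z ∈ Algebra.adjoin k {β} := by rw [htop]; trivial
    induction hz using Algebra.adjoin_induction with
    | mem z hz => rw [Set.mem_singleton_iff.mp hz]; exact hf
    | algebraMap c => intro x; rw [← Algebra.smul_def, map_smul, Algebra.smul_def]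
    | add z w _ _ hz hw => intro x; rw [add_mul, map_add, hz, hw, add_mul]
    | mul z w _ _ hz hw => intro x; rw [mul_assoc, hz, hw, mul_assoc]
  have hfn : f ^ n = (a : k) • 1 :=
    (RootMod.coe_end_pow y n).symm.trans (congrArg Subtype.val hy)
  have hpow : ∀ i : ℕ, (f ^ i) 1 = f 1 ^ i := by
    intro i
    induction i with
    | zero => rw [pow_zero, pow_zero]; rfl
    | succ i ih => rw [pow_succ', Module.End.mul_apply, ih, ← mul_one (f 1 ^ i), hfmul, pow_succ]
  refine ⟨f 1, ?_⟩
  rw [← hpow, hfn, Algebra.algebraMap_eq_smul_one]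
  rfl

/-- In a splitting field `L` of `X ^ n - b`, every root `β` generates `L`, so a root of `a` on the
object `L` is a root of `a` in `L`, and Kummer theory applies. -/
theorem RootMod.exists_eq_pow_mul_pow_of_isSplittingField {k : Type u} (L : Type u) [Field k]
    [Field L] [Algebra k L] [FiniteDimensional k L] [IsGalois k L] {n : ℕ} (hn : n ≠ 0)
    (hsplit : (Polynomial.X ^ n - 1 : Polynomial k).Splits) {a b : kˣ}
    [Polynomial.IsSplittingField k L (Polynomial.X ^ n - Polynomial.C (b : k))]
    (h : ∀ V : RootMod k n b, ∃ y : End V, y ^ n = (a : k) • 𝟙 V) :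
    ∃ (i : ℕ) (c : kˣ), a = b ^ i * c ^ n := by
  have hroots : ∀ x : L, x ^ n = 1 → ∃ c : k, algebraMap k L c = x := fun x hx =>
    hsplit.mem_range_of_isRoot (Polynomial.X_pow_sub_C_ne_zero (Nat.pos_of_ne_zero hn) 1)
      (by simp [hx])
  obtain ⟨β, hβ⟩ : ∃ β : L, β ^ n = algebraMap k L b := by
    obtain ⟨β, hβ⟩ := (Polynomial.IsSplittingField.splits L
      (Polynomial.X ^ n - Polynomial.C (b : k))).exists_eval_eq_zero (by
      rw [Polynomial.degree_map, Polynomial.degree_X_pow_sub_C (Nat.pos_of_ne_zero hn)]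
      exact_mod_cast hn)
    exact ⟨β, by simpa [sub_eq_zero] using hβ⟩
  have hb := (map_ne_zero (algebraMap k L)).mpr b.ne_zero
  have hβ0 : β ≠ 0 := by
    rintro rfl
    rw [zero_pow hn] at hβ
    exact hb hβ.symm
  have htop : Algebra.adjoin k {β} = ⊤ := by
    rw [eq_top_iff, ← Polynomial.IsSplittingField.adjoin_rootSet L
      (Polynomial.X ^ n - Polynomial.C (b : k)), Algebra.adjoin_le_iff]
    intro x hx'
    have hx : x ^ n = algebraMap k L b := by
      have := (Polynomial.mem_rootSet.mp hx').2
      simpa [sub_eq_zero] using this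
    -- two roots of `X ^ n - b` differ by a root of unity, which lies in `k`
    obtain ⟨c, hc⟩ := hroots (x / β) (by rw [div_pow, hx, hβ, div_self hb])
    have hxc : x = c • β := by rw [Algebra.smul_def, hc, div_mul_cancel₀ x hβ0]
    rw [hxc]
    exact Subalgebra.smul_mem _ (Algebra.subset_adjoin (Set.mem_singleton β)) c
  obtain ⟨y, hy⟩ := RootMod.exists_pow_eq hβ htop h
  exact exists_eq_pow_mul_pow_of_root hn hroots hβ hy htop

/-- If all vector spaces with an `n`-th root of `b` have an `n`-th root of `a`, then `a` is a power
of `b` modulo `n`-th powers. -/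
theorem RootMod.exists_eq_pow_mul_pow {k : Type u} [Field k] {n : ℕ} (hn : (n : k) ≠ 0)
    (hsplit : (Polynomial.X ^ n - 1 : Polynomial k).Splits) {a b : kˣ}
    (h : ∀ V : RootMod k n b, ∃ y : End V, y ^ n = (a : k) • 𝟙 V) :
    ∃ (i : ℕ) (c : kˣ), a = b ^ i * c ^ n := by
  have hn0 : n ≠ 0 := by rintro rfl; exact hn Nat.cast_zero
  let p : Polynomial k := Polynomial.X ^ n - Polynomial.C (b : k)
  have hsep : p.Separable := Polynomial.separable_X_pow_sub_C _ hn b.ne_zero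
  have hgal : IsGalois k p.SplittingField := IsGalois.of_separable_splitting_field hsep
  exact RootMod.exists_eq_pow_mul_pow_of_isSplittingField p.SplittingField hn0 hsplit h

end Kummer

end BG

namespace BG

open CategoryTheory

/-! ### Automorphisms of the stack -/

section Pullback

variable {k G : Type u} [Field k] [Group G] {A : AlgSheaf k G} {R R' : Type u} [CommRing R]
  [Algebra k R] [CommRing R'] [Algebra k R']

/-- Restriction along a morphism over the identity is a base change along the identity. -/
theorem QCohSheaf.res_bijective (E : QCohSheaf k G) {P P' : Torsor G R}
    (h : TorsorHom (AlgHom.id k R) P P') : Function.Bijective (E.res h) := by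
  obtain ⟨e, he⟩ := (E.baseChange h).exists_equiv fun _ => rfl
  convert ((TensorProduct.lid R (E.sec P)).symm.trans e).bijective using 1
  exact funext fun x => (he x).symm

/-- The pullback of a coherent module along a morphism of stacks. -/
def CohMod.pullback (φ : StackMap k G) (M : CohMod A) : CohMod (A.pullback φ) where
  sec P := M.sec (φ.obj P)
  res h := M.res (φ.map h)
  res_smul h r x := M.res_smul (φ.map h) r x
  res_id P x := by rw [φ.map_id, M.res_id]
  res_comp h' h x := by rw [φ.map_comp, M.res_comp]
  baseChange h := M.baseChange (φ.map h)
  act P := M.act (φ.obj P)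
  tower P := M.tower (φ.obj P)
  res_act h a x := M.res_act (φ.map h) a x
  finite P := M.finite (φ.obj P)

/-- The components of the counit of an automorphism of the stack. -/
def StackAut.counitHom (φ : StackAut k G) (P : Torsor G R) :
    TorsorHom (AlgHom.id k R) (φ.hom.obj (φ.inv.obj P)) P := φ.counit.app P

theorem StackAut.res_counitHom (φ : StackAut k G) (E : QCohSheaf k G) {f : R →ₐ[k] R'}
    {P : Torsor G R} {P' : Torsor G R'} (h : TorsorHom f P P')
    (x : E.sec (φ.hom.obj (φ.inv.obj P))) : E.res h (E.res (φ.counitHom P) x) =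
      E.res (φ.counitHom P') (E.res (φ.hom.map (φ.inv.map h)) x) := by
  rw [← E.res_comp, ← E.res_comp]
  exact E.res_congr (AlgHom.ext fun _ => rfl) (fun y => (φ.counit.naturality h y).symm) x

/-- The isomorphism of the sections of a sheaf given by the counit of an automorphism. -/
noncomputable def StackAut.counitEquiv (φ : StackAut k G) (E : QCohSheaf k G) (P : Torsor G R) :
    E.sec (φ.hom.obj (φ.inv.obj P)) ≃+ E.sec P :=
  AddEquiv.ofBijective (E.res (φ.counitHom P)) (E.res_bijective (φ.counitHom P))

theorem StackAut.counitEquiv_apply (φ : StackAut k G) (E : QCohSheaf k G) (P : Torsor G R)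
    (x : E.sec (φ.hom.obj (φ.inv.obj P))) : φ.counitEquiv E P x = E.res (φ.counitHom P) x := rfl

theorem StackAut.counitEquiv_smul (φ : StackAut k G) (M : CohMod A) (P : Torsor G R)
    (c : (A.sec (φ.hom.obj (φ.inv.obj P)))ᵐᵒᵖ) (x : M.sec (φ.hom.obj (φ.inv.obj P))) :
    φ.counitEquiv M.toQCohSheaf P (c • x) =
      (A.op.res (φ.counitHom P) c : (A.sec P)ᵐᵒᵖ) • φ.counitEquiv M.toQCohSheaf P x :=
  M.res_act (φ.counitHom P) c.unop x

/-- The components of an endomorphism of the pullback of a module. -/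
def StackAut.endApp (φ : StackAut k G) {M : CohMod A} (y : End (M.pullback φ.hom))
    (P : Torsor G R) : M.sec (φ.hom.obj (φ.inv.obj P))
      →ₗ[(A.sec (φ.hom.obj (φ.inv.obj P)))ᵐᵒᵖ] M.sec (φ.hom.obj (φ.inv.obj P)) :=
  CohMod.Hom.app (A := A.pullback φ.hom) y (φ.inv.obj P)

theorem StackAut.endApp_res (φ : StackAut k G) {M : CohMod A} (y : End (M.pullback φ.hom))
    {f : R →ₐ[k] R'} {P : Torsor G R} {P' : Torsor G R'} (h : TorsorHom f P P')
    (x : M.sec (φ.hom.obj (φ.inv.obj P))) :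
    φ.endApp y P' (M.res (φ.hom.map (φ.inv.map h)) x) =
      M.res (φ.hom.map (φ.inv.map h)) (φ.endApp y P x) :=
  CohMod.Hom.naturality (A := A.pullback φ.hom) y (φ.inv.map h) x

/-- An endomorphism of the pullback of a module along an automorphism of the stack gives an
endomorphism of the module, by conjugation with the counit. -/
noncomputable def StackAut.descendEnd (φ : StackAut k G) (M : CohMod A) :
    End (M.pullback φ.hom) →* End M where
  toFun y := End.of
    { app := fun {R} _ _ P =>
        { toFun := fun x => φ.counitEquiv M.toQCohSheaf P (φ.endApp y P
            ((φ.counitEquiv M.toQCohSheaf P).symm x))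
          map_add' := fun x x' => by rw [map_add, map_add, map_add]
          map_smul' := fun c x => by
            obtain ⟨c, rfl⟩ := (A.op.toQCohSheaf.res_bijective (φ.counitHom P)).2 c
            obtain ⟨x, rfl⟩ := (φ.counitEquiv M.toQCohSheaf P).surjective x
            refine (congrArg (fun z => φ.counitEquiv M.toQCohSheaf P (φ.endApp y P
              ((φ.counitEquiv M.toQCohSheaf P).symm z))) (φ.counitEquiv_smul M P c x).symm).trans ?_
            rw [AddEquiv.symm_apply_apply, AddEquiv.symm_apply_apply, map_smul,
              φ.counitEquiv_smul]
            rfl }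
      naturality := fun {R R' _ _ _ _ f P P'} h x => by
        obtain ⟨x, rfl⟩ := (φ.counitEquiv M.toQCohSheaf P).surjective x
        change φ.counitEquiv M.toQCohSheaf P' (φ.endApp y P' ((φ.counitEquiv M.toQCohSheaf P').symm
            (M.res h (φ.counitEquiv M.toQCohSheaf P x)))) =
          M.res h (φ.counitEquiv M.toQCohSheaf P (φ.endApp y P
            ((φ.counitEquiv M.toQCohSheaf P).symm (φ.counitEquiv M.toQCohSheaf P x))))
        have h1 : ∀ z, M.res h (φ.counitEquiv M.toQCohSheaf P z) =
            φ.counitEquiv M.toQCohSheaf P' (M.res (φ.hom.map (φ.inv.map h)) z) :=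
          fun z => φ.res_counitHom M.toQCohSheaf h z
        rw [h1, h1, AddEquiv.symm_apply_apply, AddEquiv.symm_apply_apply, endApp_res] }
  map_one' := CohMod.hom_ext fun P x => (φ.counitEquiv M.toQCohSheaf P).apply_symm_apply x
  map_mul' y z := CohMod.hom_ext fun P x => congrArg
    (fun w => φ.counitEquiv M.toQCohSheaf P (φ.endApp y P w))
    ((φ.counitEquiv M.toQCohSheaf P).symm_apply_apply _).symm

/-- A root of a scalar on the pullback of `M` descends to `M`. -/
theorem StackAut.exists_end_pow_eq (φ : StackAut k G) (M : CohMod A) {n : ℕ} {c : k}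
    (h : ∃ y : End (M.pullback φ.hom), y ^ n = c • 𝟙 (M.pullback φ.hom)) :
    ∃ y : End M, y ^ n = c • 𝟙 M := by
  obtain ⟨y, hy⟩ := h
  refine ⟨φ.descendEnd M y, ?_⟩
  rw [← map_pow, hy]
  refine CohMod.hom_ext fun {R} _ _ P x => ?_
  change φ.counitEquiv M.toQCohSheaf P (algebraMap k R c •
    (φ.counitEquiv M.toQCohSheaf P).symm x) = algebraMap k R c • x
  rw [counitEquiv_apply, M.res_smul]
  exact congrArg (algebraMap k R c • ·) ((φ.counitEquiv M.toQCohSheaf P).apply_symm_apply x)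

/-- The inverse of an automorphism of the stack. -/
def StackAut.symm (φ : StackAut k G) : StackAut k G where
  hom := φ.inv
  inv := φ.hom
  unit := φ.counit
  counit := φ.unit

/-- Pulling back along an automorphism and its inverse gives an isomorphic sheaf of algebras. -/
noncomputable def StackAut.pullbackPullbackIso (φ : StackAut k G) (A : AlgSheaf k G) :
    ((A.pullback φ.hom).pullback φ.inv).Iso A where
  app P := AlgEquiv.ofBijective
    { A.res (φ.counitHom P) with commutes' := A.res_algebraMap (φ.counitHom P) }
    (A.toQCohSheaf.res_bijective (φ.counitHom P))
  naturality h x := (φ.res_counitHom A.toQCohSheaf h x).symm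

end Pullback

section TwistAut

variable {k G : Type u} [Field k] [Group G] {R : Type u} [CommRing R]

theorem translationMap_bijective_of_smul_eq {T T' : Type u} [CommRing T] [Algebra R T]
    [MulSemiringAction G T] [SMulCommClass G R T] [CommRing T'] [Algebra R T']
    [MulSemiringAction G T'] [SMulCommClass G R T'] (α : G ≃* G) (e : T' ≃ₐ[R] T)
    (h : ∀ g t, e (g • t) = α g • e t) (hT : Function.Bijective (translationMap G R T)) :
    Function.Bijective (translationMap G R T') := by
  have key : ⇑(Equiv.arrowCongr (Equiv.refl G) e.toEquiv) ∘ translationMap G R T' =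
      ⇑(Equiv.arrowCongr α.symm.toEquiv (Equiv.refl T)) ∘ translationMap G R T ∘
        Algebra.TensorProduct.congr e e := by
    funext z g
    change e (translationMap G R T' z g) =
      translationMap G R T (Algebra.TensorProduct.congr e e z) (α g)
    induction z with
    | zero => simp only [map_zero, Pi.zero_apply]
    | add z w hz hw => simp only [map_add, Pi.add_apply, hz, hw]
    | tmul a b =>
      rw [translationMap_tmul, Algebra.TensorProduct.congr_apply, Algebra.TensorProduct.map_tmul,
        translationMap_tmul, map_mul, h]
      rfl
  rw [← Function.Bijective.of_comp_iff' (Equiv.bijective _), key]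
  exact (Equiv.bijective _).comp (hT.comp (AlgEquiv.bijective _))

/-- The torsor with the action of `G` changed by an automorphism `α` of `G`. -/
def Torsor.twist (α : G ≃* G) (P : Torsor G R) : Torsor G R where
  carrier := P.carrier
  action := MulSemiringAction.compHom P.carrier α.toMonoidHom
  smulComm := letI := MulSemiringAction.compHom P.carrier α.toMonoidHom
    ⟨fun g r t => smul_comm (α g) r t⟩
  etale := P.etale
  faithfullyFlat := P.faithfullyFlat
  bijective := @translationMap_bijective_of_smul_eq G _ R _ P.carrier P.carrier _ _ _ _ _ _
    (MulSemiringAction.compHom P.carrier α.toMonoidHom)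
    (letI := MulSemiringAction.compHom P.carrier α.toMonoidHom;
      ⟨fun g r t => smul_comm (α g) r t⟩) α AlgEquiv.refl (fun _ _ => rfl) P.bijective

variable (k) in
/-- The endomorphism of the stack given by an automorphism of `G`. -/
def StackMap.twist (α : G ≃* G) : StackMap k G where
  obj P := P.twist α
  map h :=
    { toRingHom := h.toRingHom
      map_algebraMap := h.map_algebraMap
      map_smul := fun g x => h.map_smul (α g) x }
  map_id _ := rfl
  map_comp _ _ := rfl

variable (k) in
/-- The automorphism of the stack given by an automorphism of `G`. -/
def StackAut.twist (α : G ≃* G) : StackAut k G where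
  hom := StackMap.twist k α
  inv := StackMap.twist k α.symm
  unit :=
    { app := fun P =>
        { toRingHom := RingHom.id P.carrier
          map_algebraMap := fun _ => rfl
          map_smul := fun g x => congrArg (· • (show P.carrier from x)) (α.apply_symm_apply g) }
      naturality := fun _ _ => rfl }
  counit :=
    { app := fun P =>
        { toRingHom := RingHom.id P.carrier
          map_algebraMap := fun _ => rfl
          map_smul := fun g x => congrArg (· • (show P.carrier from x)) (α.symm_apply_apply g) }
      naturality := fun _ _ => rfl }

variable [Finite G]

variable (k) in
/-- The twist of the trivial torsor is trivial. -/
def trivTwist (α : G ≃* G) : TorsorHom (AlgHom.id k k) (triv G k) ((triv G k).twist α) where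
  toRingHom :=
    { toFun := fun (f : G → k) => (fun h => f (α.symm h) : G → k)
      map_one' := rfl
      map_mul' := fun _ _ => rfl
      map_zero' := rfl
      map_add' := fun _ _ => rfl }
  map_algebraMap _ := rfl
  map_smul g f := funext fun h => by
    change (f : G → k) (α.symm h * g) = (f : G → k) (α.symm (h * α g))
    rw [map_mul, α.symm_apply_apply]

/-- Pulling back along the automorphism given by `α` changes the generator used to define the
class. -/
theorem AlgSheaf.HasClass.pullback_twist {A : AlgSheaf k G} {n : ℕ} {g : G} {a : kˣ} (α : G ≃* G)
    (h : A.HasClass n (α.symm g) a) : (A.pullback (StackMap.twist k α)).HasClass n g a := by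
  obtain ⟨u, hu, hux⟩ := h
  refine ⟨A.res (trivTwist k α) u, ?_, fun x => ?_⟩
  · refine (map_pow (A.res (trivTwist k α)) u n).symm.trans ?_
    rw [hu]
    exact A.res_algebraMap _ _
  · obtain ⟨x, rfl⟩ := (A.toQCohSheaf.res_bijective (trivTwist k α)).2 x
    have h1 : A.res ((StackMap.twist k α).map (trivTranslation k k g)) (A.res (trivTwist k α) x) =
        A.res (trivTwist k α) (A.res (trivTranslation k k (α.symm g)) x) := by
      refine (A.res_comp _ _ x).symm.trans (Eq.trans ?_ (A.res_comp _ _ x))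
      refine A.toQCohSheaf.res_congr rfl (fun f => funext fun h => ?_) x
      change (f : G → k) (α.symm (g⁻¹ * h)) = (f : G → k) ((α.symm g)⁻¹ * α.symm h)
      rw [map_mul, map_inv]
    refine (congrArg (· * A.res (trivTwist k α) u) h1).trans ?_
    refine (map_mul (A.res (trivTwist k α)) _ u).symm.trans ?_
    rw [hux]
    exact map_mul (A.res (trivTwist k α)) u x

end TwistAut

end BG

namespace BG

open CategoryTheory

/-! ### Subgroups of the Brauer group -/

/-- A generator of `⟨y⟩` is a power of `y` with exponent prime to any given multiple `n` of the
order of `y`. -/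
theorem exists_coprime_of_zpowers_eq {H : Type*} [Group H] {n : ℕ} (hn : n ≠ 0) {x y : H}
    (hy : y ^ n = 1) (h : Subgroup.zpowers x = Subgroup.zpowers y) :
    ∃ i : ℕ, n.Coprime i ∧ x = y ^ i := by
  have hord : orderOf x = orderOf y := by
    rw [← Nat.card_zpowers, h, Nat.card_zpowers]
  have hpos : 0 < orderOf y := orderOf_pos_iff.mpr (isOfFinOrder_iff_pow_eq_one.mpr
    ⟨n, Nat.pos_of_ne_zero hn, hy⟩)
  have hx : x ∈ Subgroup.zpowers y := h ▸ Subgroup.mem_zpowers x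
  have hfin : IsOfFinOrder y := orderOf_pos_iff.mp hpos
  obtain ⟨j, rfl⟩ : ∃ j : ℕ, y ^ j = x := hfin.mem_powers_iff_mem_zpowers.mpr hx
  have hgcd : (orderOf y).Coprime j := by
    rw [hfin.orderOf_pow] at hord
    exact (Nat.div_eq_self.mp hord).resolve_left hpos.ne'
  -- an integer prime to the order of `y` may be changed modulo that order to be prime to `n`
  have hdvd : orderOf y ∣ n := orderOf_dvd_of_pow_eq_one hy
  obtain ⟨v, hv⟩ := ZMod.unitsMap_surjective (hm := ⟨hn⟩) hdvd (ZMod.unitOfCoprime j hgcd.symm)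
  have : NeZero n := ⟨hn⟩
  refine ⟨(v : ZMod n).val, (ZMod.val_coe_unit_coprime v).symm, ?_⟩
  rw [pow_eq_pow_iff_modEq, ← ZMod.natCast_eq_natCast_iff, ZMod.natCast_val]
  have h1 := congrArg Units.val hv
  rw [ZMod.unitsMap_val, ZMod.coe_unitOfCoprime] at h1
  exact h1.symm

section Classification

variable {k G : Type u} [Field k] [CommGroup G] [Finite G] [NeZero (Nat.card G : k)]
  [Subsingleton (BrauerGroup.{u, u} k)] {n : ℕ} {g : G} {A B : AzumayaAlg k G}

theorem classHom_surjective (hn : n ≠ 0) (hg : g ^ n = 1) (hgen : ∀ x, x ∈ Subgroup.zpowers g)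
    (hord : orderOf g = n) : Function.Surjective (classHom k hn hg) := by
  rintro ⟨a⟩
  obtain ⟨A, hA⟩ := exists_azumayaAlg_hasClass (k := k) hn hgen hord a
  exact ⟨A.cls, classHom_cls hn hg hA⟩

/-- Powers in the Brauer group, in terms of classes in `kˣ`. -/
theorem cls_eq_pow_iff (hn : n ≠ 0) (hgen : ∀ x, x ∈ Subgroup.zpowers g) (hord : orderOf g = n)
    {a b : kˣ} (ha : A.HasClass n g a) (hb : B.HasClass n g b) (i : ℕ) :
    A.cls = B.cls ^ i ↔ ∃ c : kˣ, a = b ^ i * c ^ n := by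
  have hg : g ^ n = 1 := by rw [← hord, pow_orderOf_eq_one]
  rw [← (classHom_injective hn hg hgen hord).eq_iff, map_pow, classHom_cls hn hg ha,
    classHom_cls hn hg hb, ← QuotientGroup.mk_pow, eq_comm, QuotientGroup.eq, MonoidHom.mem_range]
  refine exists_congr fun c => ?_
  rw [powMonoidHom_apply, eq_inv_mul_iff_mul_eq, eq_comm]

theorem cls_pow_eq_one (hn : n ≠ 0) (hgen : ∀ x, x ∈ Subgroup.zpowers g) (hord : orderOf g = n)
    (A : AzumayaAlg k G) : A.cls ^ n = 1 := by
  have hg : g ^ n = 1 := by rw [← hord, pow_orderOf_eq_one]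
  obtain ⟨a, ha⟩ := A.exists_hasClass hg
  apply classHom_injective hn hg hgen hord
  rw [map_pow, map_one, classHom_cls hn hg ha, ← QuotientGroup.mk_pow, QuotientGroup.eq_one_iff]
  exact ⟨a, rfl⟩

/-- If all coherent modules over `B` have an `n`-th root of `a`, then an algebra of class `a` lies
in the subgroup generated by `B`. -/
theorem cls_mem_zpowers_of_forall_exists (hn : (n : k) ≠ 0)
    (hsplit : (Polynomial.X ^ n - 1 : Polynomial k).Splits)
    (hgen : ∀ x, x ∈ Subgroup.zpowers g) (hord : orderOf g = n) {a : kˣ} (ha : A.HasClass n g a)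
    (h : ∀ M : CohMod B.toAlgSheaf, ∃ y : End M, y ^ n = (a : k) • 𝟙 M) :
    A.cls ∈ Subgroup.zpowers B.cls := by
  have hn0 : n ≠ 0 := by rintro rfl; exact hn Nat.cast_zero
  have hg : g ^ n = 1 := by rw [← hord, pow_orderOf_eq_one]
  obtain ⟨b, hb⟩ := B.exists_hasClass hg
  obtain ⟨e, _, _⟩ := B.exists_equivalence_rootMod hgen hord hb
  obtain ⟨i, hi⟩ := RootMod.exists_eq_pow_mul_pow hn hsplit
    (exists_end_pow_eq_of_functor e.inverse h)
  rw [(cls_eq_pow_iff hn0 hgen hord ha hb i).mpr hi]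
  exact Subgroup.npow_mem_zpowers _ _

omit [Finite G] [NeZero (Nat.card G : k)] [Subsingleton (BrauerGroup.{u, u} k)] in
theorem MoritaEquivalent.symm {A B : AlgSheaf k G} (h : MoritaEquivalent A B) :
    MoritaEquivalent B A := by
  obtain ⟨e, _, _⟩ := h
  exact ⟨e.symm, inferInstanceAs e.inverse.Additive, inferInstanceAs (e.inverse.Linear k)⟩

/-- Over `A` every coherent module has an `n`-th root of the class of `A`; an equivalence carries
this property to the modules over `B`. -/
theorem MoritaEquivalent.cls_mem_zpowers (hn : (n : k) ≠ 0)
    (hsplit : (Polynomial.X ^ n - 1 : Polynomial k).Splits)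
    (hgen : ∀ x, x ∈ Subgroup.zpowers g) (hord : orderOf g = n)
    (h : MoritaEquivalent A.toAlgSheaf B.toAlgSheaf) : A.cls ∈ Subgroup.zpowers B.cls := by
  obtain ⟨e, _, _⟩ := h
  obtain ⟨a, ha⟩ := A.exists_hasClass (n := n) (g := g) (by rw [← hord, pow_orderOf_eq_one])
  exact cls_mem_zpowers_of_forall_exists hn hsplit hgen hord ha
    (exists_end_pow_eq_of_functor e.inverse (A.exists_end_pow_eq hgen hord ha))

/-- Over the pullback of `B` every coherent module has an `n`-th root of its class; for pullbacks of
`B`-modules this root descends. -/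
theorem StackAut.cls_pullback_mem_zpowers (hn : (n : k) ≠ 0)
    (hsplit : (Polynomial.X ^ n - 1 : Polynomial k).Splits)
    (hgen : ∀ x, x ∈ Subgroup.zpowers g) (hord : orderOf g = n) (φ : StackAut k G)
    (B : AzumayaAlg k G) : (B.pullback φ.hom).cls ∈ Subgroup.zpowers B.cls := by
  obtain ⟨a, ha⟩ := (B.pullback φ.hom).exists_hasClass (n := n) (g := g)
    (by rw [← hord, pow_orderOf_eq_one])
  exact cls_mem_zpowers_of_forall_exists hn hsplit hgen hord ha fun M =>
    φ.exists_end_pow_eq M ((B.pullback φ.hom).exists_end_pow_eq hgen hord ha (M.pullback φ.hom))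

/-- An automorphism of the stack preserves the subgroup generated by a class: the reverse inclusion
is `StackAut.cls_pullback_mem_zpowers` for the inverse. -/
theorem StackAut.zpowers_cls_pullback (hn : (n : k) ≠ 0)
    (hsplit : (Polynomial.X ^ n - 1 : Polynomial k).Splits)
    (hgen : ∀ x, x ∈ Subgroup.zpowers g) (hord : orderOf g = n) (φ : StackAut k G)
    (B : AzumayaAlg k G) :
    Subgroup.zpowers (B.pullback φ.hom).cls = Subgroup.zpowers B.cls := by
  refine le_antisymm (Subgroup.zpowers_le.mpr
    (φ.cls_pullback_mem_zpowers hn hsplit hgen hord B)) (Subgroup.zpowers_le.mpr ?_)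
  have h := φ.symm.cls_pullback_mem_zpowers hn hsplit hgen hord (B.pullback φ.hom)
  have h1 : ((B.pullback φ.hom).pullback φ.symm.hom).cls = B.cls :=
    Quotient.sound (BrauerEquiv.of_iso (φ.pullbackPullbackIso B.toAlgSheaf))
  rwa [h1] at h

/-- If two classes generate the same subgroup, representatives in `kˣ` can be chosen so that one is
a power of the other with exponent prime to `n`. -/
theorem exists_hasClass_pow_of_zpowers_eq (hn : n ≠ 0) (hgen : ∀ x, x ∈ Subgroup.zpowers g)
    (hord : orderOf g = n) (h : Subgroup.zpowers A.cls = Subgroup.zpowers B.cls) :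
    ∃ (i : ℕ) (b : kˣ), n.Coprime i ∧ A.HasClass n g (b ^ i) ∧ B.HasClass n g b := by
  have hg : g ^ n = 1 := by rw [← hord, pow_orderOf_eq_one]
  obtain ⟨i, hi, hAB⟩ := exists_coprime_of_zpowers_eq hn (cls_pow_eq_one hn hgen hord B) h
  obtain ⟨a, ha⟩ := A.exists_hasClass hg
  obtain ⟨b, hb⟩ := B.exists_hasClass hg
  obtain ⟨c, hc⟩ := (cls_eq_pow_iff hn hgen hord ha hb i).mp hAB
  refine ⟨i, b, hi, ?_, hb⟩
  have := ha.mul_pow c⁻¹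
  rwa [hc, inv_pow, mul_inv_cancel_right] at this

theorem pow_generator {i : ℕ} (hi : n.Coprime i) (hgen : ∀ x, x ∈ Subgroup.zpowers g)
    (hord : orderOf g = n) : (∀ x, x ∈ Subgroup.zpowers (g ^ i)) ∧ orderOf (g ^ i) = n := by
  have h1 : orderOf (g ^ i) = n := by
    rw [Nat.Coprime.orderOf_pow (hord ▸ hi), hord]
  refine ⟨fun x => ?_, h1⟩
  have h2 : Subgroup.zpowers (g ^ i) = Subgroup.zpowers g :=
    Subgroup.eq_of_le_of_card_ge (Subgroup.zpowers_le.mpr (Subgroup.npow_mem_zpowers g i))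
      (by rw [Nat.card_zpowers, Nat.card_zpowers, h1, hord])
  rw [h2]
  exact hgen x

theorem moritaEquivalent_iff_zpowers_eq (hn : (n : k) ≠ 0)
    (hsplit : (Polynomial.X ^ n - 1 : Polynomial k).Splits)
    (hgen : ∀ x, x ∈ Subgroup.zpowers g) (hord : orderOf g = n) :
    MoritaEquivalent A.toAlgSheaf B.toAlgSheaf ↔
      Subgroup.zpowers A.cls = Subgroup.zpowers B.cls := by
  have hn0 : n ≠ 0 := by rintro rfl; exact hn Nat.cast_zero
  refine ⟨fun h => le_antisymm
    (Subgroup.zpowers_le.mpr (h.cls_mem_zpowers hn hsplit hgen hord))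
    (Subgroup.zpowers_le.mpr (h.symm.cls_mem_zpowers hn hsplit hgen hord)), fun h => ?_⟩
  obtain ⟨i, b, hi, hA, hB⟩ := exists_hasClass_pow_of_zpowers_eq hn0 hgen hord h
  -- the class of `B` with respect to the generator `g ^ i` is that of `A` with respect to `g`
  obtain ⟨hgen', hord'⟩ := pow_generator hi hgen hord
  exact MoritaEquivalent.of_hasClass hgen hord hgen' hord' hA (hB.pow i)

theorem zpowers_eq_iff_exists_stackAut (hn : (n : k) ≠ 0)
    (hsplit : (Polynomial.X ^ n - 1 : Polynomial k).Splits)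
    (hgen : ∀ x, x ∈ Subgroup.zpowers g) (hord : orderOf g = n) :
    Subgroup.zpowers A.cls = Subgroup.zpowers B.cls ↔
      ∃ φ : StackAut k G, A.cls = (B.pullback φ.hom).cls := by
  have hn0 : n ≠ 0 := by rintro rfl; exact hn Nat.cast_zero
  refine ⟨fun h => ?_, fun ⟨φ, hφ⟩ => by
    rw [hφ, φ.zpowers_cls_pullback hn hsplit hgen hord B]⟩
  obtain ⟨i, b, hi, hA, hB⟩ := exists_hasClass_pow_of_zpowers_eq hn0 hgen hord h
  have hcard : (Nat.card G).Coprime i := by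
    rwa [← orderOf_eq_card_of_forall_mem_zpowers hgen, hord]
  -- the automorphism of the stack induced by `g ↦ g ^ i` turns the class `b` of `B` into `b ^ i`
  let α : G ≃* G := { powCoprime hcard with map_mul' := fun x y => mul_pow x y i }
  have hα : α.symm.symm g = g ^ i := rfl
  refine ⟨StackAut.twist k α.symm, ?_⟩
  have hB' : (B.pullback (StackAut.twist k α.symm).hom).HasClass n g (b ^ i) :=
    AlgSheaf.HasClass.pullback_twist α.symm (by rw [hα]; exact hB.pow i)
  rw [← pow_one (B.pullback _).cls]
  exact (cls_eq_pow_iff hn0 hgen hord hA hB' 1).mpr ⟨1, by simp⟩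

end Classification

end BG

theorem theorem4p9 {k : Type u} [Field k] (n : ℕ) (hn : (n : k) ≠ 0)
    (hroots : (Polynomial.X ^ n - 1 : Polynomial k).Splits)
    (hBr : Subsingleton (BrauerGroup.{u, u} k)) :
    Nonempty (BG.Br k (rootsOfUnity n k) ≃* kˣ ⧸ (powMonoidHom n : kˣ →* kˣ).range) ∧
    ∀ A B : BG.AzumayaAlg k (rootsOfUnity n k),
      (BG.MoritaEquivalent A.toAlgSheaf B.toAlgSheaf ↔
        Subgroup.zpowers A.cls = Subgroup.zpowers B.cls) ∧
      (BG.MoritaEquivalent A.toAlgSheaf B.toAlgSheaf ↔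
        ∃ φ : BG.StackAut k (rootsOfUnity n k), A.cls = (B.pullback φ.hom).cls) := by
  have hn0 : n ≠ 0 := by rintro rfl; exact hn Nat.cast_zero
  have : NeZero n := ⟨hn0⟩
  have hcard : Nat.card (rootsOfUnity n k) = n := by
    classical
    have h1 : (Polynomial.nthRoots n (1 : k)).Nodup :=
      Polynomial.nodup_roots (Polynomial.separable_X_pow_sub_C 1 hn one_ne_zero)
    have h2 : Multiset.card (Polynomial.nthRoots n (1 : k)) = n :=
      (hroots.natDegree_eq_card_roots).symm.trans (Polynomial.natDegree_X_pow_sub_C (r := (1 : k)))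
    rw [Nat.card_congr (rootsOfUnityEquivNthRoots k n), Nat.card_eq_fintype_card,
      Fintype.card_of_subtype (Polynomial.nthRoots n (1 : k)).toFinset
        fun _ => Multiset.mem_toFinset, Multiset.toFinset_card_of_nodup h1, h2]
  have : NeZero (Nat.card (rootsOfUnity n k) : k) := ⟨by rwa [hcard]⟩
  obtain ⟨g, hgen⟩ := IsCyclic.exists_generator (α := rootsOfUnity n k)
  have hord : orderOf g = n := by rw [orderOf_eq_card_of_forall_mem_zpowers hgen, hcard]
  have hg : g ^ n = 1 := orderOf_dvd_iff_pow_eq_one.mp (dvd_of_eq hord)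
  refine ⟨⟨MulEquiv.ofBijective (BG.classHom k hn0 hg)
    ⟨BG.classHom_injective hn0 hg hgen hord, BG.classHom_surjective hn0 hg hgen hord⟩⟩,
    fun A B => ⟨BG.moritaEquivalent_iff_zpowers_eq hn hroots hgen hord, ?_⟩⟩
  rw [BG.moritaEquivalent_iff_zpowers_eq hn hroots hgen hord,
    BG.zpowers_eq_iff_exists_stackAut hn hroots hgen hord]
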